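/- Let $\Sigma$ be a compact connected Riemann surface with a conformal Riemannian metric $g$ of constant curvature, let $\omega$ be its area form, and equip $\Sigma\times\Sigma$ with the product metric and the symplectic form $\omega\ominus\omega=\mathrm{pr}_1^*\omega-\mathrm{pr}_2^*\omega$. For a smooth symplectic isotopy $\varphi=\{\varphi_s\}_{0\le s\le 1}$ of $(\Sigma,\omega)$ with $\varphi_0=\mathrm{id}$, generated by the time-dependent vector field $X_s$ (that is, $\partial_s\varphi_s=X_s\circ\varphi_s$), let its flux class be $$\mathrm{Flux}(\varphi)=\Big[\int_0^1\varphi_s^*(i_{X_s}\omega)\,ds\Big]\in H^1(\Sigma,\mathbb R).$$ A diffeomorphism $f$ of $\Sigma$ is Hamiltonian, $f\in \mathrm{Ham}(\Sigma)$, if it is the time-one map of such an isotopy with zero flux class. Let $f\in\mathrm{Ham}(\Sigma)$, and suppose that its graph $S=\{(x,f(x))\}\subset\Sigma\times\Sigma$ has zero Maslov class, that is, $\frac{2}{\pi}[i_H(\omega\ominus\omega)]=0$ in $H^1(S,\mathbb R)$, where $H$ is the mean curvature vector of $S$. Let $0<T\le\infty$ and let $\{f_t\}_{0\le t<T}$ be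 the mean curvature flow of $f$: a smooth family of symplectomorphisms of $\Sigma$ with $f_0=f$ whose graphs move by mean curvature, i.e. have a smooth family of parametrizations $F_t:\Sigma\to\Sigma\times\Sigma$ by immersions, $F_0(x)=(x,f(x))$, with $(\partial_tF_t)^\perp$ equal to the mean curvature vector of $F_t$. Then the flux class of every symplectic isotopy $\{\varphi_s\}_{0\le s\le1}$ from $\mathrm{id}$ to $f$ is preserved along the flow: there are smooth two-parameter families $\{f_{s,t}\}_{0\le s\le 1,\,0\le t<T}$ such that $f_{s,0}=\varphi_s$ and, for each $t$, $\{f_{s,t}\}_s$ is a symplectic isotopy from $\mathrm{id}$ to $f_t$; and for every such family and every $t\in[0,T)$, $$\mathrm{Flux}(\{f_{s,t}\}_s)=\mathrm{Flux}(\{\varphi_s\}_s)\quad\text{in } H^1(\Sigma,\mathbb R).$$ -/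

import Mathlib

open Set
open scoped Manifold ContDiff

/-- A Riemann surface (a one-dimensional complex manifold) is in particular a smooth real surface. -/
instance RiemannSurface.isManifold_real {S : Type*} [TopologicalSpace S] [ChartedSpace ℂ S]
    [IsManifold 𝓘(ℂ) ω S] : IsManifold 𝓘(ℝ, ℂ) ∞ S := by
  refine isManifold_of_contDiffOn 𝓘(ℝ, ℂ) ∞ S fun e e' he he' => ?_
  have h := ((contDiffGroupoid ω 𝓘(ℂ)).compatible he he')
  rw [contDiffGroupoid, mem_groupoid_of_pregroupoid] at h
  have h1 : ContDiffOn ℂ ω (e.symm ≫ₕ e') (𝓘(ℂ).symm ⁻¹' (e.symm ≫ₕ e').source ∩ range 𝓘(ℂ)) := h.1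
  exact (h1.restrict_scalars ℝ).of_le le_top

noncomputable section

namespace RiemannSurface

variable {S : Type*} [TopologicalSpace S] [ChartedSpace ℂ S] [IsManifold 𝓘(ℂ) ω S]

/-! ### Conformal metrics, area form, curvature

Throughout, Mathlib's tangent space `T_p S = TangentSpace 𝓘(ℝ, ℂ) p` is the model space `ℂ`: a vector
is represented by its coordinate in the preferred holomorphic chart `chartAt ℂ p`. -/

/-- The complex structure `J` of `T_p S`: multiplication by `i` in a holomorphic chart. -/
def J (p : S) (u : TangentSpace 𝓘(ℝ, ℂ) p) : TangentSpace 𝓘(ℝ, ℂ) p :=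
  (Complex.I * (show ℂ from u) : ℂ)

variable (S) in
/-- Smooth Riemannian metrics on the real surface underlying `S`. -/
abbrev Metric := Bundle.ContMDiffRiemannianMetric 𝓘(ℝ, ℂ) ∞ ℂ
  (fun p : S => TangentSpace 𝓘(ℝ, ℂ) p)

/-- The metric is compatible with the complex structure. -/
def IsConformal (g : Metric S) : Prop :=
  ∀ (p : S) (u v : TangentSpace 𝓘(ℝ, ℂ) p), g.inner p (J p u) (J p v) = g.inner p u v

/-- The area (Kähler) form `ω(u, v) = g(J u, v)`. -/
def areaForm (g : Metric S) (p : S) (u v : TangentSpace 𝓘(ℝ, ℂ) p) : ℝ :=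
  g.inner p (J p u) v

/-- The density `ρ` of a conformal metric in a chart `e`, in which the metric is `ρ |dz|²`:
`ρ(z) = g(∂/∂x, ∂/∂x)` at the point with coordinate `z`. -/
def density (g : Metric S) (e : OpenPartialHomeomorph S ℂ) (z : ℂ) : ℝ :=
  g.inner (e.symm z) (mfderiv 𝓘(ℝ, ℂ) 𝓘(ℝ, ℂ) e.symm z (1 : ℂ))
    (mfderiv 𝓘(ℝ, ℂ) 𝓘(ℝ, ℂ) e.symm z (1 : ℂ))

/-- The Gauss curvature `K = - Δ (log ρ) / (2 ρ)` of `ρ |dz|²`, in a chart `e`. -/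
def gaussCurvature (g : Metric S) (e : OpenPartialHomeomorph S ℂ) (z : ℂ) : ℝ :=
  -Laplacian.laplacian (fun w => Real.log (density g e w)) z / (2 * density g e z)

/-- The metric has constant curvature `c`. -/
def HasConstantCurvature (g : Metric S) (c : ℝ) : Prop :=
  ∀ e ∈ atlas ℂ S, ∀ z ∈ e.target, gaussCurvature g e z = c

/-- The Wirtinger derivative `∂φ/∂z = (∂φ/∂x - i ∂φ/∂y) / 2` of a real function. -/
def wirtinger (φ : ℂ → ℝ) (z : ℂ) : ℂ :=
  ((fderiv ℝ φ z 1 : ℂ) - Complex.I * (fderiv ℝ φ z Complex.I : ℂ)) / 2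

/-- The Christoffel symbols at `p`, in the preferred chart, of the Levi-Civita connection of the
conformal metric `ρ |dz|²`: `Γ(u, v) = (∂ log ρ / ∂z) u v`. -/
def christoffel (g : Metric S) (p : S) (u v : TangentSpace 𝓘(ℝ, ℂ) p) : ℂ :=
  wirtinger (fun w => Real.log (density g (chartAt ℂ p) w)) (chartAt ℂ p p) *
    (show ℂ from u) * (show ℂ from v)

/-! ### The Kähler surface `S × S` and maps into it -/

/-- The tangent space of `S × S`. -/
abbrev TangentProd (p : S × S) : Type := TangentSpace 𝓘(ℝ, ℂ) p.1 × TangentSpace 𝓘(ℝ, ℂ) p.2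

/-- The product metric on `S × S`. -/
def prodMetric (g : Metric S) (p : S × S) (u v : TangentProd p) : ℝ :=
  g.inner p.1 u.1 v.1 + g.inner p.2 u.2 v.2

/-- The symplectic form `ω ⊖ ω = pr₁^* ω - pr₂^* ω` on `S × S`. -/
def prodForm (g : Metric S) (p : S × S) (u v : TangentProd p) : ℝ :=
  areaForm g p.1 u.1 v.1 - areaForm g p.2 u.2 v.2

/-- The differential of a map `F : S → S × S`. -/
def pushforward (F : S → S × S) (x : S) (v : TangentSpace 𝓘(ℝ, ℂ) x) : TangentProd (F x) :=
  (mfderiv 𝓘(ℝ, ℂ) 𝓘(ℝ, ℂ) (fun y => (F y).1) x v,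
    mfderiv 𝓘(ℝ, ℂ) 𝓘(ℝ, ℂ) (fun y => (F y).2) x v)

/-- The coordinate frame `∂/∂x, ∂/∂y` of `T_x S` in the preferred chart. -/
def frame (x : S) : Fin 2 → TangentSpace 𝓘(ℝ, ℂ) x := ![(1 : ℂ), Complex.I]

/-- The matrix of the induced metric `F^* (g ⊕ g)` in the coordinate frame at `x`. -/
def inducedMetric (g : Metric S) (F : S → S × S) (x : S) : Matrix (Fin 2) (Fin 2) ℝ :=
  fun i j => prodMetric g (F x) (pushforward F x (frame x i)) (pushforward F x (frame x j))

/-- The component of `w ∈ T_{F(x)} (S × S)` normal to the image of the differential of `F`. -/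
def normalPart (g : Metric S) (F : S → S × S) (x : S) (w : TangentProd (F x)) :
    TangentProd (F x) :=
  w - ∑ i, ∑ j, ((inducedMetric g F x)⁻¹ i j * prodMetric g (F x) w (pushforward F x (frame x i))) •
    pushforward F x (frame x j)

/-- For a map `h : S → S`, the covariant derivative `∇_{∂_u} (dh(∂_v))` at `x` of the vector field
`dh(∂_v)` along `h`, where `∂_u, ∂_v` are the coordinate fields with constant coefficients `u, v`:
`∂_u ∂_v h + Γ(∂_u h, ∂_v h)` in the preferred charts. -/
def secondDeriv (g : Metric S) (h : S → S) (x : S) (u v : TangentSpace 𝓘(ℝ, ℂ) x) :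
    TangentSpace 𝓘(ℝ, ℂ) (h x) :=
  (fderiv ℝ (fderiv ℝ (writtenInExtChartAt 𝓘(ℝ, ℂ) 𝓘(ℝ, ℂ) x h)) (extChartAt 𝓘(ℝ, ℂ) x x)
      (show ℂ from u) (show ℂ from v) +
    christoffel g (h x) (mfderiv 𝓘(ℝ, ℂ) 𝓘(ℝ, ℂ) h x u) (mfderiv 𝓘(ℝ, ℂ) 𝓘(ℝ, ℂ) h x v) : ℂ)

/-- The mean curvature vector at `x` of an immersion `F : S → S × S`: the trace, with respect to
the induced metric, of the second fundamental form `(∇_{∂_i} (dF ∂_j))^⊥`. -/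
def meanCurvature (g : Metric S) (F : S → S × S) (x : S) : TangentProd (F x) :=
  ∑ i, ∑ j, (inducedMetric g F x)⁻¹ i j •
    normalPart g F x
      (secondDeriv g (fun y => (F y).1) x (frame x i) (frame x j),
        secondDeriv g (fun y => (F y).2) x (frame x i) (frame x j))

/-- The time interval `[0, T)`, `0 < T ≤ ∞`. -/
def timeInterval (T : EReal) : Set ℝ := {t | 0 ≤ t ∧ (t : EReal) < T}

/-- `F_t`, `t ∈ [0, T)`, is a smooth family of immersions `S → S × S` whose normal velocity is the
mean curvature vector. -/
structure IsMeanCurvatureMotion (g : Metric S) (T : EReal) (F : ℝ → S → S × S) : Prop where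
  smooth : ContMDiffOn (𝓘(ℝ, ℝ).prod 𝓘(ℝ, ℂ)) (𝓘(ℝ, ℂ).prod 𝓘(ℝ, ℂ)) ∞
    (fun q : ℝ × S => F q.1 q.2) (timeInterval T ×ˢ univ)
  immersion : ∀ t ∈ timeInterval T, ∀ x, Function.Injective (pushforward (F t) x)
  velocity : ∀ t ∈ timeInterval T, ∀ x,
    normalPart g (F t) x
      (mfderivWithin 𝓘(ℝ, ℝ) 𝓘(ℝ, ℂ) (fun τ => (F τ x).1) (timeInterval T) t (1 : ℝ),
        mfderivWithin 𝓘(ℝ, ℝ) 𝓘(ℝ, ℂ) (fun τ => (F τ x).2) (timeInterval T) t (1 : ℝ)) =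
      meanCurvature g (F t) x

/-! ### One-forms and first de Rham cohomology -/

variable (S) in
/-- Fields of functions on the tangent spaces of `S`, among them the differential one-forms. -/
abbrev OneForm := (x : S) → TangentSpace 𝓘(ℝ, ℂ) x → ℝ

/-- `α` is a smooth closed one-form: in each chart it is given by a smooth function `A` with values
in the linear forms on `ℂ`, and `dA = 0`. -/
def IsClosedForm (α : OneForm S) : Prop :=
  ∀ e ∈ atlas ℂ S, ∃ A : ℂ → ℂ →L[ℝ] ℝ, ContDiffOn ℝ ∞ A e.target ∧
    (∀ z ∈ e.target, ∀ v : ℂ, A z v = α (e.symm z) (mfderiv 𝓘(ℝ, ℂ) 𝓘(ℝ, ℂ) e.symm z v)) ∧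
    ∀ z ∈ e.target, ∀ u v : ℂ, fderiv ℝ A z u v = fderiv ℝ A z v u

/-- `α` is the differential of a smooth function. -/
def IsExactForm (α : OneForm S) : Prop :=
  ∃ K : S → ℝ, ContMDiff 𝓘(ℝ, ℂ) 𝓘(ℝ, ℝ) ∞ K ∧
    ∀ x v, (mfderiv 𝓘(ℝ, ℂ) 𝓘(ℝ, ℝ) K x v : ℝ) = α x v

/-- `α` and `β` are smooth closed one-forms with `[α] = [β]` in `H¹(S, ℝ)`. -/
def SameClass (α β : OneForm S) : Prop :=
  IsClosedForm α ∧ IsClosedForm β ∧ IsExactForm (fun x v => α x v - β x v)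

/-! ### Symplectomorphisms, flux, Hamiltonian diffeomorphisms -/

/-- `f` is a diffeomorphism with `f^* ω = ω`. -/
def IsSymplectomorphism (g : Metric S) (f : S → S) : Prop :=
  (∃ Φ : S ≃ₘ^∞⟮𝓘(ℝ, ℂ), 𝓘(ℝ, ℂ)⟯ S, ⇑Φ = f) ∧
    ∀ (x : S) (u v : TangentSpace 𝓘(ℝ, ℂ) x),
      areaForm g (f x) (mfderiv 𝓘(ℝ, ℂ) 𝓘(ℝ, ℂ) f x u) (mfderiv 𝓘(ℝ, ℂ) 𝓘(ℝ, ℂ) f x v) =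
        areaForm g x u v

/-- `φ_s`, `0 ≤ s ≤ 1`, is a (smooth) symplectic isotopy from the identity to `f`. -/
structure IsSymplecticIsotopy (g : Metric S) (φ : ℝ → S → S) (f : S → S) : Prop where
  smooth : ContMDiffOn (𝓘(ℝ, ℝ).prod 𝓘(ℝ, ℂ)) 𝓘(ℝ, ℂ) ∞
    (fun q : ℝ × S => φ q.1 q.2) (Icc 0 1 ×ˢ univ)
  symplectic : ∀ s ∈ Icc (0 : ℝ) 1, IsSymplectomorphism g (φ s)
  zero : φ 0 = id
  one : φ 1 = f

/-- The flux form `∫₀¹ φ_s^* (i_{X_s} ω) ds` of an isotopy with generating field `X_s`, where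
`X_s (φ_s (x)) = ∂φ_s(x)/∂s`. -/
def fluxForm (g : Metric S) (φ : ℝ → S → S) : OneForm S := fun x v =>
  ∫ s in (0 : ℝ)..1,
    areaForm g (φ s x) (mfderiv 𝓘(ℝ, ℝ) 𝓘(ℝ, ℂ) (fun σ => φ σ x) s (1 : ℝ))
      (mfderiv 𝓘(ℝ, ℂ) 𝓘(ℝ, ℂ) (φ s) x v)

/-- `f` is the time-one map of a symplectic isotopy with zero flux class. -/
def IsHamiltonian (g : Metric S) (f : S → S) : Prop :=
  ∃ φ : ℝ → S → S, IsSymplecticIsotopy g φ f ∧ IsExactForm (fluxForm g φ)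

/-- The graph `{(x, f(x))}` of `f`, embedded by `x ↦ (x, f(x))`. -/
def graphMap (f : S → S) (x : S) : S × S := (x, f x)

/-- The Maslov form `(n / π) i_H (ω ⊖ ω)`, `n = 2`, of the Lagrangian graph of `f` in `S × S`,
pulled back to `S` by `x ↦ (x, f(x))`. -/
def maslovForm (g : Metric S) (f : S → S) : OneForm S := fun x v =>
  2 / Real.pi *
    prodForm g (x, f x) (meanCurvature g (graphMap f) x) (pushforward (graphMap f) x v)

/-- The graph of `f` has zero Maslov class. -/
def HasZeroMaslovClass (g : Metric S) (f : S → S) : Prop := IsExactForm (maslovForm g f)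

/-- `f_t`, `t ∈ [0, T)`, is the mean curvature flow of `f` in the group of symplectomorphisms: a
smooth family of symplectomorphisms with `f_0 = f` whose graphs move by mean curvature, that is,
have parametrizations `F_t` with normal velocity equal to the mean curvature vector. -/
structure IsMeanCurvatureFlow (g : Metric S) (f : S → S) (T : EReal) (f_ : ℝ → S → S) : Prop where
  smooth : ContMDiffOn (𝓘(ℝ, ℝ).prod 𝓘(ℝ, ℂ)) 𝓘(ℝ, ℂ) ∞
    (fun q : ℝ × S => f_ q.1 q.2) (timeInterval T ×ˢ univ)
  symplectic : ∀ t ∈ timeInterval T, IsSymplectomorphism g (f_ t)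
  zero : f_ 0 = f
  flow : ∃ F : ℝ → S → S × S, IsMeanCurvatureMotion g T F ∧ F 0 = graphMap f ∧
    ∀ t ∈ timeInterval T, range (F t) = range (graphMap (f_ t))

/-- The smooth two-parameter family `f_{s,t}`, `s ∈ [0, 1]`, `t ∈ [0, T)`, extends the symplectic
isotopy `φ_s = f_{s,0}` along the flow `f_t`: each `{f_{s,t}}_s` is a symplectic isotopy from the
identity to `f_t`. -/
structure IsIsotopyAlongFlow (g : Metric S) (T : EReal) (φ f_ : ℝ → S → S)
    (Φ : ℝ → ℝ → S → S) : Prop where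
  smooth : ContMDiffOn (𝓘(ℝ, ℝ).prod (𝓘(ℝ, ℝ).prod 𝓘(ℝ, ℂ))) 𝓘(ℝ, ℂ) ∞
    (fun q : ℝ × ℝ × S => Φ q.1 q.2.1 q.2.2) (Icc 0 1 ×ˢ timeInterval T ×ˢ univ)
  isotopy : ∀ t ∈ timeInterval T, IsSymplecticIsotopy g (fun s => Φ s t) (f_ t)
  zero : ∀ s ∈ Icc (0 : ℝ) 1, Φ s 0 = φ s

end RiemannSurface

end

open Set
open scoped Manifold ContDiff

noncomputable section

namespace RiemannSurface

open scoped ComplexConjugate Topology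

/-! ### Conformal metrics in holomorphic charts -/

variable {S : Type*} [TopologicalSpace S] [ChartedSpace ℂ S] [IsManifold 𝓘(ℂ) ω S]

set_option linter.unusedSectionVars false

/-! Let θ_t = Im(∇∂f_t / ∂f_t) be the `phaseForm` of f_t: the rate at which the complex linear part
∂f_t of df_t rotates, measured with the Levi-Civita connections of source and target. It is well
defined because a symplectomorphism has |∂f|² − |∂̄f|² > 0, so ∂f never vanishes. The theorem rests
on three facts.

The form i_H(ω ⊖ ω) on the graph of f is θ (`prodForm_meanCurvature_graph_comp`). Hence the Maslov
form is (2/π)θ_0, so θ_0 is exact, and the flow equation says that the velocity V_t of f_t satisfies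
ω(V_t, df_t v) = −θ_t(v) (`IsMeanCurvatureFlow.pullbackArea_eq_neg_phaseForm`).

The pullback of ω by a two-parameter family of maps is closed, so the flux form changes at the rate
of f_t^*(i_{V_t} ω) plus an exact form (`IsIsotopyAlongFlow.hasDerivAt_flux`). With the first fact,
the flux class has derivative −[θ_t].

On space-time θ extends to a connection form with differential −c Ψ^*ω (`fderiv_angleForm_sub`).
This is where constant curvature is used. Evaluated on ∂_t and a vector v, it gives ∂_t θ_t = cθ_t +
exact. Thus [θ_t] solves a linear equation with initial value zero, and the flux class is constant.

No differential equation in H¹ is solved. For a fixed final time, a scalar weight w with w = 0 at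
that time is chosen so that the derivative of flux − wθ is exact with an explicit primitive.
Integration in time then gives the flux difference as −w(0)θ_0 plus an explicit exact form.

The parameters range over intervals with endpoints. The substitutions s = (1 − cos σ)/2 and t = r²
turn the families into smooth maps on open sets, where ordinary derivatives and closedness of
pullbacks are available. -/

/-- The conformal factor of the metric at `p`, in the preferred chart. -/
def conformalFactor (g : Metric S) (p : S) : ℝ :=
  g.inner p (show TangentSpace 𝓘(ℝ, ℂ) p from (1 : ℂ)) (show TangentSpace 𝓘(ℝ, ℂ) p from (1 : ℂ))

theorem conformalFactor_pos (g : Metric S) (p : S) : 0 < conformalFactor g p :=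
  g.pos p _ (one_ne_zero (α := ℂ))

/-- Invariance under multiplication by i gives B(i, i) = B(1, 1); together with symmetry it gives
B(1, i) = −B(1, i) = 0. A real bilinear form on ℂ is determined by its values on 1 and i. -/
theorem inner_eq {g : Metric S} (hg : IsConformal g) (p : S) (u v : ℂ) :
    g.inner p (show TangentSpace 𝓘(ℝ, ℂ) p from u) (show TangentSpace 𝓘(ℝ, ℂ) p from v) =
      conformalFactor g p * (conj u * v).re := by
  let B : ℂ →ₗ[ℝ] ℂ →ₗ[ℝ] ℝ := LinearMap.mk₂ ℝ
    (fun u v : ℂ => g.inner p (show TangentSpace 𝓘(ℝ, ℂ) p from u)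
      (show TangentSpace 𝓘(ℝ, ℂ) p from v))
    (fun a b c => by
      change g.inner p ((show TangentSpace 𝓘(ℝ, ℂ) p from a) + (show TangentSpace 𝓘(ℝ, ℂ) p from b)) _ = _
      rw [map_add]; rfl)
    (fun a b c => by
      change g.inner p (a • (show TangentSpace 𝓘(ℝ, ℂ) p from b)) _ = _
      rw [map_smul]; rfl)
    (fun a b c => by
      change g.inner p _ ((show TangentSpace 𝓘(ℝ, ℂ) p from b) + (show TangentSpace 𝓘(ℝ, ℂ) p from c)) = _
      rw [map_add])
    (fun a b c => by
      change g.inner p _ (a • (show TangentSpace 𝓘(ℝ, ℂ) p from c)) = _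
      rw [map_smul])
  have hJ : ∀ u v : ℂ, B (Complex.I * u) (Complex.I * v) = B u v := fun u v => hg p u v
  have hs : ∀ u v : ℂ, B u v = B v u := fun u v => g.symm p u v
  change B u v = B 1 1 * (conj u * v).re
  have h1 : B Complex.I Complex.I = B 1 1 := by simpa using hJ 1 1
  have h2 : B 1 Complex.I = 0 := by
    have h := hJ 1 Complex.I
    simp only [mul_one, Complex.I_mul_I, map_neg] at h
    rw [hs Complex.I 1] at h
    linarith
  have e1 : ∀ z : ℂ, z = z.re • (1 : ℂ) + z.im • Complex.I := fun z => by
    simp [Complex.re_add_im]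
  rw [e1 u, e1 v]
  simp only [map_add, map_smul, LinearMap.add_apply, LinearMap.smul_apply, h1, h2,
    hs Complex.I 1, smul_eq_mul]
  simp
  ring

theorem areaForm_eq {g : Metric S} (hg : IsConformal g) (p : S) (u v : ℂ) :
    areaForm g p u v = conformalFactor g p * (conj u * v).im := by
  have h := inner_eq hg p (Complex.I * u) v
  refine h.trans ?_
  congr 1
  simp
  ring

theorem mem_maximalAtlas_real {e : OpenPartialHomeomorph S ℂ} (he : e ∈ atlas ℂ S) :
    e ∈ IsManifold.maximalAtlas 𝓘(ℝ, ℂ) ∞ S :=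
  IsManifold.subset_maximalAtlas he

theorem contMDiffOn_chart_real {e : OpenPartialHomeomorph S ℂ} (he : e ∈ atlas ℂ S) :
    ContMDiffOn 𝓘(ℝ, ℂ) 𝓘(ℝ, ℂ) ∞ e e.source :=
  contMDiffOn_of_mem_maximalAtlas (mem_maximalAtlas_real he)

theorem contMDiffOn_chart_symm_real {e : OpenPartialHomeomorph S ℂ} (he : e ∈ atlas ℂ S) :
    ContMDiffOn 𝓘(ℝ, ℂ) 𝓘(ℝ, ℂ) ∞ e.symm e.target :=
  contMDiffOn_symm_of_mem_maximalAtlas (mem_maximalAtlas_real he)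

theorem mdifferentiableAt_chart_symm_real {e : OpenPartialHomeomorph S ℂ} (he : e ∈ atlas ℂ S)
    {z : ℂ} (hz : z ∈ e.target) : MDifferentiableAt 𝓘(ℝ, ℂ) 𝓘(ℝ, ℂ) e.symm z :=
  ((contMDiffOn_chart_symm_real he).contMDiffAt (e.open_target.mem_nhds hz)).mdifferentiableAt
    (by simp)

theorem mdifferentiableAt_chart_real {e : OpenPartialHomeomorph S ℂ} (he : e ∈ atlas ℂ S)
    {p : S} (hp : p ∈ e.source) : MDifferentiableAt 𝓘(ℝ, ℂ) 𝓘(ℝ, ℂ) e p :=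
  ((contMDiffOn_chart_real he).contMDiffAt (e.open_source.mem_nhds hp)).mdifferentiableAt
    (by simp)

/-- The differential of the inverse of a holomorphic chart is complex linear and invertible. -/
theorem exists_mfderiv_chart_symm_eq_mul {e : OpenPartialHomeomorph S ℂ} (he : e ∈ atlas ℂ S)
    {z : ℂ} (hz : z ∈ e.target) : ∃ m : ℂ, m ≠ 0 ∧
      ∀ v : ℂ, mfderiv 𝓘(ℝ, ℂ) 𝓘(ℝ, ℂ) e.symm z v = (m * v : ℂ) := by
  have : IsManifold 𝓘(ℂ) 1 S := IsManifold.of_le (n := ω) le_top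
  have hd : MDifferentiableAt 𝓘(ℂ) 𝓘(ℂ) e.symm z := mdifferentiableAt_atlas_symm he hz
  have h1 := hd.hasMFDerivAt
  have h2 : HasMFDerivAt 𝓘(ℝ, ℂ) 𝓘(ℝ, ℂ) e.symm z
      ((show ℂ →L[ℂ] ℂ from mfderiv 𝓘(ℂ) 𝓘(ℂ) e.symm z).restrictScalars ℝ) :=
    ⟨h1.1, HasFDerivWithinAt.restrictScalars ℝ (𝕜' := ℂ) h1.2⟩
  set D : ℂ →L[ℂ] ℂ := mfderiv 𝓘(ℂ) 𝓘(ℂ) e.symm z with hD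
  have hv : ∀ v : ℂ, mfderiv 𝓘(ℝ, ℂ) 𝓘(ℝ, ℂ) e.symm z v = (D 1 * v : ℂ) := fun v => by
    rw [h2.mfderiv]
    change D v = _
    conv_lhs => rw [← mul_one v, ← smul_eq_mul, map_smul, smul_eq_mul, mul_comm]
  refine ⟨D 1, fun h0 => ?_, hv⟩
  have hb := (mdifferentiable_of_mem_atlas (I := 𝓘(ℂ)) he).symm.mfderiv_injective
    (x := z) (by simpa using hz)
  have h0' : D 1 = D 0 := by rw [h0, map_zero]
  exact one_ne_zero (α := ℂ) (hb h0')

theorem density_eq {g : Metric S} (hg : IsConformal g) {e : OpenPartialHomeomorph S ℂ}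
    {z m : ℂ} (hm : ∀ v : ℂ, mfderiv 𝓘(ℝ, ℂ) 𝓘(ℝ, ℂ) e.symm z v = (m * v : ℂ)) :
    density g e z = conformalFactor g (e.symm z) * Complex.normSq m := by
  unfold density
  rw [hm 1]
  refine (inner_eq hg _ _ _).trans ?_
  simp [Complex.normSq_apply]

theorem density_pos {g : Metric S} (hg : IsConformal g) {e : OpenPartialHomeomorph S ℂ}
    (he : e ∈ atlas ℂ S) {z : ℂ} (hz : z ∈ e.target) : 0 < density g e z := by
  obtain ⟨m, hm0, hm⟩ := exists_mfderiv_chart_symm_eq_mul he hz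
  rw [density_eq hg hm]
  exact mul_pos (conformalFactor_pos g _) (Complex.normSq_pos.2 hm0)

/-- The area form in a holomorphic chart. -/
theorem areaForm_chart_symm {g : Metric S} (hg : IsConformal g) {e : OpenPartialHomeomorph S ℂ}
    (he : e ∈ atlas ℂ S) {z : ℂ} (hz : z ∈ e.target) (u v : ℂ) :
    areaForm g (e.symm z) (mfderiv 𝓘(ℝ, ℂ) 𝓘(ℝ, ℂ) e.symm z u)
      (mfderiv 𝓘(ℝ, ℂ) 𝓘(ℝ, ℂ) e.symm z v) = density g e z * (conj u * v).im := by
  obtain ⟨m, hm0, hm⟩ := exists_mfderiv_chart_symm_eq_mul he hz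
  rw [density_eq hg hm, hm u, hm v]
  refine (areaForm_eq hg _ _ _).trans ?_
  rw [mul_assoc]
  congr 1
  simp [Complex.normSq_apply]
  ring

/-- The density is the smooth bundle metric evaluated twice on the coordinate field ∂/∂x, which is
smooth as the tangent map of the inverse chart applied to a constant field. -/
theorem contDiffOn_density (g : Metric S) {e : OpenPartialHomeomorph S ℂ} (he : e ∈ atlas ℂ S) :
    ContDiffOn ℝ ∞ (density g e) e.target := by
  rw [← contMDiffOn_iff_contDiffOn]
  intro z hz
  have hzn := e.open_target.mem_nhds hz
  have hsm : ContMDiffAt 𝓘(ℝ, ℂ) 𝓘(ℝ, ℂ) ∞ e.symm z :=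
    (contMDiffOn_chart_symm_real he).contMDiffAt hzn
  have hv : ContMDiffAt 𝓘(ℝ, ℂ) (𝓘(ℝ, ℂ).prod 𝓘(ℝ, ℂ)) ∞
      (fun w : ℂ => (⟨e.symm w, mfderiv 𝓘(ℝ, ℂ) 𝓘(ℝ, ℂ) e.symm w (1 : ℂ)⟩ :
        TangentBundle 𝓘(ℝ, ℂ) S)) z := by
    have h1 : ContMDiffOn 𝓘(ℝ, ℂ).tangent 𝓘(ℝ, ℂ).tangent ∞
        (tangentMapWithin 𝓘(ℝ, ℂ) 𝓘(ℝ, ℂ) e.symm e.target)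
        (Bundle.TotalSpace.proj ⁻¹' e.target) :=
      (contMDiffOn_chart_symm_real he).contMDiffOn_tangentMapWithin (by simp)
        e.open_target.uniqueMDiffOn
    have h2 : ContMDiff 𝓘(ℝ, ℂ) 𝓘(ℝ, ℂ).tangent ∞
        (fun w : ℂ => (⟨w, (1 : ℂ)⟩ : TangentBundle 𝓘(ℝ, ℂ) ℂ)) := by
      rw [contMDiff_vectorSpace_iff_contDiff (V := fun _ => (1:ℂ))]
      exact contDiff_const
    have h3 := (h1.contMDiffAt (x := ⟨z, (1 : ℂ)⟩) ((e.open_target.preimage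
      (FiberBundle.continuous_proj ℂ (TangentSpace 𝓘(ℝ, ℂ) : ℂ → Type))).mem_nhds hz)).comp z
        h2.contMDiffAt
    refine h3.congr_of_eventuallyEq ?_
    filter_upwards [hzn] with w hw
    simp only [Function.comp, tangentMapWithin, mfderivWithin_of_isOpen e.open_target hw]
  have hg := (g.contMDiff.contMDiffAt (x := e.symm z)).comp z hsm
  have : ContMDiffAt 𝓘(ℝ, ℂ) (𝓘(ℝ, ℂ).prod 𝓘(ℝ)) ∞
      (fun w ↦ Bundle.TotalSpace.mk' ℝ (E := Bundle.Trivial S ℝ) (e.symm w) (density g e w)) z :=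
    ContMDiffAt.clm_bundle_apply₂ (F₁ := ℂ) (F₂ := ℂ) (E₁ := (TangentSpace 𝓘(ℝ, ℂ) : S → Type))
     (E₂ := (TangentSpace 𝓘(ℝ, ℂ) : S → Type)) hg hv hv
  rw [Bundle.contMDiffAt_totalSpace] at this
  exact this.2.contMDiffWithinAt

/-! ### Smooth dependence of integrals on parameters -/

section ParametricIntegral

open MeasureTheory

variable {E F : Type} [NormedAddCommGroup E] [NormedSpace ℝ E] [ProperSpace E]
  [NormedAddCommGroup F] [NormedSpace ℝ F] {f : ℝ × E → F} {I : Set ℝ} {U : Set E} {a b : ℝ}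

/-- Differentiation under the integral sign for an integrand smooth near the domain. -/
theorem hasFDerivAt_intervalIntegral_prod (hI : IsOpen I) (hab : uIcc a b ⊆ I) (hU : IsOpen U)
    (hf : ContDiffOn ℝ ∞ f (I ×ˢ U)) {z : E} (hz : z ∈ U) :
    HasFDerivAt (fun w => ∫ s in a..b, f (s, w))
      (∫ s in a..b, (fderiv ℝ f (s, z)).comp (ContinuousLinearMap.inr ℝ ℝ E)) z := by
  obtain ⟨r, hr, hrU⟩ := Metric.nhds_basis_closedBall.mem_iff.1 (hU.mem_nhds hz)
  have hO : IsOpen (I ×ˢ U) := hI.prod hU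
  have hD : ContinuousOn (fderiv ℝ f) (I ×ˢ U) :=
    hf.continuousOn_fderiv_of_isOpen hO (by simp)
  -- Closed balls are compact in a proper space, so the derivative is bounded near z and a constant
  -- serves as dominating function.
  have hK : IsCompact (uIcc a b ×ˢ Metric.closedBall z r) :=
    isCompact_uIcc.prod (isCompact_closedBall z r)
  have hKO : uIcc a b ×ˢ Metric.closedBall z r ⊆ I ×ˢ U := prod_mono hab hrU
  have hD' : ContinuousOn (fun q => (fderiv ℝ f q).comp (ContinuousLinearMap.inr ℝ ℝ E))
      (I ×ˢ U) := hD.clm_comp continuousOn_const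
  obtain ⟨C, hC⟩ := hK.exists_bound_of_continuousOn (hD'.mono hKO)
  have hline : ∀ w ∈ Metric.closedBall z r, ContinuousOn (fun s : ℝ => (s, w)) (uIcc a b) :=
    fun w _ => by fun_prop
  have hmap : ∀ w ∈ Metric.closedBall z r, MapsTo (fun s : ℝ => (s, w)) (uIcc a b) (I ×ˢ U) :=
    fun w hw s hs => hKO ⟨hs, hw⟩
  have hcf : ∀ w ∈ Metric.closedBall z r, ContinuousOn (fun s => f (s, w)) (uIcc a b) :=
    fun w hw => hf.continuousOn.comp (hline w hw) (hmap w hw)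
  have hzr : z ∈ Metric.closedBall z r := Metric.mem_closedBall_self hr.le
  refine intervalIntegral.hasFDerivAt_integral_of_dominated_of_fderiv_le
    (F := fun w s => f (s, w))
    (F' := fun w s => (fderiv ℝ f (s, w)).comp (ContinuousLinearMap.inr ℝ ℝ E))
    (bound := fun _ => C) (Metric.closedBall_mem_nhds z hr) ?_ ?_ ?_ ?_ ?_ ?_
  · filter_upwards [Metric.closedBall_mem_nhds z hr] with w hw
    exact ((hcf w hw).mono uIoc_subset_uIcc).aestronglyMeasurable measurableSet_uIoc
  · exact (hcf z hzr).intervalIntegrable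
  · exact ((hD'.comp (hline z hzr) (hmap z hzr)).mono
      uIoc_subset_uIcc).aestronglyMeasurable measurableSet_uIoc
  · exact Filter.Eventually.of_forall fun s hs w hw => hC (s, w) ⟨uIoc_subset_uIcc hs, hw⟩
  · exact intervalIntegrable_const
  · refine Filter.Eventually.of_forall fun s hs w hw => ?_
    have hq : (s, w) ∈ I ×ˢ U := hKO ⟨uIoc_subset_uIcc hs, hw⟩
    have h1 : HasFDerivAt f (fderiv ℝ f (s, w)) (s, w) :=
      ((hf.contDiffAt (hO.mem_nhds hq)).differentiableAt (by simp)).hasFDerivAt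
    exact h1.comp w (hasFDerivAt_prodMk_right s w)

/-- Induction on the order of differentiability: the derivative is again a parametric integral, now
with values in `E →L[ℝ] F`, so the target space has to vary in the induction. -/
theorem contDiffOn_intervalIntegral_prod (hI : IsOpen I) (hab : uIcc a b ⊆ I) (hU : IsOpen U)
    (hf : ContDiffOn ℝ ∞ f (I ×ˢ U)) :
    ContDiffOn ℝ ∞ (fun w => ∫ s in a..b, f (s, w)) U := by
  rw [contDiffOn_infty]
  intro n
  induction n generalizing F with
  | zero =>
    rw [Nat.cast_zero, contDiffOn_zero]
    exact fun z hz =>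
      (hasFDerivAt_intervalIntegral_prod hI hab hU hf hz).continuousAt.continuousWithinAt
  | succ n ih =>
    rw [Nat.cast_succ, contDiffOn_succ_iff_fderiv_of_isOpen hU]
    refine ⟨fun z hz => (hasFDerivAt_intervalIntegral_prod hI hab hU
      hf hz).differentiableAt.differentiableWithinAt, by simp, ?_⟩
    have hD : ContDiffOn ℝ ∞ (fun q => (fderiv ℝ f q).comp (ContinuousLinearMap.inr ℝ ℝ E))
        (I ×ˢ U) :=
      (hf.fderiv_of_isOpen (hI.prod hU) (by simp)).clm_comp contDiffOn_const
    exact (ih hD).congr fun z hz => (hasFDerivAt_intervalIntegral_prod hI hab hU hf hz).fderiv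

end ParametricIntegral

/-! ### The pullback of the area form and its closedness -/

section PullbackArea

variable {E : Type*} [NormedAddCommGroup E] [NormedSpace ℝ E]

/-- The pullback `Ψ^* ω` of the area form by a map `Ψ` from a vector space. -/
def pullbackArea (g : Metric S) (Ψ : E → S) (q X Y : E) : ℝ :=
  areaForm g (Ψ q) (mfderiv 𝓘(ℝ, E) 𝓘(ℝ, ℂ) Ψ q X) (mfderiv 𝓘(ℝ, E) 𝓘(ℝ, ℂ) Ψ q Y)

variable {Ψ : E → S} {W : Set E} {e : OpenPartialHomeomorph S ℂ}

theorem isOpen_inter_preimage_chart (hW : IsOpen W)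
    (hΨ : ContMDiffOn 𝓘(ℝ, E) 𝓘(ℝ, ℂ) ∞ Ψ W) (e : OpenPartialHomeomorph S ℂ) :
    IsOpen (W ∩ Ψ ⁻¹' e.source) :=
  hΨ.continuousOn.isOpen_inter_preimage hW e.open_source

theorem contDiffOn_chart_comp (hΨ : ContMDiffOn 𝓘(ℝ, E) 𝓘(ℝ, ℂ) ∞ Ψ W) (he : e ∈ atlas ℂ S) :
    ContDiffOn ℝ ∞ (fun q => e (Ψ q)) (W ∩ Ψ ⁻¹' e.source) := by
  rw [← contMDiffOn_iff_contDiffOn]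
  exact (contMDiffOn_chart_real he).comp (hΨ.mono inter_subset_left) inter_subset_right

theorem mfderiv_eq_mfderiv_chart_symm (hW : IsOpen W)
    (hΨ : ContMDiffOn 𝓘(ℝ, E) 𝓘(ℝ, ℂ) ∞ Ψ W) (he : e ∈ atlas ℂ S) {q : E}
    (hq : q ∈ W ∩ Ψ ⁻¹' e.source) (X : E) :
    mfderiv 𝓘(ℝ, E) 𝓘(ℝ, ℂ) Ψ q X =
      mfderiv 𝓘(ℝ, ℂ) 𝓘(ℝ, ℂ) e.symm (e (Ψ q)) (fderiv ℝ (fun q => e (Ψ q)) q X) := by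
  have hV := isOpen_inter_preimage_chart hW hΨ e
  have hu : DifferentiableAt ℝ (fun q => e (Ψ q)) q :=
    ((contDiffOn_chart_comp hΨ he).contDiffAt (hV.mem_nhds hq)).differentiableAt (by simp)
  have h1 : Ψ =ᶠ[𝓝 q] e.symm ∘ (fun q => e (Ψ q)) := by
    filter_upwards [hV.mem_nhds hq] with q' hq'
    exact (e.left_inv hq'.2).symm
  have h2 : HasMFDerivAt 𝓘(ℝ, E) 𝓘(ℝ, ℂ) (fun q => e (Ψ q)) q (fderiv ℝ (fun q => e (Ψ q)) q) :=
    hu.hasFDerivAt.hasMFDerivAt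
  have h3 := (mdifferentiableAt_chart_symm_real he (e.map_source hq.2)).hasMFDerivAt
  have h4 := (HasMFDerivAt.comp q h3 h2).congr_of_eventuallyEq h1
  rw [h4.mfderiv]
  rfl

theorem pullbackArea_eq {g : Metric S} (hg : IsConformal g) (hW : IsOpen W)
    (hΨ : ContMDiffOn 𝓘(ℝ, E) 𝓘(ℝ, ℂ) ∞ Ψ W) (he : e ∈ atlas ℂ S) {q : E}
    (hq : q ∈ W ∩ Ψ ⁻¹' e.source) (X Y : E) :
    pullbackArea g Ψ q X Y = density g e (e (Ψ q)) *
      (conj (fderiv ℝ (fun q => e (Ψ q)) q X) * fderiv ℝ (fun q => e (Ψ q)) q Y).im := by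
  rw [← areaForm_chart_symm hg he (e.map_source hq.2), ← mfderiv_eq_mfderiv_chart_symm hW hΨ he hq,
    ← mfderiv_eq_mfderiv_chart_symm hW hΨ he hq, e.left_inv hq.2]
  rfl

theorem hasFDerivAt_fderiv_apply {F : Type*} [NormedAddCommGroup F] [NormedSpace ℝ F]
    {u : E → F} {V : Set E} (hV : IsOpen V)
    (hu : ContDiffOn ℝ ∞ u V) {q : E} (hq : q ∈ V) (Y : E) :
    HasFDerivAt (fun q => fderiv ℝ u q Y) ((fderiv ℝ (fderiv ℝ u) q).flip Y) q := by
  have h : HasFDerivAt (fderiv ℝ u) (fderiv ℝ (fderiv ℝ u) q) q :=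
    (((hu.fderiv_of_isOpen hV (m := ∞) (by simp)).contDiffAt
      (hV.mem_nhds hq)).differentiableAt (by simp)).hasFDerivAt
  convert! h.clm_apply (hasFDerivAt_const Y q) using 1
  ext X
  simp

theorem fderiv_fderiv_comm {F : Type*} [NormedAddCommGroup F] [NormedSpace ℝ F]
    {u : E → F} {V : Set E} (hV : IsOpen V)
    (hu : ContDiffOn ℝ ∞ u V) {q : E} (hq : q ∈ V) (X Y : E) :
    fderiv ℝ (fderiv ℝ u) q X Y = fderiv ℝ (fderiv ℝ u) q Y X :=
  ((hu.contDiffAt (hV.mem_nhds hq)).isSymmSndFDerivAt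
    (by rw [minSmoothness_of_isRCLikeNormedField]; exact ENat.LEInfty.out)).eq X Y

theorem contDiffOn_pullbackArea {g : Metric S} (hg : IsConformal g) (hW : IsOpen W)
    (hΨ : ContMDiffOn 𝓘(ℝ, E) 𝓘(ℝ, ℂ) ∞ Ψ W) (X Y : E) :
    ContDiffOn ℝ ∞ (fun q => pullbackArea g Ψ q X Y) W := by
  intro q hq
  set e := chartAt ℂ (Ψ q) with he'
  have he : e ∈ atlas ℂ S := chart_mem_atlas ℂ _
  have hqV : q ∈ W ∩ Ψ ⁻¹' e.source := ⟨hq, mem_chart_source ℂ _⟩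
  have hV := isOpen_inter_preimage_chart hW hΨ e
  have hu := contDiffOn_chart_comp hΨ he
  have hD : ∀ X, ContDiffOn ℝ ∞ (fun q' => fderiv ℝ (fun q => e (Ψ q)) q' X)
      (W ∩ Ψ ⁻¹' e.source) := fun X =>
    (hu.fderiv_of_isOpen hV (by simp)).clm_apply contDiffOn_const
  have hρ : ContDiffOn ℝ ∞ (fun q => density g e (e (Ψ q))) (W ∩ Ψ ⁻¹' e.source) :=
    (contDiffOn_density g he).comp hu fun q hq => e.map_source hq.2
  have h : ContDiffOn ℝ ∞ (fun q => density g e (e (Ψ q)) *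
      (conj (fderiv ℝ (fun q => e (Ψ q)) q X) * fderiv ℝ (fun q => e (Ψ q)) q Y).im)
      (W ∩ Ψ ⁻¹' e.source) :=
    hρ.mul (Complex.imCLM.contDiff.comp_contDiffOn
      ((Complex.conjCLE.contDiff.comp_contDiffOn (hD X)).mul (hD Y)))
  refine ContDiffAt.contDiffWithinAt ((h.contDiffAt (hV.mem_nhds hqV)).congr_of_eventuallyEq ?_)
  filter_upwards [hV.mem_nhds hqV] with q' hq'
  exact pullbackArea_eq hg hW hΨ he hq' X Y

/-- The pullback of the area form is closed. -/
theorem fderiv_pullbackArea_cyclic {g : Metric S} (hg : IsConformal g) (hW : IsOpen W)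
    (hΨ : ContMDiffOn 𝓘(ℝ, E) 𝓘(ℝ, ℂ) ∞ Ψ W) {q : E} (hq : q ∈ W) (X Y Z : E) :
    fderiv ℝ (fun q => pullbackArea g Ψ q Y Z) q X +
      fderiv ℝ (fun q => pullbackArea g Ψ q Z X) q Y +
        fderiv ℝ (fun q => pullbackArea g Ψ q X Y) q Z = 0 := by
  set e := chartAt ℂ (Ψ q) with he'
  have he : e ∈ atlas ℂ S := chart_mem_atlas ℂ _
  have hqV : q ∈ W ∩ Ψ ⁻¹' e.source := ⟨hq, mem_chart_source ℂ _⟩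
  have hV := isOpen_inter_preimage_chart hW hΨ e
  have hu := contDiffOn_chart_comp hΨ he
  set u : E → ℂ := fun q => e (Ψ q) with hu'
  have huq : HasFDerivAt u (fderiv ℝ u q) q :=
    ((hu.contDiffAt (hV.mem_nhds hqV)).differentiableAt (by simp)).hasFDerivAt
  have hρ : HasFDerivAt (density g e) (fderiv ℝ (density g e) (u q)) (u q) :=
    (((contDiffOn_density g he).contDiffAt (e.open_target.mem_nhds
      (e.map_source hqV.2))).differentiableAt (by simp)).hasFDerivAt
  set R := fderiv ℝ (density g e) (u q) with hR
  have hR' : ∀ v : ℂ, R v = v.re * R 1 + v.im * R Complex.I := fun v => by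
    conv_lhs => rw [show v = v.re • (1 : ℂ) + v.im • Complex.I by simp [Complex.re_add_im]]
    simp only [map_add, map_smul, smul_eq_mul]
  have key : ∀ X Y Z : E, fderiv ℝ (fun q => pullbackArea g Ψ q Y Z) q X =
      R (fderiv ℝ u q X) * (conj (fderiv ℝ u q Y) * fderiv ℝ u q Z).im +
      density g e (u q) * ((conj (fderiv ℝ (fderiv ℝ u) q X Y) * fderiv ℝ u q Z).im +
        (conj (fderiv ℝ u q Y) * fderiv ℝ (fderiv ℝ u) q X Z).im) := by
    intro X Y Z
    have h1 : (fun q => pullbackArea g Ψ q Y Z) =ᶠ[𝓝 q] fun q => density g e (u q) *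
        ((fderiv ℝ u q Y).re * (fderiv ℝ u q Z).im -
          (fderiv ℝ u q Y).im * (fderiv ℝ u q Z).re) := by
      filter_upwards [hV.mem_nhds hqV] with q' hq'
      rw [pullbackArea_eq hg hW hΨ he hq' Y Z]
      congr 1
      simp
      ring
    have hY := hasFDerivAt_fderiv_apply hV hu hqV Y
    have hZ := hasFDerivAt_fderiv_apply hV hu hqV Z
    have h2 := (hρ.comp q huq).mul
      (((Complex.reCLM.hasFDerivAt.comp q hY).mul (Complex.imCLM.hasFDerivAt.comp q hZ)).sub
        ((Complex.imCLM.hasFDerivAt.comp q hY).mul (Complex.reCLM.hasFDerivAt.comp q hZ)))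
    rw [(h2.congr_of_eventuallyEq h1).fderiv]
    simp
    ring
  -- Second derivatives of u cancel by symmetry. What remains is dρ ∧ du₁ ∧ du₂, a three-form pulled
  -- back from a real plane; expanding dρ over 1 and i makes its vanishing a polynomial identity.
  rw [key, key, key, fderiv_fderiv_comm hV hu hqV Y X, fderiv_fderiv_comm hV hu hqV Z X,
    fderiv_fderiv_comm hV hu hqV Z Y, hR' (fderiv ℝ u q X), hR' (fderiv ℝ u q Y),
    hR' (fderiv ℝ u q Z)]
  simp
  ring

theorem areaForm_swap {g : Metric S} (hg : IsConformal g) (p : S) (u v : ℂ) :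
    areaForm g p u v = -areaForm g p v u := by
  rw [areaForm_eq hg, areaForm_eq hg, ← mul_neg]
  congr 1
  simp
  ring

theorem pullbackArea_swap {g : Metric S} (hg : IsConformal g) (q X Y : E) :
    pullbackArea g Ψ q X Y = -pullbackArea g Ψ q Y X :=
  areaForm_swap hg _ _ _

end PullbackArea

theorem areaForm_smul_left {g : Metric S} (hg : IsConformal g) (p : S) (r : ℝ) (u v : ℂ) :
    areaForm g p (r • u : ℂ) v = r * areaForm g p u v := by
  rw [areaForm_eq hg, areaForm_eq hg]
  simp
  ring

/-! ### Chain rules and the reparametrisation of the isotopy parameter -/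

section Slices

variable {E E' : Type*} [NormedAddCommGroup E] [NormedSpace ℝ E] [NormedAddCommGroup E']
  [NormedSpace ℝ E']

theorem mfderiv_comp_of_hasFDerivAt {Ψ : E → S} {ℓ : E' → E} {L : E' →L[ℝ] E} {p : E'}
    (hΨ : MDifferentiableAt 𝓘(ℝ, E) 𝓘(ℝ, ℂ) Ψ (ℓ p)) (hℓ : HasFDerivAt ℓ L p) (v : E') :
    mfderiv 𝓘(ℝ, E') 𝓘(ℝ, ℂ) (fun p => Ψ (ℓ p)) p v =
      mfderiv 𝓘(ℝ, E) 𝓘(ℝ, ℂ) Ψ (ℓ p) (L v) := by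
  have h := HasMFDerivAt.comp p hΨ.hasMFDerivAt hℓ.hasMFDerivAt
  have h2 : mfderiv 𝓘(ℝ, E') 𝓘(ℝ, ℂ) (fun p => Ψ (ℓ p)) p = _ := h.mfderiv
  rw [h2]
  rfl

theorem mdifferentiableAt_of_contMDiffOn {Ψ : E → S} {W : Set E} (hW : IsOpen W)
    (hΨ : ContMDiffOn 𝓘(ℝ, E) 𝓘(ℝ, ℂ) ∞ Ψ W) {q : E} (hq : q ∈ W) :
    MDifferentiableAt 𝓘(ℝ, E) 𝓘(ℝ, ℂ) Ψ q :=
  (hΨ.contMDiffAt (hW.mem_nhds hq)).mdifferentiableAt (by simp)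

theorem hasFDerivAt_prodMk_const_left (σ : ℝ) (q : E) :
    HasFDerivAt (fun s : ℝ => (s, q)) (ContinuousLinearMap.inl ℝ ℝ E) σ :=
  hasFDerivAt_prodMk_left σ q

end Slices

/-- A smooth monotone map of `[0, π]` onto `[0, 1]` which is defined on `ℝ` with values in
`[0, 1]`. -/
def unitWave (σ : ℝ) : ℝ := (1 - Real.cos σ) / 2

/-- Since every real σ lands in [0, 1], an isotopy that is smooth only over the closed interval
becomes smooth in σ over all of ℝ. -/
theorem unitWave_mem (σ : ℝ) : unitWave σ ∈ Icc (0 : ℝ) 1 := by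
  have h1 := Real.neg_one_le_cos σ
  have h2 := Real.cos_le_one σ
  constructor <;> unfold unitWave <;> linarith

theorem unitWave_zero : unitWave 0 = 0 := by simp [unitWave]

theorem unitWave_pi : unitWave Real.pi = 1 := by simp [unitWave]

theorem contDiff_unitWave : ContDiff ℝ ∞ unitWave :=
  (contDiff_const.sub Real.contDiff_cos).div_const 2

theorem hasDerivAt_unitWave (σ : ℝ) : HasDerivAt unitWave (Real.sin σ / 2) σ := by
  have h := ((Real.hasDerivAt_cos σ).const_sub 1).div_const 2
  simp only [neg_neg] at h
  exact h

theorem unitWave_mem_Ioo {σ : ℝ} (h : σ ∈ Ioo 0 Real.pi) : unitWave σ ∈ Ioo (0 : ℝ) 1 := by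
  have h1 : Real.cos σ < 1 := by
    rw [← Real.cos_zero]
    exact Real.cos_lt_cos_of_nonneg_of_le_pi le_rfl h.2.le h.1
  have h2 : -1 < Real.cos σ := by
    rw [← Real.cos_pi]
    exact Real.cos_lt_cos_of_nonneg_of_le_pi h.1.le le_rfl h.2
  constructor <;> unfold unitWave <;> linarith

theorem image_unitWave_Ioo : unitWave '' Ioo 0 Real.pi = Ioo 0 1 := by
  refine Subset.antisymm (image_subset_iff.2 fun σ h => unitWave_mem_Ioo h) fun s hs => ?_
  refine ⟨Real.arccos (1 - 2 * s), ⟨?_, ?_⟩, ?_⟩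
  · exact Real.arccos_pos.2 (by linarith [hs.1])
  · exact lt_of_le_of_ne (Real.arccos_le_pi _) fun h => by
      have := Real.arccos_eq_pi.1 h
      linarith [hs.2]
  · unfold unitWave
    rw [Real.cos_arccos (by linarith [hs.2]) (by linarith [hs.1])]
    ring

/-- Change of variables on the open intervals, where the substitution is a bijection with positive
derivative; no regularity of `F` is needed. -/
theorem integral_unitWave (F : ℝ → ℝ) :
    ∫ s in (0 : ℝ)..1, F s = ∫ σ in (0 : ℝ)..Real.pi, Real.sin σ / 2 * F (unitWave σ) := by
  rw [intervalIntegral.integral_of_le zero_le_one, intervalIntegral.integral_of_le Real.pi_pos.le,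
    MeasureTheory.integral_Ioc_eq_integral_Ioo, MeasureTheory.integral_Ioc_eq_integral_Ioo,
    ← image_unitWave_Ioo, MeasureTheory.integral_image_eq_integral_abs_deriv_smul measurableSet_Ioo
      (fun σ _ => (hasDerivAt_unitWave σ).hasDerivWithinAt)]
  · refine MeasureTheory.setIntegral_congr_fun measurableSet_Ioo fun σ hσ => ?_
    simp only [smul_eq_mul]
    rw [abs_of_pos (by have := Real.sin_pos_of_mem_Ioo hσ; positivity)]
  · intro σ hσ τ hτ h
    refine Real.injOn_cos (Ioo_subset_Icc_self hσ) (Ioo_subset_Icc_self hτ) ?_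
    unfold unitWave at h
    linarith

/-! ### The flux form in a chart, and its closedness -/

section Flux

variable {g : Metric S} {φ : ℝ → S → S} {f : S → S} {e : OpenPartialHomeomorph S ℂ}

/-- An isotopy, reparametrised and written in a chart of the source. -/
def isotopyInChart (φ : ℝ → S → S) (e : OpenPartialHomeomorph S ℂ) (q : ℝ × ℂ) : S :=
  φ (unitWave q.1) (e.symm q.2)

theorem IsSymplecticIsotopy.contMDiffOn_isotopyInChart (hφ : IsSymplecticIsotopy g φ f)
    (he : e ∈ atlas ℂ S) :
    ContMDiffOn 𝓘(ℝ, ℝ × ℂ) 𝓘(ℝ, ℂ) ∞ (isotopyInChart φ e) (univ ×ˢ e.target) := by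
  have h1 : ContMDiffOn 𝓘(ℝ, ℝ × ℂ) 𝓘(ℝ, ℝ) ∞ (fun q : ℝ × ℂ => unitWave q.1)
      (univ ×ˢ e.target) :=
    (contDiff_unitWave.comp contDiff_fst).contMDiff.contMDiffOn
  have h2 : ContMDiffOn 𝓘(ℝ, ℝ × ℂ) 𝓘(ℝ, ℂ) ∞ (fun q : ℝ × ℂ => e.symm q.2)
      (univ ×ˢ e.target) :=
    (contMDiffOn_chart_symm_real he).comp contDiff_snd.contMDiff.contMDiffOn fun q hq => hq.2
  exact hφ.smooth.comp (h1.prodMk h2) fun q _ => ⟨unitWave_mem _, mem_univ _⟩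

theorem mfderiv_symplectic_comp_chart_symm (hf : IsSymplectomorphism g f) (he : e ∈ atlas ℂ S)
    {z : ℂ} (hz : z ∈ e.target) (w : ℂ) :
    mfderiv 𝓘(ℝ, ℂ) 𝓘(ℝ, ℂ) (fun z => f (e.symm z)) z w =
      mfderiv 𝓘(ℝ, ℂ) 𝓘(ℝ, ℂ) f (e.symm z) (mfderiv 𝓘(ℝ, ℂ) 𝓘(ℝ, ℂ) e.symm z w) := by
  obtain ⟨⟨Φ, rfl⟩, -⟩ := hf
  have h := HasMFDerivAt.comp z (Φ.contMDiff.mdifferentiableAt (x := e.symm z)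
    (by simp)).hasMFDerivAt (mdifferentiableAt_chart_symm_real he hz).hasMFDerivAt
  have h2 : mfderiv 𝓘(ℝ, ℂ) 𝓘(ℝ, ℂ) (fun z => Φ (e.symm z)) z = _ := h.mfderiv
  rw [h2]
  rfl

theorem IsSymplecticIsotopy.mfderiv_isotopyInChart_inr (hφ : IsSymplecticIsotopy g φ f)
    (he : e ∈ atlas ℂ S) {q : ℝ × ℂ} (hz : q.2 ∈ e.target) (w : ℂ) :
    mfderiv 𝓘(ℝ, ℝ × ℂ) 𝓘(ℝ, ℂ) (isotopyInChart φ e) q (0, w) =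
      mfderiv 𝓘(ℝ, ℂ) 𝓘(ℝ, ℂ) (φ (unitWave q.1)) (e.symm q.2)
        (mfderiv 𝓘(ℝ, ℂ) 𝓘(ℝ, ℂ) e.symm q.2 w) := by
  rw [← mfderiv_symplectic_comp_chart_symm (hφ.symplectic _ (unitWave_mem q.1)) he hz]
  exact (mfderiv_comp_of_hasFDerivAt (Ψ := isotopyInChart φ e)
    (mdifferentiableAt_of_contMDiffOn (isOpen_univ.prod e.open_target)
      (hφ.contMDiffOn_isotopyInChart he) ⟨mem_univ _, hz⟩) (hasFDerivAt_prodMk_right q.1 q.2) w).symm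

theorem IsSymplecticIsotopy.mfderiv_isotopyInChart_inl (hφ : IsSymplecticIsotopy g φ f)
    (he : e ∈ atlas ℂ S) {q : ℝ × ℂ} (hz : q.2 ∈ e.target) (hq : q.1 ∈ Ioo 0 Real.pi) :
    mfderiv 𝓘(ℝ, ℝ × ℂ) 𝓘(ℝ, ℂ) (isotopyInChart φ e) q (1, 0) =
      ((Real.sin q.1 / 2) • (show ℂ from mfderiv 𝓘(ℝ, ℝ) 𝓘(ℝ, ℂ) (fun s => φ s (e.symm q.2))
        (unitWave q.1) (1 : ℝ)) : ℂ) := by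
  have h1 := (mfderiv_comp_of_hasFDerivAt (Ψ := isotopyInChart φ e)
    (mdifferentiableAt_of_contMDiffOn (isOpen_univ.prod e.open_target)
      (hφ.contMDiffOn_isotopyInChart he) ⟨mem_univ _, hz⟩)
        (hasFDerivAt_prodMk_const_left q.1 q.2) (1 : ℝ)).symm
  refine h1.trans ?_
  have hs : ContMDiffAt 𝓘(ℝ, ℝ) 𝓘(ℝ, ℂ) ∞ (fun s => φ s (e.symm q.2)) (unitWave q.1) := by
    have h2 : ContMDiffOn 𝓘(ℝ, ℝ) 𝓘(ℝ, ℂ) ∞ (fun s => φ s (e.symm q.2)) (Icc 0 1) :=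
      hφ.smooth.comp (contMDiff_id.prodMk contMDiff_const).contMDiffOn
        fun s hs => ⟨hs, mem_univ _⟩
    have h3 := unitWave_mem_Ioo hq
    exact h2.contMDiffAt (Icc_mem_nhds h3.1 h3.2)
  have h4 := mfderiv_comp_of_hasFDerivAt (Ψ := fun s => φ s (e.symm q.2)) (ℓ := unitWave)
    (hs.mdifferentiableAt (by simp)) (hasDerivAt_unitWave q.1).hasFDerivAt (1 : ℝ)
  refine h4.trans ?_
  have h5 : (ContinuousLinearMap.toSpanSingleton ℝ (Real.sin q.1 / 2)) (1 : ℝ) =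
    (Real.sin q.1 / 2) • (1 : ℝ) := by simp
  rw [h5]
  exact map_smul (show ℝ →L[ℝ] ℂ from mfderiv 𝓘(ℝ, ℝ) 𝓘(ℝ, ℂ) (fun s => φ s (e.symm q.2))
        (unitWave q.1)) _ _

/-- The flux form of a symplectic isotopy, in a chart. -/
theorem IsSymplecticIsotopy.fluxForm_chart_symm (hφ : IsSymplecticIsotopy g φ f)
    (hg : IsConformal g) (he : e ∈ atlas ℂ S) {z : ℂ} (hz : z ∈ e.target) (w : ℂ) :
    fluxForm g φ (e.symm z) (mfderiv 𝓘(ℝ, ℂ) 𝓘(ℝ, ℂ) e.symm z w) =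
      ∫ σ in (0 : ℝ)..Real.pi, pullbackArea g (isotopyInChart φ e) (σ, z) (1, 0) (0, w) := by
  unfold fluxForm
  rw [integral_unitWave, intervalIntegral.integral_of_le Real.pi_pos.le,
    intervalIntegral.integral_of_le Real.pi_pos.le,
    -- The endpoints are discarded because smoothness on [0, 1] says nothing about the two-sided
    -- derivative at s = 0 and s = 1. Inside, the factor sin σ / 2 of the substitution is exactly
    -- the one in ∂_σ.
    MeasureTheory.integral_Ioc_eq_integral_Ioo, MeasureTheory.integral_Ioc_eq_integral_Ioo]
  refine MeasureTheory.setIntegral_congr_fun measurableSet_Ioo fun σ hσ => ?_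
  simp only [pullbackArea]
  rw [hφ.mfderiv_isotopyInChart_inr he (q := (σ, z)) hz,
    hφ.mfderiv_isotopyInChart_inl he (q := (σ, z)) hz hσ]
  exact (areaForm_smul_left hg (φ (unitWave σ) (e.symm z)) _ _ _).symm

end Flux

theorem pullbackArea_right_comb {E : Type*} [NormedAddCommGroup E] [NormedSpace ℝ E]
    {g : Metric S} (hg : IsConformal g) (Ψ : E → S) (q X Y Z : E) (r s : ℝ) :
    pullbackArea g Ψ q X (r • Y + s • Z) =
      r * pullbackArea g Ψ q X Y + s * pullbackArea g Ψ q X Z := by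
  have h : ∀ Y, pullbackArea g Ψ q X Y = conformalFactor g (Ψ q) *
      (conj (show ℂ from mfderiv 𝓘(ℝ, E) 𝓘(ℝ, ℂ) Ψ q X) *
        (show E →L[ℝ] ℂ from mfderiv 𝓘(ℝ, E) 𝓘(ℝ, ℂ) Ψ q) Y).im :=
    fun Y => areaForm_eq hg _ _ _
  rw [h, h Y, h Z, map_add, map_smul, map_smul]
  simp
  ring

/-- Each φ_s preserves ω, so on vectors tangent to the slices the pullback does not depend on σ. -/
theorem IsSymplecticIsotopy.pullbackArea_inr {g : Metric S} {φ : ℝ → S → S} {f : S → S}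
    {e : OpenPartialHomeomorph S ℂ} (hφ : IsSymplecticIsotopy g φ f) (he : e ∈ atlas ℂ S)
    {q : ℝ × ℂ} (hz : q.2 ∈ e.target) (u v : ℂ) :
    pullbackArea g (isotopyInChart φ e) q (0, u) (0, v) =
      areaForm g (e.symm q.2) (mfderiv 𝓘(ℝ, ℂ) 𝓘(ℝ, ℂ) e.symm q.2 u)
        (mfderiv 𝓘(ℝ, ℂ) 𝓘(ℝ, ℂ) e.symm q.2 v) := by
  unfold pullbackArea
  rw [hφ.mfderiv_isotopyInChart_inr he hz, hφ.mfderiv_isotopyInChart_inr he hz]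
  exact (hφ.symplectic _ (unitWave_mem q.1)).2 _ _ _

/-- The flux form of a symplectic isotopy is closed. -/
theorem IsSymplecticIsotopy.isClosedForm_fluxForm {g : Metric S} {φ : ℝ → S → S} {f : S → S}
    (hφ : IsSymplecticIsotopy g φ f) (hg : IsConformal g) : IsClosedForm (fluxForm g φ) := by
  intro e he
  have hΨ := hφ.contMDiffOn_isotopyInChart he
  set Ψ := isotopyInChart φ e
  have hW : IsOpen ((univ : Set ℝ) ×ˢ e.target) := isOpen_univ.prod e.open_target
  have hsm : ∀ w : ℂ, ContDiffOn ℝ ∞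
      (fun q => pullbackArea g Ψ q (1, 0) (0, w)) (univ ×ˢ e.target) :=
    fun w => contDiffOn_pullbackArea hg hW hΨ _ _
  let a : ℂ → ℂ → ℝ := fun w z => ∫ σ in (0 : ℝ)..Real.pi, pullbackArea g Ψ (σ, z) (1, 0) (0, w)
  have ha : ∀ w, ContDiffOn ℝ ∞ (a w) e.target := fun w =>
    contDiffOn_intervalIntegral_prod isOpen_univ (subset_univ _) e.open_target (hsm w)
  have hda : ∀ w z, z ∈ e.target → HasFDerivAt (a w) (fderiv ℝ (a w) z) z := fun w z hz =>
    (((ha w).contDiffAt (e.open_target.mem_nhds hz)).differentiableAt (by simp)).hasFDerivAt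
  have hint : ∀ z ∈ e.target, ∀ w u, fderiv ℝ (a w) z u = ∫ σ in (0 : ℝ)..Real.pi,
      fderiv ℝ (fun q => pullbackArea g Ψ q (1, 0) (0, w)) (σ, z) (0, u) := by
    intro z hz w u
    rw [(hasFDerivAt_intervalIntegral_prod isOpen_univ (subset_univ _) e.open_target
      (hsm w) hz).fderiv, ContinuousLinearMap.intervalIntegral_apply]
    · simp
    · refine ContinuousOn.intervalIntegrable ?_
      exact (((hsm w).continuousOn_fderiv_of_isOpen hW (by simp)).clm_comp continuousOn_const).comp
        (by fun_prop) (fun σ _ => ⟨mem_univ _, hz⟩)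
  refine ⟨fun z => (a 1 z) • Complex.reCLM + (a Complex.I z) • Complex.imCLM, ?_, ?_, ?_⟩
  · exact ((ha 1).smul contDiffOn_const).add ((ha _).smul contDiffOn_const)
  · intro z hz v
    rw [hφ.fluxForm_chart_symm hg he hz]
    have hv : ∀ σ : ℝ, pullbackArea g Ψ (σ, z) (1, 0) (0, v) =
        v.re * pullbackArea g Ψ (σ, z) (1, 0) (0, 1) +
          v.im * pullbackArea g Ψ (σ, z) (1, 0) (0, Complex.I) := fun σ => by
      rw [← pullbackArea_right_comb hg]
      congr 1
      simp [Complex.re_add_im]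
    have hii : ∀ w, IntervalIntegrable (fun σ => pullbackArea g Ψ (σ, z) (1, 0) (0, w))
        MeasureTheory.volume 0 Real.pi := fun w =>
      ((hsm w).continuousOn.comp (f := fun σ : ℝ => (σ, z)) (by fun_prop)
        (fun σ _ => ⟨mem_univ _, hz⟩)).intervalIntegrable
    simp only [Ψ] at hv
    rw [intervalIntegral.integral_congr fun σ _ => hv σ, intervalIntegral.integral_add
      ((hii 1).const_mul _) ((hii Complex.I).const_mul _), intervalIntegral.integral_const_mul,
      intervalIntegral.integral_const_mul]
    simp [a, Ψ]
    ring
  · intro z hz u v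
    have hA : HasFDerivAt (fun z => (a 1 z) • Complex.reCLM + (a Complex.I z) • Complex.imCLM)
        ((fderiv ℝ (a 1) z).smulRight Complex.reCLM +
          (fderiv ℝ (a Complex.I) z).smulRight Complex.imCLM) z :=
      ((hda 1 z hz).smul_const Complex.reCLM).add ((hda Complex.I z hz).smul_const Complex.imCLM)
    rw [hA.fderiv]
    -- The pullback of ω is closed; apply this to ∂_σ, 1, i. The term ∂_σ ω(1, i) vanishes since the
    -- slices are symplectic, and the other two terms are the two sides of this equation under the
    -- integral.
    have hsym : fderiv ℝ (a 1) z Complex.I = fderiv ℝ (a Complex.I) z 1 := by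
      rw [hint z hz, hint z hz]
      refine intervalIntegral.integral_congr fun σ _ => ?_
      have hq : (σ, z) ∈ (univ : Set ℝ) ×ˢ e.target := ⟨mem_univ _, hz⟩
      have hcyc := fderiv_pullbackArea_cyclic hg hW hΨ hq (1, 0) (0, 1) (0, Complex.I)
      have h0 : fderiv ℝ (fun q => pullbackArea g Ψ q (0, 1) (0, Complex.I)) (σ, z) (1, 0) = 0 := by
        have hd : HasFDerivAt (fun q => pullbackArea g Ψ q (0, 1) (0, Complex.I)) _ (σ, z) :=
          (((contDiffOn_pullbackArea hg hW hΨ (0, 1) (0, Complex.I)).contDiffAt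
            (hW.mem_nhds hq)).differentiableAt (by simp)).hasFDerivAt
        have h1 := hd.comp σ (hasFDerivAt_prodMk_const_left σ z)
        have h2 : ((fun q => pullbackArea g Ψ q (0, 1) (0, Complex.I)) ∘ fun s : ℝ => (s, z)) =
            fun _ => areaForm g (e.symm z) (mfderiv 𝓘(ℝ, ℂ) 𝓘(ℝ, ℂ) e.symm z (1 : ℂ))
              (mfderiv 𝓘(ℝ, ℂ) 𝓘(ℝ, ℂ) e.symm z Complex.I) :=
          funext fun s => hφ.pullbackArea_inr he (q := (s, z)) hz _ _
        rw [h2] at h1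
        have h3 := h1.unique (hasFDerivAt_const _ σ)
        simpa using DFunLike.congr_fun h3 1
      have hsw : (fun q => pullbackArea g Ψ q (0, Complex.I) (1, 0)) =
          fun q => -pullbackArea g Ψ q (1, 0) (0, Complex.I) :=
        funext fun q => pullbackArea_swap hg _ _ _
      rw [h0, hsw, fderiv_fun_neg] at hcyc
      simp only [neg_apply] at hcyc
      linarith
    have hlin : ∀ (L : ℂ →L[ℝ] ℝ) (v : ℂ), L v = v.re * L 1 + v.im * L Complex.I := fun L v => by
      conv_lhs => rw [show v = v.re • (1 : ℂ) + v.im • Complex.I by simp [Complex.re_add_im]]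
      simp only [map_add, map_smul, smul_eq_mul]
    simp only [add_apply, ContinuousLinearMap.smulRight_apply,
      smul_apply, smul_eq_mul, Complex.reCLM_apply, Complex.imCLM_apply]
    rw [hlin _ u, hlin _ v, hlin (fderiv ℝ (a Complex.I) z) u, hlin (fderiv ℝ (a Complex.I) z) v,
      hsym]
    ring

/-! ### Functoriality of the pullback, and the time substitution t = r² -/

section PullbackAreaComp

variable {E E' : Type*} [NormedAddCommGroup E] [NormedSpace ℝ E] [NormedAddCommGroup E']
  [NormedSpace ℝ E'] {g : Metric S}

theorem pullbackArea_comp {Ψ : E → S} {ℓ : E' → E} {L : E' →L[ℝ] E} {p : E'}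
    (hΨ : MDifferentiableAt 𝓘(ℝ, E) 𝓘(ℝ, ℂ) Ψ (ℓ p)) (hℓ : HasFDerivAt ℓ L p) (X Y : E') :
    pullbackArea g (fun p => Ψ (ℓ p)) p X Y = pullbackArea g Ψ (ℓ p) (L X) (L Y) := by
  unfold pullbackArea
  rw [mfderiv_comp_of_hasFDerivAt hΨ hℓ, mfderiv_comp_of_hasFDerivAt hΨ hℓ]

theorem pullbackArea_congr (hg : IsConformal g) {Ψ Ψ' : E → S} {q : E} (h : Ψ =ᶠ[𝓝 q] Ψ')
    (X Y : E) : pullbackArea g Ψ q X Y = pullbackArea g Ψ' q X Y := by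
  have h1 : (show E →L[ℝ] ℂ from mfderiv 𝓘(ℝ, E) 𝓘(ℝ, ℂ) Ψ q) =
    (show E →L[ℝ] ℂ from mfderiv 𝓘(ℝ, E) 𝓘(ℝ, ℂ) Ψ' q) := h.mfderiv_eq
  refine (areaForm_eq hg _ _ _).trans (Eq.trans ?_ (areaForm_eq hg _ _ _).symm)
  change conformalFactor g (Ψ q) * (conj ((show E →L[ℝ] ℂ from mfderiv 𝓘(ℝ, E) 𝓘(ℝ, ℂ) Ψ q) X) *
    (show E →L[ℝ] ℂ from mfderiv 𝓘(ℝ, E) 𝓘(ℝ, ℂ) Ψ q) Y).im = _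
  rw [h1, h.eq_of_nhds]
  rfl

end PullbackAreaComp

/-- The set of `r` with `r ^ 2 < T`. -/
def sqrtDomain (T : EReal) : Set ℝ := {r | ((r ^ 2 : ℝ) : EReal) < T}

/-- Openness is the purpose of t = r²: the initial time t = 0 becomes the interior point r = 0. -/
theorem isOpen_sqrtDomain (T : EReal) : IsOpen (sqrtDomain T) :=
  isOpen_Iio.preimage (continuous_coe_real_ereal.comp (continuous_pow 2))

theorem sq_mem_timeInterval {T : EReal} {r : ℝ} (hr : r ∈ sqrtDomain T) :
    r ^ 2 ∈ timeInterval T := ⟨sq_nonneg r, hr⟩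

theorem uIcc_subset_sqrtDomain {T : EReal} {τ : ℝ} (hτ : τ ∈ sqrtDomain T) :
    uIcc 0 τ ⊆ sqrtDomain T := by
  intro r hr
  refine lt_of_le_of_lt (EReal.coe_le_coe_iff.2 ?_) hτ
  rw [sq_le_sq]
  rcases mem_uIcc.1 hr with h | h
  · rw [abs_of_nonneg h.1, abs_of_nonneg (h.1.trans h.2)]; exact h.2
  · rw [abs_of_nonpos h.2, abs_of_nonpos (h.1.trans h.2)]; linarith

/-! ### First variation of the flux in a two-parameter family -/

section Family

variable {g : Metric S} {T : EReal} {φ f_ : ℝ → S → S} {Φ : ℝ → ℝ → S → S}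
  {e : OpenPartialHomeomorph S ℂ}

/-- A two-parameter family, reparametrised and written in a chart of the source. -/
def familyInChart (Φ : ℝ → ℝ → S → S) (e : OpenPartialHomeomorph S ℂ) (q : ℝ × ℝ × ℂ) : S :=
  Φ (unitWave q.1) (q.2.1 ^ 2) (e.symm q.2.2)

/-- A one-parameter family, reparametrised and written in a chart of the source. -/
def flowInChart (f_ : ℝ → S → S) (e : OpenPartialHomeomorph S ℂ) (q : ℝ × ℂ) : S :=
  f_ (q.1 ^ 2) (e.symm q.2)

theorem IsIsotopyAlongFlow.contMDiffOn_familyInChart (hΦ : IsIsotopyAlongFlow g T φ f_ Φ)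
    (he : e ∈ atlas ℂ S) :
    ContMDiffOn 𝓘(ℝ, ℝ × ℝ × ℂ) 𝓘(ℝ, ℂ) ∞ (familyInChart Φ e)
      (univ ×ˢ sqrtDomain T ×ˢ e.target) := by
  have h1 : ContMDiffOn 𝓘(ℝ, ℝ × ℝ × ℂ) 𝓘(ℝ, ℝ) ∞ (fun q : ℝ × ℝ × ℂ => unitWave q.1)
      (univ ×ˢ sqrtDomain T ×ˢ e.target) :=
    (contDiff_unitWave.comp contDiff_fst).contMDiff.contMDiffOn
  have h2 : ContMDiffOn 𝓘(ℝ, ℝ × ℝ × ℂ) 𝓘(ℝ, ℝ) ∞ (fun q : ℝ × ℝ × ℂ => q.2.1 ^ 2)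
      (univ ×ˢ sqrtDomain T ×ˢ e.target) :=
    ((contDiff_fst.comp contDiff_snd).pow 2).contMDiff.contMDiffOn
  have h3 : ContMDiffOn 𝓘(ℝ, ℝ × ℝ × ℂ) 𝓘(ℝ, ℂ) ∞ (fun q : ℝ × ℝ × ℂ => e.symm q.2.2)
      (univ ×ˢ sqrtDomain T ×ˢ e.target) :=
    (contMDiffOn_chart_symm_real he).comp
      (contDiff_snd.comp contDiff_snd).contMDiff.contMDiffOn fun q hq => hq.2.2
  exact hΦ.smooth.comp (h1.prodMk (h2.prodMk h3)) fun q hq =>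
    ⟨unitWave_mem _, sq_mem_timeInterval hq.2.1, mem_univ _⟩

theorem contMDiffOn_flowInChart (hf : ContMDiffOn (𝓘(ℝ, ℝ).prod 𝓘(ℝ, ℂ)) 𝓘(ℝ, ℂ) ∞
    (fun q : ℝ × S => f_ q.1 q.2) (timeInterval T ×ˢ univ)) (he : e ∈ atlas ℂ S) :
    ContMDiffOn 𝓘(ℝ, ℝ × ℂ) 𝓘(ℝ, ℂ) ∞ (flowInChart f_ e) (sqrtDomain T ×ˢ e.target) := by
  have h2 : ContMDiffOn 𝓘(ℝ, ℝ × ℂ) 𝓘(ℝ, ℝ) ∞ (fun q : ℝ × ℂ => q.1 ^ 2)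
      (sqrtDomain T ×ˢ e.target) :=
    (contDiff_fst.pow 2).contMDiff.contMDiffOn
  have h3 : ContMDiffOn 𝓘(ℝ, ℝ × ℂ) 𝓘(ℝ, ℂ) ∞ (fun q : ℝ × ℂ => e.symm q.2)
      (sqrtDomain T ×ˢ e.target) :=
    (contMDiffOn_chart_symm_real he).comp contDiff_snd.contMDiff.contMDiffOn fun q hq => hq.2
  exact hf.comp (h2.prodMk h3) fun q hq => ⟨sq_mem_timeInterval hq.1, mem_univ _⟩

theorem IsIsotopyAlongFlow.fluxForm_chart_symm (hΦ : IsIsotopyAlongFlow g T φ f_ Φ)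
    (hg : IsConformal g) (he : e ∈ atlas ℂ S) {r : ℝ} (hr : r ∈ sqrtDomain T)
    {z : ℂ} (hz : z ∈ e.target) (w : ℂ) :
    fluxForm g (fun s => Φ s (r ^ 2)) (e.symm z) (mfderiv 𝓘(ℝ, ℂ) 𝓘(ℝ, ℂ) e.symm z w) =
      ∫ σ in (0 : ℝ)..Real.pi,
        pullbackArea g (familyInChart Φ e) (σ, r, z) (1, 0, 0) (0, 0, w) := by
  rw [(hΦ.isotopy _ (sq_mem_timeInterval hr)).fluxForm_chart_symm hg he hz]
  refine intervalIntegral.integral_congr fun σ _ => ?_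
  have hO : IsOpen ((univ : Set ℝ) ×ˢ sqrtDomain T ×ˢ e.target) :=
    isOpen_univ.prod ((isOpen_sqrtDomain T).prod e.open_target)
  let L : ℝ × ℂ →L[ℝ] ℝ × ℝ × ℂ := (ContinuousLinearMap.fst ℝ ℝ ℂ).prod
    ((0 : ℝ × ℂ →L[ℝ] ℝ).prod (ContinuousLinearMap.snd ℝ ℝ ℂ))
  have hL : HasFDerivAt (fun p : ℝ × ℂ => (p.1, r, p.2)) L (σ, z) :=
    hasFDerivAt_fst.prodMk ((hasFDerivAt_const r _).prodMk hasFDerivAt_snd)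
  have h := pullbackArea_comp (g := g) (Ψ := familyInChart Φ e)
    (mdifferentiableAt_of_contMDiffOn hO (hΦ.contMDiffOn_familyInChart he)
      ⟨mem_univ _, hr, hz⟩) hL (1, 0) (0, w)
  exact h

/-- The upper boundary term of the variation: at σ = π the family is the flow f_t itself. -/
theorem IsIsotopyAlongFlow.pullbackArea_pi (hΦ : IsIsotopyAlongFlow g T φ f_ Φ)
    (hg : IsConformal g) (he : e ∈ atlas ℂ S) {r : ℝ} (hr : r ∈ sqrtDomain T)
    {z : ℂ} (hz : z ∈ e.target) (w : ℂ) :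
    pullbackArea g (familyInChart Φ e) (Real.pi, r, z) (0, 1, 0) (0, 0, w) =
      pullbackArea g (flowInChart f_ e) (r, z) (1, 0) (0, w) := by
  have hO : IsOpen ((univ : Set ℝ) ×ˢ sqrtDomain T ×ˢ e.target) :=
    isOpen_univ.prod ((isOpen_sqrtDomain T).prod e.open_target)
  have h := pullbackArea_comp (g := g) (Ψ := familyInChart Φ e)
    (mdifferentiableAt_of_contMDiffOn hO (hΦ.contMDiffOn_familyInChart he)
      ⟨mem_univ _, hr, hz⟩) (hasFDerivAt_prodMk_right Real.pi (r, z)) (1, 0) (0, w)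
  refine Eq.trans h.symm (pullbackArea_congr hg ?_ _ _)
  filter_upwards [((isOpen_sqrtDomain T).prod e.open_target).mem_nhds (show (r, z) ∈ _ from
    ⟨hr, hz⟩)] with q hq
  simp only [familyInChart, flowInChart, unitWave_pi]
  exact congrFun (hΦ.isotopy _ (sq_mem_timeInterval hq.1)).one _

/-- The lower boundary term: at σ = 0 the family is the identity for every r, so ∂_r of it is zero.
-/
theorem IsIsotopyAlongFlow.pullbackArea_zero (hΦ : IsIsotopyAlongFlow g T φ f_ Φ)
    (hg : IsConformal g) (he : e ∈ atlas ℂ S) {r : ℝ} (hr : r ∈ sqrtDomain T)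
    {z : ℂ} (hz : z ∈ e.target) (w : ℂ) :
    pullbackArea g (familyInChart Φ e) (0, r, z) (0, 1, 0) (0, 0, w) = 0 := by
  have hO : IsOpen ((univ : Set ℝ) ×ˢ sqrtDomain T ×ˢ e.target) :=
    isOpen_univ.prod ((isOpen_sqrtDomain T).prod e.open_target)
  have h := pullbackArea_comp (g := g) (Ψ := familyInChart Φ e)
    (mdifferentiableAt_of_contMDiffOn hO (hΦ.contMDiffOn_familyInChart he)
      ⟨mem_univ _, hr, hz⟩) (hasFDerivAt_prodMk_right (0 : ℝ) (r, z)) (1, 0) (0, w)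
  refine Eq.trans h.symm ?_
  have h2 : (fun p : ℝ × ℂ => familyInChart Φ e (0, p)) =ᶠ[𝓝 (r, z)] fun p => e.symm p.2 := by
    filter_upwards [((isOpen_sqrtDomain T).prod e.open_target).mem_nhds (show (r, z) ∈ _ from
      ⟨hr, hz⟩)] with q hq
    simp only [familyInChart, unitWave_zero]
    exact congrFun (hΦ.isotopy _ (sq_mem_timeInterval hq.1)).zero _
  rw [pullbackArea_congr hg h2, pullbackArea_comp (Ψ := e.symm) (ℓ := Prod.snd)
    (mdifferentiableAt_chart_symm_real he hz) hasFDerivAt_snd]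
  refine (areaForm_chart_symm hg he hz _ _).trans ?_
  simp

/-- `∫ ω(∂_σ, ∂_τ) dσ` for a two-parameter family, in a chart. -/
def sweptArea (g : Metric S) (Φ : ℝ → ℝ → S → S) (e : OpenPartialHomeomorph S ℂ)
    (q : ℝ × ℂ) : ℝ :=
  ∫ σ in (0 : ℝ)..Real.pi, pullbackArea g (familyInChart Φ e) (σ, q) (1, 0, 0) (0, 1, 0)

theorem IsIsotopyAlongFlow.contDiffOn_sweptArea (hΦ : IsIsotopyAlongFlow g T φ f_ Φ)
    (hg : IsConformal g) (he : e ∈ atlas ℂ S) :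
    ContDiffOn ℝ ∞ (sweptArea g Φ e) (sqrtDomain T ×ˢ e.target) :=
  contDiffOn_intervalIntegral_prod isOpen_univ (subset_univ _)
    ((isOpen_sqrtDomain T).prod e.open_target) (contDiffOn_pullbackArea hg
    (isOpen_univ.prod ((isOpen_sqrtDomain T).prod e.open_target))
      (hΦ.contMDiffOn_familyInChart he) _ _)

/-- With Ω the closed pullback of ω, closedness on constant fields reads ∂_r Ω(∂_σ, w) = ∂_σ Ω(∂_r,
w) + ∂_w Ω(∂_σ, ∂_r). Integrated over σ, the first term gives the boundary values and the second the
differential of the swept area. -/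
theorem IsIsotopyAlongFlow.hasDerivAt_flux (hΦ : IsIsotopyAlongFlow g T φ f_ Φ)
    (hg : IsConformal g) (he : e ∈ atlas ℂ S) {r : ℝ} (hr : r ∈ sqrtDomain T)
    {z : ℂ} (hz : z ∈ e.target) (w : ℂ) :
    HasDerivAt (fun r => ∫ σ in (0 : ℝ)..Real.pi,
        pullbackArea g (familyInChart Φ e) (σ, r, z) (1, 0, 0) (0, 0, w))
      (pullbackArea g (flowInChart f_ e) (r, z) (1, 0) (0, w) +
        fderiv ℝ (sweptArea g Φ e) (r, z) (0, w)) r := by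
  have hU : IsOpen (sqrtDomain T ×ˢ e.target) := (isOpen_sqrtDomain T).prod e.open_target
  have hO : IsOpen ((univ : Set ℝ) ×ˢ sqrtDomain T ×ˢ e.target) := isOpen_univ.prod hU
  have hΨ := hΦ.contMDiffOn_familyInChart he
  have hp : (r, z) ∈ sqrtDomain T ×ˢ e.target := ⟨hr, hz⟩
  have hsm := fun X Y => contDiffOn_pullbackArea hg hO hΨ X Y
  have hcont : ∀ X Y V, ContinuousOn (fun σ : ℝ =>
      fderiv ℝ (fun q => pullbackArea g (familyInChart Φ e) q X Y) (σ, r, z) V)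
      (uIcc 0 Real.pi) := fun X Y V =>
    (((hsm X Y).continuousOn_fderiv_of_isOpen hO (by simp)).clm_apply continuousOn_const).comp
      (by fun_prop) (fun σ _ => ⟨mem_univ _, hp⟩)
  have happ : ∀ X Y (V : ℝ × ℂ), fderiv ℝ (fun p : ℝ × ℂ => ∫ σ in (0 : ℝ)..Real.pi,
      pullbackArea g (familyInChart Φ e) (σ, p) X Y) (r, z) V =
      ∫ σ in (0 : ℝ)..Real.pi,
        fderiv ℝ (fun q => pullbackArea g (familyInChart Φ e) q X Y) (σ, r, z) (0, V) := by
    intro X Y V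
    rw [(hasFDerivAt_intervalIntegral_prod isOpen_univ (subset_univ _) hU (hsm X Y) hp).fderiv,
      ContinuousLinearMap.intervalIntegral_apply]
    · simp
    · refine ContinuousOn.intervalIntegrable ?_
      exact (((hsm X Y).continuousOn_fderiv_of_isOpen hO (by simp)).clm_comp
        continuousOn_const).comp (by fun_prop) (fun σ _ => ⟨mem_univ _, hp⟩)
  have hF : HasFDerivAt (fun p : ℝ × ℂ => ∫ σ in (0 : ℝ)..Real.pi,
      pullbackArea g (familyInChart Φ e) (σ, p) (1, 0, 0) (0, 0, w)) _ (r, z) :=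
    (hasFDerivAt_intervalIntegral_prod isOpen_univ (subset_univ _) hU
      (hsm (1, 0, 0) (0, 0, w)) hp).differentiableAt.hasFDerivAt
  have hD := (hF.comp r (hasFDerivAt_prodMk_const_left r z)).hasDerivAt
  convert! hD using 1
  simp only [ContinuousLinearMap.comp_apply, ContinuousLinearMap.inl_apply]
  rw [happ, show fderiv ℝ (sweptArea g Φ e) (r, z) (0, w) = _ from happ (1, 0, 0) (0, 1, 0) (0, w)]
  have hend : pullbackArea g (flowInChart f_ e) (r, z) (1, 0) (0, w) =
      ∫ σ in (0 : ℝ)..Real.pi, fderiv ℝ (fun q => pullbackArea g (familyInChart Φ e) q (0, 1, 0)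
        (0, 0, w)) (σ, r, z) (1, 0, 0) := by
    rw [intervalIntegral.integral_eq_sub_of_hasDerivAt (f := fun σ => pullbackArea g
      (familyInChart Φ e) (σ, r, z) (0, 1, 0) (0, 0, w)) _ (hcont _ _ _).intervalIntegrable]
    · rw [hΦ.pullbackArea_pi hg he hr hz, hΦ.pullbackArea_zero hg he hr hz, sub_zero]
    · intro σ _
      have h1 : HasFDerivAt (fun q => pullbackArea g (familyInChart Φ e) q (0, 1, 0)
        (0, 0, w)) _ (σ, r, z) := (((hsm (0, 1, 0) (0, 0, w)).contDiffAt
          (hO.mem_nhds ⟨mem_univ _, hp⟩)).differentiableAt (by simp)).hasFDerivAt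
      exact (h1.comp σ (hasFDerivAt_prodMk_const_left σ (r, z))).hasDerivAt
  rw [hend, ← intervalIntegral.integral_add (hcont _ _ _).intervalIntegrable
    (hcont _ _ _).intervalIntegrable]
  refine intervalIntegral.integral_congr fun σ _ => ?_
  have hcyc := fderiv_pullbackArea_cyclic hg hO hΨ (q := (σ, r, z)) ⟨mem_univ _, hp⟩
    (0, 1, 0) (1, 0, 0) (0, 0, w)
  have hsw : ∀ X Y, fderiv ℝ (fun q => pullbackArea g (familyInChart Φ e) q X Y) (σ, r, z) =
      -fderiv ℝ (fun q => pullbackArea g (familyInChart Φ e) q Y X) (σ, r, z) := fun X Y => by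
    rw [← fderiv_fun_neg]
    congr 1
    exact funext fun q => pullbackArea_swap hg _ _ _
  rw [hsw (0, 0, w) (0, 1, 0), hsw (0, 1, 0) (1, 0, 0)] at hcyc
  simp only [neg_apply] at hcyc
  linarith

end Family

/-! ### The Levi-Civita connection and its curvature in holomorphic charts -/

theorem real_clm_apply_eq {F : Type*} [NormedAddCommGroup F] [NormedSpace ℝ F] (L : ℂ →L[ℝ] F)
    (v : ℂ) : L v = v.re • L 1 + v.im • L Complex.I := by
  conv_lhs => rw [show v = v.re • (1 : ℂ) + v.im • Complex.I by simp [Complex.re_add_im]]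
  simp only [map_add, map_smul]

theorem fderiv_eq_two_re_wirtinger (φ : ℂ → ℝ) (z v : ℂ) :
    fderiv ℝ φ z v = 2 * (wirtinger φ z * v).re := by
  rw [real_clm_apply_eq]
  simp [wirtinger]
  ring

theorem wirtinger_eq_of_hasFDerivAt {φ : ℂ → ℝ} {D : ℂ →L[ℝ] ℝ} {z G : ℂ}
    (h : HasFDerivAt φ D z) (hD : ∀ v, D v = 2 * (G * v).re) : wirtinger φ z = G := by
  unfold wirtinger
  rw [h.fderiv, hD, hD]
  apply Complex.ext <;> simp

/-- The coefficient `∂ log ρ / ∂z` of the Levi-Civita connection in a chart. -/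
def connectionCoeff (g : Metric S) (e : OpenPartialHomeomorph S ℂ) (w : ℂ) : ℂ :=
  wirtinger (fun w => Real.log (density g e w)) w

section Charts

variable {g : Metric S} {e e₁ e₂ : OpenPartialHomeomorph S ℂ}

theorem contDiffOn_log_density (hg : IsConformal g) (he : e ∈ atlas ℂ S) :
    ContDiffOn ℝ ∞ (fun w => Real.log (density g e w)) e.target :=
  (contDiffOn_density g he).log fun _ hz => (density_pos hg he hz).ne'

theorem contDiffOn_connectionCoeff (hg : IsConformal g) (he : e ∈ atlas ℂ S) :
    ContDiffOn ℝ ∞ (connectionCoeff g e) e.target := by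
  have h : ∀ v, ContDiffOn ℝ ∞
      (fun z => ((fderiv ℝ (fun w => Real.log (density g e w)) z v : ℝ) : ℂ)) e.target := fun v =>
    Complex.ofRealCLM.contDiff.comp_contDiffOn
      (((contDiffOn_log_density hg he).fderiv_of_isOpen e.open_target (by simp)).clm_apply
        contDiffOn_const)
  exact ((h 1).sub (contDiffOn_const.mul (h Complex.I))).div_const 2

/-- The curvature of the connection, for a metric of constant curvature. -/
theorem curvature_connectionCoeff (hg : IsConformal g) {c : ℝ} (hc : HasConstantCurvature g c)
    (he : e ∈ atlas ℂ S) {z : ℂ} (hz : z ∈ e.target) (p q : ℂ) :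
    (fderiv ℝ (connectionCoeff g e) z p * q - fderiv ℝ (connectionCoeff g e) z q * p).im =
      -c * (density g e z * (conj p * q).im) := by
  set φ : ℂ → ℝ := fun w => Real.log (density g e w) with hφ
  have hφs : ContDiffOn ℝ ∞ φ e.target := contDiffOn_log_density hg he
  have hd : ∀ v, HasFDerivAt (fun z => fderiv ℝ φ z v) ((fderiv ℝ (fderiv ℝ φ) z).flip v) z :=
    fun v => hasFDerivAt_fderiv_apply e.open_target hφs hz v
  have hΓ : ∀ v, fderiv ℝ (connectionCoeff g e) z v =
      ((fderiv ℝ (fderiv ℝ φ) z v 1 : ℂ) - Complex.I * (fderiv ℝ (fderiv ℝ φ) z v Complex.I : ℂ)) /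
        2 := by
    intro v
    have h : HasFDerivAt (connectionCoeff g e) _ z :=
      (((Complex.ofRealCLM.hasFDerivAt.comp z (hd 1)).sub
        ((Complex.ofRealCLM.hasFDerivAt.comp z (hd Complex.I)).const_mul
          Complex.I)).mul_const (2⁻¹ : ℂ))
    rw [h.fderiv]
    simp
    ring
  -- Constant curvature enters here, as Δ log ρ = −2cρ. Antisymmetrising the derivative of ∂ log ρ
  -- leaves only its ∂̄-part, which is Δ log ρ / 4.
  have hlap : fderiv ℝ (fderiv ℝ φ) z 1 1 + fderiv ℝ (fderiv ℝ φ) z Complex.I Complex.I =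
      -2 * c * density g e z := by
    have h := hc e he z hz
    have hpos := density_pos hg he hz
    unfold gaussCurvature at h
    rw [InnerProductSpace.laplacian_eq_iteratedFDeriv_complexPlane] at h
    simp only [iteratedFDeriv_two_apply, Matrix.cons_val_zero, Matrix.cons_val_one] at h
    rw [div_eq_iff (by positivity)] at h
    linarith
  have hsym := fderiv_fderiv_comm e.open_target hφs hz 1 Complex.I
  have hlin : ∀ v w, fderiv ℝ (fderiv ℝ φ) z v w =
      v.re * fderiv ℝ (fderiv ℝ φ) z 1 w + v.im * fderiv ℝ (fderiv ℝ φ) z Complex.I w := by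
    intro v w
    rw [real_clm_apply_eq (fderiv ℝ (fderiv ℝ φ) z) v]
    simp
  rw [hΓ p, hΓ q, hlin p, hlin p, hlin q, hlin q, hsym]
  have : density g e z * c = -(fderiv ℝ (fderiv ℝ φ) z 1 1 +
      fderiv ℝ (fderiv ℝ φ) z Complex.I Complex.I) / 2 := by rw [hlap]; ring
  rw [show -c * (density g e z * (conj p * q).im) = -(density g e z * c) * (conj p * q).im by ring,
    this]
  simp
  ring

theorem isOpen_transition (e₁ e₂ : OpenPartialHomeomorph S ℂ) :
    IsOpen (e₁.target ∩ e₁.symm ⁻¹' e₂.source) :=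
  e₁.symm.continuousOn.isOpen_inter_preimage e₁.open_target e₂.open_source

theorem differentiableOn_transition (h₁ : e₁ ∈ atlas ℂ S) (h₂ : e₂ ∈ atlas ℂ S) :
    DifferentiableOn ℂ (fun w => e₂ (e₁.symm w)) (e₁.target ∩ e₁.symm ⁻¹' e₂.source) := by
  have h := ((contDiffGroupoid ω 𝓘(ℂ)).compatible h₁ h₂)
  rw [contDiffGroupoid, mem_groupoid_of_pregroupoid] at h
  have h1 : ContDiffOn ℂ ω (e₁.symm ≫ₕ e₂)
    (𝓘(ℂ).symm ⁻¹' (e₁.symm ≫ₕ e₂).source ∩ range 𝓘(ℂ)) := h.1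
  have h2 := h1.differentiableOn (by simp)
  have h3 : 𝓘(ℂ).symm ⁻¹' (e₁.symm ≫ₕ e₂).source ∩ range 𝓘(ℂ) =
      e₁.target ∩ e₁.symm ⁻¹' e₂.source := by
    simp
  rw [h3] at h2
  exact h2

theorem fderiv_real_eq_deriv_mul {h : ℂ → ℂ} {w : ℂ} (hd : DifferentiableAt ℂ h w) :
    HasFDerivAt h ((ContinuousLinearMap.toSpanSingleton ℂ (deriv h w)).restrictScalars ℝ) w :=
  hd.hasDerivAt.hasFDerivAt.restrictScalars ℝ

theorem density_transition (hg : IsConformal g) (h₁ : e₁ ∈ atlas ℂ S) (h₂ : e₂ ∈ atlas ℂ S)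
    {w : ℂ} (hw : w ∈ e₁.target ∩ e₁.symm ⁻¹' e₂.source) :
    density g e₁ w = density g e₂ (e₂ (e₁.symm w)) *
      Complex.normSq (deriv (fun w => e₂ (e₁.symm w)) w) := by
  have ha := areaForm_chart_symm hg h₁ hw.1 1 Complex.I
  have hb := pullbackArea_eq hg e₁.open_target (contMDiffOn_chart_symm_real h₁) h₂ hw 1 Complex.I
  have hd := fderiv_real_eq_deriv_mul ((differentiableOn_transition h₁ h₂).differentiableAt
    ((isOpen_transition e₁ e₂).mem_nhds hw))
  rw [hd.fderiv] at hb
  have hab : density g e₁ w * (conj (1 : ℂ) * Complex.I).im = _ := ha.symm.trans hb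
  simp only [map_one, one_mul, Complex.I_im, mul_one] at hab
  rw [hab]
  congr 1
  simp [Complex.normSq_apply]

theorem deriv_transition_ne_zero (hg : IsConformal g) (h₁ : e₁ ∈ atlas ℂ S) (h₂ : e₂ ∈ atlas ℂ S)
    {w : ℂ} (hw : w ∈ e₁.target ∩ e₁.symm ⁻¹' e₂.source) :
    deriv (fun w => e₂ (e₁.symm w)) w ≠ 0 := by
  intro h
  have h3 := density_transition hg h₁ h₂ hw
  rw [h, map_zero, mul_zero] at h3
  exact (density_pos hg h₁ hw.1).ne' h3

/-- Apply ∂/∂z to log ρ₁ = log ρ₂ ∘ t + log |t'|², where t is the holomorphic transition map; the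
last summand contributes t''/t'. -/
theorem connectionCoeff_transition (hg : IsConformal g) (h₁ : e₁ ∈ atlas ℂ S)
    (h₂ : e₂ ∈ atlas ℂ S) {w : ℂ} (hw : w ∈ e₁.target ∩ e₁.symm ⁻¹' e₂.source) :
    connectionCoeff g e₁ w =
      connectionCoeff g e₂ (e₂ (e₁.symm w)) * deriv (fun w => e₂ (e₁.symm w)) w +
        deriv (deriv fun w => e₂ (e₁.symm w)) w / deriv (fun w => e₂ (e₁.symm w)) w := by
  set t : ℂ → ℂ := fun w => e₂ (e₁.symm w) with ht
  have hN := isOpen_transition e₁ e₂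
  have htd : DifferentiableOn ℂ t (e₁.target ∩ e₁.symm ⁻¹' e₂.source) :=
    differentiableOn_transition h₁ h₂
  have h0 : deriv t w ≠ 0 := deriv_transition_ne_zero hg h₁ h₂ hw
  have ht1 := fderiv_real_eq_deriv_mul (htd.differentiableAt (hN.mem_nhds hw))
  have ht2 := fderiv_real_eq_deriv_mul ((htd.deriv hN).differentiableAt (hN.mem_nhds hw))
  have htw : t w ∈ e₂.target := e₂.map_source hw.2
  have hlog : HasFDerivAt (fun w => Real.log (density g e₂ w)) _ (t w) :=
    (((contDiffOn_log_density hg h₂).contDiffAt (e₂.open_target.mem_nhds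
      htw)).differentiableAt (by simp)).hasFDerivAt
  have hn : HasFDerivAt (fun w => (deriv t w).re * (deriv t w).re +
      (deriv t w).im * (deriv t w).im) _ w :=
    ((Complex.reCLM.hasFDerivAt.comp w ht2).mul (Complex.reCLM.hasFDerivAt.comp w ht2)).add
      ((Complex.imCLM.hasFDerivAt.comp w ht2).mul (Complex.imCLM.hasFDerivAt.comp w ht2))
  have hn0 : (deriv t w).re * (deriv t w).re + (deriv t w).im * (deriv t w).im ≠ 0 := by
    rw [← Complex.normSq_apply]
    exact (Complex.normSq_pos.2 h0).ne'
  have hsum := (hlog.comp w ht1).add (hn.log hn0)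
  have heq : (fun w => Real.log (density g e₁ w)) =ᶠ[𝓝 w]
      fun w => Real.log (density g e₂ (t w)) + Real.log ((deriv t w).re * (deriv t w).re +
      (deriv t w).im * (deriv t w).im) := by
    filter_upwards [hN.mem_nhds hw] with w' hw'
    rw [density_transition hg h₁ h₂ hw', Real.log_mul
      (density_pos hg h₂ (e₂.map_source hw'.2)).ne'
      (Complex.normSq_pos.2 (deriv_transition_ne_zero hg h₁ h₂ hw')).ne', Complex.normSq_apply]
  refine wirtinger_eq_of_hasFDerivAt (hsum.congr_of_eventuallyEq heq) fun v => ?_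
  have hq : (deriv (deriv t) w / deriv t w * v).re = (conj (deriv t w) * deriv (deriv t) w * v).re /
      ((deriv t w).re * (deriv t w).re + (deriv t w).im * (deriv t w).im) := by
    rw [← Complex.normSq_apply, eq_div_iff (Complex.normSq_pos.2 h0).ne', ← Complex.re_mul_ofReal,
      ← Complex.mul_conj]
    congr 1
    field_simp
  rw [add_mul, Complex.add_re, mul_add, hq]
  simp only [add_apply, ContinuousLinearMap.comp_apply, fderiv_eq_two_re_wirtinger,
    smul_apply, smul_eq_mul, Function.comp]
  congr 1
  · simp [connectionCoeff, ht]
    ring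
  · field_simp
    simp
    ring

end Charts

/-! ### The connection form of ∂Ψ and its structure equation -/

/-- The derivative `∂u/∂z` of a function `u` of `(τ, z)`. -/
def dzPart (u : ℝ × ℂ → ℂ) (q : ℝ × ℂ) : ℂ :=
  (fderiv ℝ u q (0, 1) - Complex.I * fderiv ℝ u q (0, Complex.I)) / 2

/-- The connection form `Im (∇ (∂Ψ) / ∂Ψ)` of the section `∂Ψ` of `Hom(ℂ, Ψ^* TS)`, in the chart
`e` of the target. -/
def angleIn (g : Metric S) (e : OpenPartialHomeomorph S ℂ) (Ψ : ℝ × ℂ → S) (q X : ℝ × ℂ) : ℝ :=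
  (fderiv ℝ (dzPart fun q => e (Ψ q)) q X / dzPart (fun q => e (Ψ q)) q +
    connectionCoeff g e (e (Ψ q)) * fderiv ℝ (fun q => e (Ψ q)) q X).im

/-- The connection form `Im (∇ (∂Ψ) / ∂Ψ)` of the section `∂Ψ` of `Hom(ℂ, Ψ^* TS)`. -/
def angleForm (g : Metric S) (Ψ : ℝ × ℂ → S) (q X : ℝ × ℂ) : ℝ :=
  angleIn g (chartAt ℂ (Ψ q)) Ψ q X

theorem contDiffOn_dzPart {u : ℝ × ℂ → ℂ} {V : Set (ℝ × ℂ)} (hV : IsOpen V)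
    (hu : ContDiffOn ℝ ∞ u V) : ContDiffOn ℝ ∞ (dzPart u) V := by
  have h : ∀ X, ContDiffOn ℝ ∞ (fun q => fderiv ℝ u q X) V := fun X =>
    (hu.fderiv_of_isOpen hV (by simp)).clm_apply contDiffOn_const
  exact ((h _).sub (contDiffOn_const.mul (h _))).div_const 2

section Angle

variable {g : Metric S} {Ψ : ℝ × ℂ → S} {W : Set (ℝ × ℂ)} {e e₁ e₂ : OpenPartialHomeomorph S ℂ}

/-- The Jacobian in z is |∂u|² − |∂̄u|², which is not positive where ∂u = 0. -/
theorem dzPart_ne_zero (hg : IsConformal g) (hW : IsOpen W)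
    (hΨ : ContMDiffOn 𝓘(ℝ, ℝ × ℂ) 𝓘(ℝ, ℂ) ∞ Ψ W) (he : e ∈ atlas ℂ S) {q : ℝ × ℂ}
    (hq : q ∈ W ∩ Ψ ⁻¹' e.source)
    (hpos : 0 < pullbackArea g Ψ q (0, 1) (0, Complex.I)) :
    dzPart (fun q => e (Ψ q)) q ≠ 0 := by
  intro h
  rw [pullbackArea_eq hg hW hΨ he hq] at hpos
  have hρ := density_pos hg he (e.map_source hq.2)
  have h1 := pos_of_mul_pos_right hpos hρ.le
  have h2 : fderiv ℝ (fun q => e (Ψ q)) q (0, 1) =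
      Complex.I * fderiv ℝ (fun q => e (Ψ q)) q (0, Complex.I) := by
    unfold dzPart at h
    rw [div_eq_zero_iff] at h
    rcases h with h | h
    · exact sub_eq_zero.1 h
    · norm_num at h
  rw [h2] at h1
  simp at h1
  nlinarith [sq_nonneg (fderiv ℝ (fun q => e (Ψ q)) q (0, Complex.I)).re,
    sq_nonneg (fderiv ℝ (fun q => e (Ψ q)) q (0, Complex.I)).im]

/-- If u₂ = t ∘ u₁ with t holomorphic, then ∂u₂ = t'(u₁) ∂u₁. The logarithmic derivative of ∂u thus
gains (t''/t') du₁, which is what the change of connection coefficient takes away. -/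
theorem angleIn_eq_angleIn (hg : IsConformal g) (hW : IsOpen W)
    (hΨ : ContMDiffOn 𝓘(ℝ, ℝ × ℂ) 𝓘(ℝ, ℂ) ∞ Ψ W) (h₁ : e₁ ∈ atlas ℂ S) (h₂ : e₂ ∈ atlas ℂ S)
    {q : ℝ × ℂ} (hq : q ∈ W) (hq₁ : Ψ q ∈ e₁.source) (hq₂ : Ψ q ∈ e₂.source)
    (hpos : 0 < pullbackArea g Ψ q (0, 1) (0, Complex.I)) (X : ℝ × ℂ) :
    angleIn g e₂ Ψ q X = angleIn g e₁ Ψ q X := by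
  set u : ℝ × ℂ → ℂ := fun q => e₁ (Ψ q) with hu
  set t : ℂ → ℂ := fun w => e₂ (e₁.symm w) with ht
  have hV₁ := isOpen_inter_preimage_chart hW hΨ e₁
  have hV₂ := isOpen_inter_preimage_chart hW hΨ e₂
  have hV := hV₁.inter hV₂
  have hqV : q ∈ (W ∩ Ψ ⁻¹' e₁.source) ∩ (W ∩ Ψ ⁻¹' e₂.source) := ⟨⟨hq, hq₁⟩, hq, hq₂⟩
  have hus : ContDiffOn ℝ ∞ u (W ∩ Ψ ⁻¹' e₁.source) := contDiffOn_chart_comp hΨ h₁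
  have hN := isOpen_transition e₁ e₂
  have htd : DifferentiableOn ℂ t (e₁.target ∩ e₁.symm ⁻¹' e₂.source) :=
    differentiableOn_transition h₁ h₂
  have hmem : ∀ q' ∈ (W ∩ Ψ ⁻¹' e₁.source) ∩ (W ∩ Ψ ⁻¹' e₂.source),
      u q' ∈ e₁.target ∩ e₁.symm ⁻¹' e₂.source := fun q' hq' =>
    ⟨e₁.map_source hq'.1.2, by simp only [mem_preimage, hu, e₁.left_inv hq'.1.2]; exact hq'.2.2⟩
  have hcomp : ∀ q' ∈ (W ∩ Ψ ⁻¹' e₁.source) ∩ (W ∩ Ψ ⁻¹' e₂.source),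
      e₂ (Ψ q') = t (u q') := fun q' hq' => by simp only [ht, hu, e₁.left_inv hq'.1.2]
  have hD : ∀ q' ∈ (W ∩ Ψ ⁻¹' e₁.source) ∩ (W ∩ Ψ ⁻¹' e₂.source), ∀ Y,
      fderiv ℝ (fun q => e₂ (Ψ q)) q' Y = deriv t (u q') * fderiv ℝ u q' Y := by
    intro q' hq' Y
    have h1 := fderiv_real_eq_deriv_mul (htd.differentiableAt (hN.mem_nhds (hmem q' hq')))
    have h2 : HasFDerivAt u (fderiv ℝ u q') q' :=
      ((hus.contDiffAt (hV₁.mem_nhds hq'.1)).differentiableAt (by simp)).hasFDerivAt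
    have h3 : (fun q => e₂ (Ψ q)) =ᶠ[𝓝 q'] t ∘ u := by
      filter_upwards [hV.mem_nhds hq'] with q'' hq''
      exact hcomp q'' hq''
    rw [((h1.comp q' h2).congr_of_eventuallyEq h3).fderiv]
    simp [mul_comm]
  have hdz : ∀ q' ∈ (W ∩ Ψ ⁻¹' e₁.source) ∩ (W ∩ Ψ ⁻¹' e₂.source),
      dzPart (fun q => e₂ (Ψ q)) q' = deriv t (u q') * dzPart u q' := by
    intro q' hq'
    simp only [dzPart, hD q' hq']
    ring
  have hDdz : fderiv ℝ (dzPart fun q => e₂ (Ψ q)) q X =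
      deriv (deriv t) (u q) * fderiv ℝ u q X * dzPart u q +
        deriv t (u q) * fderiv ℝ (dzPart u) q X := by
    have h1 := fderiv_real_eq_deriv_mul ((htd.deriv hN).differentiableAt
      (hN.mem_nhds (hmem q hqV)))
    have h2 : HasFDerivAt u (fderiv ℝ u q) q :=
      ((hus.contDiffAt (hV₁.mem_nhds hqV.1)).differentiableAt (by simp)).hasFDerivAt
    have h3 : HasFDerivAt (dzPart u) (fderiv ℝ (dzPart u) q) q :=
      (((contDiffOn_dzPart hV₁ hus).contDiffAt (hV₁.mem_nhds hqV.1)).differentiableAt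
        (by simp)).hasFDerivAt
    have h4 : (dzPart fun q => e₂ (Ψ q)) =ᶠ[𝓝 q] fun q => deriv t (u q) * dzPart u q := by
      filter_upwards [hV.mem_nhds hqV] with q'' hq''
      exact hdz q'' hq''
    rw [(((h1.comp q h2).mul h3).congr_of_eventuallyEq h4).fderiv]
    simp
    ring
  have ha : dzPart u q ≠ 0 := dzPart_ne_zero hg hW hΨ h₁ hqV.1 hpos
  have ht0 : deriv t (u q) ≠ 0 := deriv_transition_ne_zero hg h₁ h₂ (hmem q hqV)
  unfold angleIn
  rw [hDdz, hdz q hqV, hcomp q hqV, hD q hqV,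
    show connectionCoeff g e₁ (e₁ (Ψ q)) = _ from
      connectionCoeff_transition hg h₁ h₂ (hmem q hqV)]
  congr 1
  change _ + connectionCoeff g e₂ (t (u q)) * _ = _ / dzPart u q +
    (connectionCoeff g e₂ (t (u q)) * deriv t (u q) + deriv (deriv t) (u q) / deriv t (u q)) *
      fderiv ℝ u q X
  field_simp
  ring

theorem angleForm_eventuallyEq (hg : IsConformal g) (hW : IsOpen W)
    (hΨ : ContMDiffOn 𝓘(ℝ, ℝ × ℂ) 𝓘(ℝ, ℂ) ∞ Ψ W) (he : e ∈ atlas ℂ S)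
    (hpos : ∀ q ∈ W, 0 < pullbackArea g Ψ q (0, 1) (0, Complex.I))
    {q : ℝ × ℂ} (hq : q ∈ W ∩ Ψ ⁻¹' e.source) (X : ℝ × ℂ) :
    (fun q => angleForm g Ψ q X) =ᶠ[𝓝 q] fun q => angleIn g e Ψ q X := by
  filter_upwards [(isOpen_inter_preimage_chart hW hΨ e).mem_nhds hq] with q' hq'
  exact angleIn_eq_angleIn hg hW hΨ he (chart_mem_atlas ℂ _) hq'.1 hq'.2 (mem_chart_source ℂ _)
    (hpos q' hq'.1) X

theorem contDiffOn_angleIn (hg : IsConformal g) (hW : IsOpen W)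
    (hΨ : ContMDiffOn 𝓘(ℝ, ℝ × ℂ) 𝓘(ℝ, ℂ) ∞ Ψ W) (he : e ∈ atlas ℂ S)
    (hpos : ∀ q ∈ W, 0 < pullbackArea g Ψ q (0, 1) (0, Complex.I)) (X : ℝ × ℂ) :
    ContDiffOn ℝ ∞ (fun q => angleIn g e Ψ q X) (W ∩ Ψ ⁻¹' e.source) := by
  have hV := isOpen_inter_preimage_chart hW hΨ e
  have hu := contDiffOn_chart_comp hΨ he
  have ha := contDiffOn_dzPart hV hu
  have h0 : ∀ q ∈ W ∩ Ψ ⁻¹' e.source, dzPart (fun q => e (Ψ q)) q ≠ 0 := fun q hq =>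
    dzPart_ne_zero hg hW hΨ he hq (hpos q hq.1)
  have h1 : ContDiffOn ℝ ∞ (fun q => fderiv ℝ (dzPart fun q => e (Ψ q)) q X)
      (W ∩ Ψ ⁻¹' e.source) := (ha.fderiv_of_isOpen hV (by simp)).clm_apply contDiffOn_const
  have h2 : ContDiffOn ℝ ∞ (fun q => fderiv ℝ (fun q => e (Ψ q)) q X)
      (W ∩ Ψ ⁻¹' e.source) := (hu.fderiv_of_isOpen hV (by simp)).clm_apply contDiffOn_const
  have h3 : ContDiffOn ℝ ∞ (fun q => connectionCoeff g e (e (Ψ q))) (W ∩ Ψ ⁻¹' e.source) :=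
    (contDiffOn_connectionCoeff hg he).comp hu fun q hq => e.map_source hq.2
  exact Complex.imCLM.contDiff.comp_contDiffOn ((h1.mul (ha.inv h0)).add (h3.mul h2))

theorem contDiffOn_angleForm (hg : IsConformal g) (hW : IsOpen W)
    (hΨ : ContMDiffOn 𝓘(ℝ, ℝ × ℂ) 𝓘(ℝ, ℂ) ∞ Ψ W)
    (hpos : ∀ q ∈ W, 0 < pullbackArea g Ψ q (0, 1) (0, Complex.I)) (X : ℝ × ℂ) :
    ContDiffOn ℝ ∞ (fun q => angleForm g Ψ q X) W := by
  intro q hq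
  have he : chartAt ℂ (Ψ q) ∈ atlas ℂ S := chart_mem_atlas ℂ _
  have hqV : q ∈ W ∩ Ψ ⁻¹' (chartAt ℂ (Ψ q)).source := ⟨hq, mem_chart_source ℂ _⟩
  exact (((contDiffOn_angleIn hg hW hΨ he hpos X).contDiffAt
    ((isOpen_inter_preimage_chart hW hΨ _).mem_nhds hqV)).congr_of_eventuallyEq
      (angleForm_eventuallyEq hg hW hΨ he hpos hqV X)).contDiffWithinAt

/-- The structure equation `d (angle form) = - c Ψ^* ω`. -/
theorem fderiv_angleForm_sub (hg : IsConformal g) {c : ℝ} (hc : HasConstantCurvature g c)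
    (hW : IsOpen W) (hΨ : ContMDiffOn 𝓘(ℝ, ℝ × ℂ) 𝓘(ℝ, ℂ) ∞ Ψ W)
    (hpos : ∀ q ∈ W, 0 < pullbackArea g Ψ q (0, 1) (0, Complex.I))
    {q : ℝ × ℂ} (hq : q ∈ W) (X Y : ℝ × ℂ) :
    fderiv ℝ (fun q => angleForm g Ψ q Y) q X - fderiv ℝ (fun q => angleForm g Ψ q X) q Y =
      -c * pullbackArea g Ψ q X Y := by
  set e := chartAt ℂ (Ψ q) with he'
  have he : e ∈ atlas ℂ S := chart_mem_atlas ℂ _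
  have hqV : q ∈ W ∩ Ψ ⁻¹' e.source := ⟨hq, mem_chart_source ℂ _⟩
  have hV := isOpen_inter_preimage_chart hW hΨ e
  have hu := contDiffOn_chart_comp hΨ he
  rw [(angleForm_eventuallyEq hg hW hΨ he hpos hqV Y).fderiv_eq,
    (angleForm_eventuallyEq hg hW hΨ he hpos hqV X).fderiv_eq,
    pullbackArea_eq hg hW hΨ he hqV, ← curvature_connectionCoeff hg hc he (e.map_source hqV.2)]
  have h0 := dzPart_ne_zero hg hW hΨ he hqV (hpos q hq)
  set u : ℝ × ℂ → ℂ := fun q => e (Ψ q) with hu'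
  have ha := contDiffOn_dzPart hV hu
  set a := dzPart u with ha'
  have hda : HasFDerivAt a (fderiv ℝ a q) q :=
    ((ha.contDiffAt (hV.mem_nhds hqV)).differentiableAt (by simp)).hasFDerivAt
  have hdu : HasFDerivAt u (fderiv ℝ u q) q :=
    ((hu.contDiffAt (hV.mem_nhds hqV)).differentiableAt (by simp)).hasFDerivAt
  have hΓ : HasFDerivAt (connectionCoeff g e) (fderiv ℝ (connectionCoeff g e) (u q)) (u q) :=
    (((contDiffOn_connectionCoeff hg he).contDiffAt (e.open_target.mem_nhds
      (e.map_source hqV.2))).differentiableAt (by simp)).hasFDerivAt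
  have key : ∀ X Y, fderiv ℝ (fun q => angleIn g e Ψ q Y) q X =
      (fderiv ℝ (fderiv ℝ a) q X Y / a q - fderiv ℝ a q Y * fderiv ℝ a q X / a q ^ 2 +
        (fderiv ℝ (connectionCoeff g e) (u q) (fderiv ℝ u q X) * fderiv ℝ u q Y +
          connectionCoeff g e (u q) * fderiv ℝ (fderiv ℝ u) q X Y)).im := by
    intro X Y
    have h1 := hasFDerivAt_fderiv_apply hV ha hqV Y
    have h2 := hasFDerivAt_fderiv_apply hV hu hqV Y
    have hinv : HasFDerivAt (fun q => (a q)⁻¹) _ q :=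
      ((hasDerivAt_inv h0).hasFDerivAt.restrictScalars ℝ).comp q hda
    have h3 : HasFDerivAt (fun q => angleIn g e Ψ q Y) _ q :=
      Complex.imCLM.hasFDerivAt.comp q ((h1.mul hinv).add ((hΓ.comp q hdu).mul h2))
    rw [h3.fderiv]
    simp only [ContinuousLinearMap.comp_apply, add_apply, smul_apply, smul_eq_mul,
      ContinuousLinearMap.flip_apply, Complex.imCLM_apply, Function.comp,
      ContinuousLinearMap.coe_restrictScalars', ContinuousLinearMap.toSpanSingleton_apply]
    congr 1
    field_simp
    ring
  -- The logarithmic derivative is a closed form and the Hessian of u is symmetric, so only the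
  -- antisymmetrised derivative of the connection coefficient survives.
  rw [key, key, fderiv_fderiv_comm hV hu hqV Y X, fderiv_fderiv_comm hV ha hqV Y X,
    ← Complex.sub_im]
  congr 1
  ring

end Angle

/-! ### The time component of the connection form as a function on the surface -/

section PhaseRate

variable {g : Metric S} {T : EReal} {f_ : ℝ → S → S} {e e₁ e₂ : OpenPartialHomeomorph S ℂ}

theorem mfderiv_flowInChart_inr
    (hs : ∀ t ∈ timeInterval T, IsSymplectomorphism g (f_ t))
    (hf : ContMDiffOn (𝓘(ℝ, ℝ).prod 𝓘(ℝ, ℂ)) 𝓘(ℝ, ℂ) ∞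
      (fun q : ℝ × S => f_ q.1 q.2) (timeInterval T ×ˢ univ)) (he : e ∈ atlas ℂ S)
    {q : ℝ × ℂ} (hq : q ∈ sqrtDomain T ×ˢ e.target) (w : ℂ) :
    mfderiv 𝓘(ℝ, ℝ × ℂ) 𝓘(ℝ, ℂ) (flowInChart f_ e) q (0, w) =
      mfderiv 𝓘(ℝ, ℂ) 𝓘(ℝ, ℂ) (f_ (q.1 ^ 2)) (e.symm q.2)
        (mfderiv 𝓘(ℝ, ℂ) 𝓘(ℝ, ℂ) e.symm q.2 w) := by
  rw [← mfderiv_symplectic_comp_chart_symm (hs _ (sq_mem_timeInterval hq.1)) he hq.2]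
  exact (mfderiv_comp_of_hasFDerivAt (Ψ := flowInChart f_ e)
    (mdifferentiableAt_of_contMDiffOn ((isOpen_sqrtDomain T).prod e.open_target)
      (contMDiffOn_flowInChart hf he) hq) (hasFDerivAt_prodMk_right q.1 q.2) w).symm

theorem pullbackArea_flowInChart_pos (hg : IsConformal g)
    (hs : ∀ t ∈ timeInterval T, IsSymplectomorphism g (f_ t))
    (hf : ContMDiffOn (𝓘(ℝ, ℝ).prod 𝓘(ℝ, ℂ)) 𝓘(ℝ, ℂ) ∞
      (fun q : ℝ × S => f_ q.1 q.2) (timeInterval T ×ˢ univ)) (he : e ∈ atlas ℂ S)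
    {q : ℝ × ℂ} (hq : q ∈ sqrtDomain T ×ˢ e.target) :
    0 < pullbackArea g (flowInChart f_ e) q (0, 1) (0, Complex.I) := by
  have h : pullbackArea g (flowInChart f_ e) q (0, 1) (0, Complex.I) =
      areaForm g (e.symm q.2) (mfderiv 𝓘(ℝ, ℂ) 𝓘(ℝ, ℂ) e.symm q.2 (1 : ℂ))
        (mfderiv 𝓘(ℝ, ℂ) 𝓘(ℝ, ℂ) e.symm q.2 Complex.I) := by
    unfold pullbackArea
    rw [mfderiv_flowInChart_inr hs hf he hq, mfderiv_flowInChart_inr hs hf he hq]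
    exact (hs _ (sq_mem_timeInterval hq.1)).2 _ _ _
  rw [h, areaForm_chart_symm hg he hq.2]
  simpa using density_pos hg he hq.2

/-- Precomposition with multiplication by k multiplies the complex linear part by k. -/
theorem real_clm_prod_apply_eq (L : ℝ × ℂ →L[ℝ] ℂ) (k : ℂ) :
    (L (0, k) - Complex.I * L (0, k * Complex.I)) / 2 =
      k * ((L (0, 1) - Complex.I * L (0, Complex.I)) / 2) := by
  have h : ∀ v : ℂ, L (0, v) = v.re * L (0, 1) + v.im * L (0, Complex.I) := fun v => by
    have := real_clm_apply_eq (L.comp (ContinuousLinearMap.inr ℝ ℝ ℂ)) v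
    simpa using this
  rw [h k, h (k * Complex.I)]
  have hk := Complex.re_add_im k
  simp only [Complex.mul_re, Complex.mul_im, Complex.I_re, Complex.I_im, mul_zero, mul_one,
    zero_sub, add_zero, Complex.ofReal_neg]
  linear_combination (L (0, 1) / 2 - Complex.I * L (0, Complex.I) / 2) * hk +
    ((k.im : ℂ) * L (0, Complex.I) / 2) * Complex.I_sq

/-- A holomorphic change κ of source chart multiplies ∂u by κ'(z), which does not depend on time and
so drops out of the logarithmic time derivative. This makes `phaseRate` independent of the source
chart. -/
theorem angleForm_flowInChart_eq (hg : IsConformal g)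
    (hf : ContMDiffOn (𝓘(ℝ, ℝ).prod 𝓘(ℝ, ℂ)) 𝓘(ℝ, ℂ) ∞
      (fun q : ℝ × S => f_ q.1 q.2) (timeInterval T ×ˢ univ))
    (h₁ : e₁ ∈ atlas ℂ S) (h₂ : e₂ ∈ atlas ℂ S) {τ : ℝ} (hτ : τ ∈ sqrtDomain T)
    {z : ℂ} (hz : z ∈ e₂.target ∩ e₂.symm ⁻¹' e₁.source) :
    angleForm g (flowInChart f_ e₂) (τ, z) (1, 0) =
      angleForm g (flowInChart f_ e₁) (τ, e₁ (e₂.symm z)) (1, 0) := by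
  set κ : ℂ → ℂ := fun w => e₁ (e₂.symm w) with hκ
  have hN := isOpen_transition e₂ e₁
  have hκd : DifferentiableOn ℂ κ (e₂.target ∩ e₂.symm ⁻¹' e₁.source) :=
    differentiableOn_transition h₂ h₁
  have hWo₁ : IsOpen (sqrtDomain T ×ˢ e₁.target) := (isOpen_sqrtDomain T).prod e₁.open_target
  have hΨ₁ := contMDiffOn_flowInChart hf h₁
  have hcomp : ∀ q : ℝ × ℂ, q.2 ∈ e₂.target ∩ e₂.symm ⁻¹' e₁.source →
      flowInChart f_ e₂ q = flowInChart f_ e₁ (q.1, κ q.2) := fun q hq => by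
    simp only [flowInChart, hκ, e₁.left_inv hq.2]
  unfold angleForm
  rw [hcomp (τ, z) hz]
  set e := chartAt ℂ (flowInChart f_ e₁ (τ, κ z)) with he'
  have he : e ∈ atlas ℂ S := chart_mem_atlas ℂ _
  set V := (sqrtDomain T ×ˢ e₁.target) ∩ flowInChart f_ e₁ ⁻¹' e.source with hVdef
  have hV : IsOpen V := isOpen_inter_preimage_chart hWo₁ hΨ₁ e
  set u : ℝ × ℂ → ℂ := fun q => e (flowInChart f_ e₁ q) with hu'
  have hu : ContDiffOn ℝ ∞ u V := contDiffOn_chart_comp hΨ₁ he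
  have hp : (τ, κ z) ∈ V := ⟨⟨hτ, e₁.map_source hz.2⟩, mem_chart_source ℂ _⟩
  set u₂ : ℝ × ℂ → ℂ := fun q => e (flowInChart f_ e₂ q) with hu₂
  have hD : ∀ q : ℝ × ℂ, q.2 ∈ e₂.target ∩ e₂.symm ⁻¹' e₁.source → (q.1, κ q.2) ∈ V →
      ∀ X : ℝ × ℂ, fderiv ℝ u₂ q X = fderiv ℝ u (q.1, κ q.2) (X.1, deriv κ q.2 * X.2) := by
    intro q hq hqV X
    have h1 := fderiv_real_eq_deriv_mul (hκd.differentiableAt (hN.mem_nhds hq))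
    have h2 : HasFDerivAt u (fderiv ℝ u (q.1, κ q.2)) (q.1, κ q.2) :=
      ((hu.contDiffAt (hV.mem_nhds hqV)).differentiableAt (by simp)).hasFDerivAt
    have h3 : HasFDerivAt (fun q : ℝ × ℂ => (q.1, κ q.2)) _ q :=
      hasFDerivAt_fst.prodMk (h1.comp q hasFDerivAt_snd)
    have h4 : u₂ =ᶠ[𝓝 q] u ∘ fun q : ℝ × ℂ => (q.1, κ q.2) := by
      filter_upwards [(hN.preimage continuous_snd).mem_nhds hq] with q' hq'
      simp only [hu₂, hu', Function.comp, hcomp q' hq']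
    rw [((h2.comp q h3).congr_of_eventuallyEq h4).fderiv]
    simp [mul_comm]
  have hdz : ∀ q : ℝ × ℂ, q.2 ∈ e₂.target ∩ e₂.symm ⁻¹' e₁.source → (q.1, κ q.2) ∈ V →
      dzPart u₂ q = deriv κ q.2 * dzPart u (q.1, κ q.2) := by
    intro q hq hqV
    unfold dzPart
    rw [hD q hq hqV, hD q hq hqV, mul_one]
    exact real_clm_prod_apply_eq _ _
  have hκ0 : deriv κ z ≠ 0 := deriv_transition_ne_zero hg h₂ h₁ hz
  have hda : fderiv ℝ (dzPart u₂) (τ, z) (1, 0) =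
      deriv κ z * fderiv ℝ (dzPart u) (τ, κ z) (1, 0) := by
    have hWo₂ : IsOpen (sqrtDomain T ×ˢ e₂.target) := (isOpen_sqrtDomain T).prod e₂.open_target
    have hΨ₂ := contMDiffOn_flowInChart hf h₂
    have hV₂ := isOpen_inter_preimage_chart hWo₂ hΨ₂ e
    have hp₂ : (τ, z) ∈ (sqrtDomain T ×ˢ e₂.target) ∩ flowInChart f_ e₂ ⁻¹' e.source := by
      refine ⟨⟨hτ, hz.1⟩, ?_⟩
      rw [mem_preimage, hcomp (τ, z) hz]
      exact hp.2
    have h1 : HasFDerivAt (dzPart u) _ (τ, κ z) :=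
      (((contDiffOn_dzPart hV hu).contDiffAt (hV.mem_nhds hp)).differentiableAt
        (by simp)).hasFDerivAt
    have h2 : HasFDerivAt (dzPart u₂) _ (τ, z) :=
      (((contDiffOn_dzPart hV₂ (contDiffOn_chart_comp hΨ₂ he)).contDiffAt
        (hV₂.mem_nhds hp₂)).differentiableAt (by simp)).hasFDerivAt
    have h3 := h2.comp τ (hasFDerivAt_prodMk_const_left τ z)
    have h4 := (h1.comp τ (hasFDerivAt_prodMk_const_left τ (κ z))).const_mul (deriv κ z)
    have h5 : (dzPart u₂ ∘ fun s : ℝ => (s, z)) =ᶠ[𝓝 τ]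
        fun s => deriv κ z * (dzPart u ∘ fun s : ℝ => (s, κ z)) s := by
      have : ∀ᶠ s in 𝓝 τ, (s, κ z) ∈ V :=
        (Continuous.tendsto (f := fun s : ℝ => (s, κ z)) (by fun_prop) τ).eventually
          (hV.mem_nhds hp)
      filter_upwards [this] with s hsV
      exact hdz (s, z) hz hsV
    have h6 := DFunLike.congr_fun (h3.unique (h4.congr_of_eventuallyEq h5)) (1 : ℝ)
    simpa using h6
  unfold angleIn
  rw [hda, hdz (τ, z) hz hp, hD (τ, z) hz hp, hcomp (τ, z) hz, mul_div_mul_left _ _ hκ0, mul_zero]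

/-- The rate of change of the phase of `∂f_t` along a flow, as a function on the surface. -/
def phaseRate (g : Metric S) (f_ : ℝ → S → S) (τ : ℝ) (x : S) : ℝ :=
  angleForm g (flowInChart f_ (chartAt ℂ x)) (τ, chartAt ℂ x x) (1, 0)

theorem phaseRate_chart_symm (hg : IsConformal g)
    (hf : ContMDiffOn (𝓘(ℝ, ℝ).prod 𝓘(ℝ, ℂ)) 𝓘(ℝ, ℂ) ∞
      (fun q : ℝ × S => f_ q.1 q.2) (timeInterval T ×ˢ univ))
    (he : e ∈ atlas ℂ S) {τ : ℝ} (hτ : τ ∈ sqrtDomain T) {z : ℂ} (hz : z ∈ e.target) :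
    phaseRate g f_ τ (e.symm z) = angleForm g (flowInChart f_ e) (τ, z) (1, 0) :=
  (angleForm_flowInChart_eq hg hf (chart_mem_atlas ℂ _) he hτ
    ⟨hz, mem_chart_source ℂ (e.symm z)⟩).symm

end PhaseRate

/-! ### Linear algebra of the mean curvature of a symplectic graph -/

/-- The real basis `1, i` of `ℂ`. -/
def unitFrame : Fin 2 → ℂ := ![1, Complex.I]

/-- The trace of a bilinear form with respect to another one is invariant under linear
isomorphisms. -/
theorem trace_comp_linear (Q b : ℂ →ₗ[ℝ] ℂ →ₗ[ℝ] ℝ) (L : ℂ →ₗ[ℝ] ℂ) (hL : Function.Injective L) :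
    ∑ i, ∑ j, (Matrix.of fun i j => Q (L (unitFrame i)) (L (unitFrame j)))⁻¹ i j *
        b (L (unitFrame i)) (L (unitFrame j)) =
      ∑ i, ∑ j, (Matrix.of fun i j => Q (unitFrame i) (unitFrame j))⁻¹ i j *
        b (unitFrame i) (unitFrame j) := by
  let M : Matrix (Fin 2) (Fin 2) ℝ := Matrix.of fun k j =>
    ![(L (unitFrame j)).re, (L (unitFrame j)).im] k
  have hLM : ∀ i, L (unitFrame i) = ∑ k, M k i • unitFrame k := fun i => by
    simp [M, Fin.sum_univ_two, unitFrame, Complex.re_add_im]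
  have hpull : ∀ B : ℂ →ₗ[ℝ] ℂ →ₗ[ℝ] ℝ,
      (Matrix.of fun i j => B (L (unitFrame i)) (L (unitFrame j))) =
        M.transpose * (Matrix.of fun i j => B (unitFrame i) (unitFrame j)) * M := by
    intro B
    ext i j
    rw [Matrix.of_apply, hLM i, hLM j]
    simp only [Fin.sum_univ_two, map_add, map_smul, LinearMap.add_apply, LinearMap.smul_apply,
      Matrix.mul_apply, Matrix.transpose_apply, Matrix.of_apply, smul_eq_mul]
    ring
  have htr : ∀ X Y : Matrix (Fin 2) (Fin 2) ℝ,
      ∑ i, ∑ j, X i j * Y i j = (X * Y.transpose).trace := fun X Y => by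
    simp [Matrix.trace, Matrix.mul_apply]
  have hdet : IsUnit M.det := by
    rw [isUnit_iff_ne_zero]
    intro h
    obtain ⟨v, hv0, hv⟩ := Matrix.exists_mulVec_eq_zero_iff.2 h
    apply hv0
    have h1 : L (∑ i, v i • unitFrame i) = 0 := by
      have h2 : ∀ k, ∑ i, M k i * v i = 0 := fun k => congrFun hv k
      have h3 := h2 0
      have h4 := h2 1
      simp only [Fin.sum_univ_two] at h3 h4
      simp only [Fin.sum_univ_two, map_add, map_smul]
      rw [hLM 0, hLM 1]
      simp only [Fin.sum_univ_two]
      have h5 : v 0 • (M 0 0 • unitFrame 0 + M 1 0 • unitFrame 1) +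
          v 1 • (M 0 1 • unitFrame 0 + M 1 1 • unitFrame 1) =
          (M 0 0 * v 0 + M 0 1 * v 1) • unitFrame 0 +
            (M 1 0 * v 0 + M 1 1 * v 1) • unitFrame 1 := by
        module
      rw [h5, h3, h4]
      simp
    have h6 := hL (h1.trans (map_zero L).symm)
    simp only [Fin.sum_univ_two, unitFrame, Matrix.cons_val_zero, Matrix.cons_val_one] at h6
    have h7 := congrArg Complex.re h6
    have h8 := congrArg Complex.im h6
    simp at h7 h8
    ext i
    fin_cases i <;> simp [h7, h8]
  have h1 := htr (Matrix.of fun i j => Q (L (unitFrame i)) (L (unitFrame j)))⁻¹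
    (Matrix.of fun i j => b (L (unitFrame i)) (L (unitFrame j)))
  have h2 := htr (Matrix.of fun i j => Q (unitFrame i) (unitFrame j))⁻¹
    (Matrix.of fun i j => b (unitFrame i) (unitFrame j))
  simp only [Matrix.of_apply] at h1 h2
  rw [h1, h2, hpull Q, hpull b]
  set N := (Matrix.of fun i j => Q (unitFrame i) (unitFrame j))
  set B := (Matrix.of fun i j => b (unitFrame i) (unitFrame j))
  have hdet' : IsUnit M.transpose.det := by rwa [Matrix.det_transpose]
  rw [Matrix.mul_inv_rev, Matrix.mul_inv_rev, Matrix.transpose_mul, Matrix.transpose_mul,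
    Matrix.transpose_transpose]
  -- Both Gram matrices change by the congruence MᵀNM, so N⁻¹Bᵀ changes by conjugation with M and
  -- its trace is unchanged.
  have h3 : M⁻¹ * (N⁻¹ * M.transpose⁻¹) * (M.transpose * (B.transpose * M)) =
      M⁻¹ * (N⁻¹ * B.transpose) * M := by
    calc _ = M⁻¹ * (N⁻¹ * (M.transpose⁻¹ * M.transpose) * B.transpose) * M := by
          simp only [Matrix.mul_assoc]
      _ = _ := by rw [Matrix.nonsing_inv_mul _ hdet', Matrix.mul_one]
  rw [h3, Matrix.trace_mul_comm, ← Matrix.mul_assoc, Matrix.mul_nonsing_inv _ hdet, Matrix.one_mul]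

/-- The trace of the second fundamental form of a symplectic graph, in terms of the complex
coefficients `a, b` of the differential and `A, B, C` of its covariant derivative. -/
theorem trace_symplectic_graph {a b A B C w : ℂ} {ρ ρ' : ℝ} (hρ : 0 < ρ) (hρ' : 0 < ρ')
    (hN : ρ' * (Complex.normSq a - Complex.normSq b) = ρ)
    (hS : conj a * A + a * conj B - conj b * B - b * conj C = 0) (D : ℂ → ℂ)
    (hD : ∀ u, D u = a * u + b * conj u) (E : ℂ → ℂ → ℂ)
    (hE : ∀ u v, E u v = A * u * v + B * (u * conj v + conj u * v) + C * conj u * conj v) :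
    ∑ i, ∑ j, (Matrix.of fun i j : Fin 2 => ρ * (conj (unitFrame i) * unitFrame j).re +
        ρ' * (conj (D (unitFrame i)) * D (unitFrame j)).re)⁻¹ i j *
        (-(ρ' * (conj (E (unitFrame i) (unitFrame j)) * D w).im)) =
      ((A * w + B * conj w) / a).im := by
  have hNpos : 0 < Complex.normSq a - Complex.normSq b := by
    by_contra h
    push Not at h
    nlinarith
  have ha2 : 0 < Complex.normSq a := by
    have := Complex.normSq_nonneg b
    linarith
  have ha0 : a ≠ 0 := Complex.normSq_pos.1 ha2
  set N := Complex.normSq a - Complex.normSq b with hNdef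
  have hNc : (N : ℂ) = a * conj a - b * conj b := by
    rw [hNdef, Complex.mul_conj, Complex.mul_conj]; push_cast; ring
  -- The Jacobian identity `hN` eliminates ρ, leaving an induced metric that depends only on ρ', a
  -- and b, with determinant 4ρ'²|a|²(|a|² − |b|²).
  have hM : (Matrix.of fun i j : Fin 2 => ρ * (conj (unitFrame i) * unitFrame j).re +
        ρ' * (conj (D (unitFrame i)) * D (unitFrame j)).re) =
      !![2 * ρ' * (Complex.normSq a + (a * conj b).re), -(2 * ρ' * (a * conj b).im);
        -(2 * ρ' * (a * conj b).im), 2 * ρ' * (Complex.normSq a - (a * conj b).re)] := by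
    ext i j
    rw [← hN]
    fin_cases i <;> fin_cases j <;> simp [unitFrame, hD, Complex.normSq_apply, hNdef] <;> ring
  have hdet : (!![2 * ρ' * (Complex.normSq a + (a * conj b).re), -(2 * ρ' * (a * conj b).im);
        -(2 * ρ' * (a * conj b).im), 2 * ρ' * (Complex.normSq a - (a * conj b).re)] :
        Matrix (Fin 2) (Fin 2) ℝ).det = 4 * ρ' ^ 2 * (Complex.normSq a * N) := by
    rw [Matrix.det_fin_two_of, hNdef]
    simp [Complex.normSq_apply]
    ring
  rw [hM, Matrix.inv_def, hdet, Matrix.adjugate_fin_two_of, Ring.inverse_eq_inv']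
  have hSc : a * conj A + conj a * B - b * conj B - conj b * C = 0 := by
    have := congrArg conj hS
    simpa using this
  -- Contracting `E` with the adjugate of the induced metric gives 4ρ'X. The derivative `hS` of the
  -- Jacobian identity and its conjugate then eliminate C from the pairing of X with `D w`, and the
  -- factor N cancels against the determinant.
  set X : ℂ := 2 * (a * conj a) * B - conj a * b * A - a * conj b * C with hX
  have hk : conj X * a - X * conj b = N * (a * conj B - conj a * A) := by
    have hXc : conj X = 2 * (a * conj a) * conj B - a * conj b * conj A - conj a * b * conj C := by
      simp only [hX, map_sub, map_mul, Complex.conj_conj, Complex.conj_ofNat]; ring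
    rw [hXc, hX, hNc]
    linear_combination (a * conj a) * hS - (a * conj b) * hSc
  have hIm : -(conj X * D w).im = N * (conj a * (A * w + B * conj w)).im := by
    have h1 : (conj X * D w).im = ((conj X * a - X * conj b) * w).im := by
      rw [hD]; simp; ring
    rw [h1, hk]
    simp
    ring
  have hdiv : ((A * w + B * conj w) / a).im = (conj a * (A * w + B * conj w)).im /
      Complex.normSq a := by
    rw [eq_div_iff ha2.ne', ← Complex.im_mul_ofReal, ← Complex.mul_conj]
    congr 1
    field_simp
  have hsum : ∀ k : ℝ, ∑ i, ∑ j, (k • !![2 * ρ' * (Complex.normSq a - (a * conj b).re),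
        - -(2 * ρ' * (a * conj b).im);
        - -(2 * ρ' * (a * conj b).im), 2 * ρ' * (Complex.normSq a + (a * conj b).re)]) i j *
        (-(ρ' * (conj (E (unitFrame i) (unitFrame j)) * D w).im)) =
      k * (4 * ρ' ^ 2) * -(conj X * D w).im := by
    intro k
    simp only [Fin.sum_univ_two, hE, unitFrame, hX]
    generalize D w = d
    simp [Complex.normSq_apply]
    ring
  rw [hsum, hIm, hdiv]
  field_simp

/-! ### Maps of the surface in the preferred charts -/

/-- A map `h : S → S` in the preferred charts at `x` and `h x`. -/
def inCharts (h : S → S) (x : S) (w : ℂ) : ℂ := chartAt ℂ (h x) (h ((chartAt ℂ x).symm w))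

theorem contDiffAt_inCharts {h : S → S} {x : S}
    (hh : ContMDiffAt 𝓘(ℝ, ℂ) 𝓘(ℝ, ℂ) ∞ h x) :
    ContDiffAt ℝ ∞ (inCharts h x) (chartAt ℂ x x) := by
  have h1 := (contMDiffAt_iff.1 hh).2
  simp only [modelWithCornersSelf_coe, range_id, contDiffWithinAt_univ] at h1
  exact h1

theorem mfderiv_eq_fderiv_inCharts {h : S → S} {x : S}
    (hh : MDifferentiableAt 𝓘(ℝ, ℂ) 𝓘(ℝ, ℂ) h x) :
    (show ℂ →L[ℝ] ℂ from mfderiv 𝓘(ℝ, ℂ) 𝓘(ℝ, ℂ) h x) =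
      fderiv ℝ (inCharts h x) (chartAt ℂ x x) := by
  have h1 := hh.mfderiv
  simp only [modelWithCornersSelf_coe, range_id, fderivWithin_univ] at h1
  exact h1

theorem secondDeriv_eq (g : Metric S) {h : S → S} {x : S}
    (hh : MDifferentiableAt 𝓘(ℝ, ℂ) 𝓘(ℝ, ℂ) h x) (u v : ℂ) :
    secondDeriv g h x u v = (fderiv ℝ (fderiv ℝ (inCharts h x)) (chartAt ℂ x x) u v +
      connectionCoeff g (chartAt ℂ (h x)) (chartAt ℂ (h x) (h x)) *
        fderiv ℝ (inCharts h x) (chartAt ℂ x x) u *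
        fderiv ℝ (inCharts h x) (chartAt ℂ x x) v : ℂ) := by
  rw [← mfderiv_eq_fderiv_inCharts hh]
  rfl

theorem fderiv_fderiv_comp {u h : ℂ → ℂ} {z : ℂ} (hh : ContDiffAt ℝ ∞ h z)
    (hu : ContDiffAt ℝ ∞ u (h z)) (v w : ℂ) :
    fderiv ℝ (fderiv ℝ (u ∘ h)) z v w =
      fderiv ℝ (fderiv ℝ u) (h z) (fderiv ℝ h z v) (fderiv ℝ h z w) +
        fderiv ℝ u (h z) (fderiv ℝ (fderiv ℝ h) z v w) := by
  have hud : HasFDerivAt (fderiv ℝ u) (fderiv ℝ (fderiv ℝ u) (h z)) (h z) :=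
    ((hu.fderiv_right (m := ∞) (by simp)).differentiableAt (by simp)).hasFDerivAt
  have hhd : HasFDerivAt (fderiv ℝ h) (fderiv ℝ (fderiv ℝ h) z) z :=
    ((hh.fderiv_right (m := ∞) (by simp)).differentiableAt (by simp)).hasFDerivAt
  have hh1 : HasFDerivAt h (fderiv ℝ h z) z := (hh.differentiableAt (by simp)).hasFDerivAt
  have heq : fderiv ℝ (u ∘ h) =ᶠ[𝓝 z] fun z => (fderiv ℝ u (h z)).comp (fderiv ℝ h z) := by
    have h1 : ∀ᶠ z' in 𝓝 z, DifferentiableAt ℝ h z' := by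
      filter_upwards [(hh.of_le (m := 1) (by simp)).eventually (by simp)] with z' hz'
      exact hz'.differentiableAt (by simp)
    have h2 : ∀ᶠ z' in 𝓝 z, DifferentiableAt ℝ u (h z') := by
      filter_upwards [hh.continuousAt.eventually
        ((hu.of_le (m := 1) (by simp)).eventually (by simp))] with z' hz'
      exact hz'.differentiableAt (by simp)
    filter_upwards [h1, h2] with z' h1 h2
    exact fderiv_comp z' h2 h1
  rw [(((hud.comp z hh1).clm_comp hhd).congr_of_eventuallyEq heq).fderiv]
  simp
  ring

theorem inCharts_comp {f h : S → S} {x : S} (hh : ContinuousAt h x) :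
    inCharts (fun y => f (h y)) x =ᶠ[𝓝 (chartAt ℂ x x)] inCharts f (h x) ∘ inCharts h x := by
  have h1 : ContinuousAt (fun w => h ((chartAt ℂ x).symm w)) (chartAt ℂ x x) := by
    have h2 : ContinuousAt (chartAt ℂ x).symm (chartAt ℂ x x) :=
      (chartAt ℂ x).continuousAt_symm (mem_chart_target ℂ x)
    refine ContinuousAt.comp (g := h) ?_ h2
    rwa [(chartAt ℂ x).left_inv (mem_chart_source ℂ x)]
  have h3 : ∀ᶠ w in 𝓝 (chartAt ℂ x x), h ((chartAt ℂ x).symm w) ∈ (chartAt ℂ (h x)).source := by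
    refine h1.eventually (IsOpen.mem_nhds (chartAt ℂ (h x)).open_source ?_)
    change h ((chartAt ℂ x).symm (chartAt ℂ x x)) ∈ _
    rw [(chartAt ℂ x).left_inv (mem_chart_source ℂ x)]
    exact mem_chart_source ℂ (h x)
  filter_upwards [h3] with w hw
  simp only [inCharts, Function.comp, (chartAt ℂ (h x)).left_inv hw]

theorem inCharts_center (h : S → S) (x : S) :
    inCharts h x (chartAt ℂ x x) = chartAt ℂ (h x) (h x) := by
  simp only [inCharts, (chartAt ℂ x).left_inv (mem_chart_source ℂ x)]

/-! ### The mean curvature form -/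

theorem prodForm_eq {g : Metric S} (hg : IsConformal g) (p : S × S) (u v : ℂ × ℂ) :
    prodForm g p u v = conformalFactor g p.1 * (conj u.1 * v.1).im -
      conformalFactor g p.2 * (conj u.2 * v.2).im := by
  unfold prodForm
  congr 1
  · exact areaForm_eq hg _ _ _
  · exact areaForm_eq hg _ _ _

theorem prodMetric_eq {g : Metric S} (hg : IsConformal g) (p : S × S) (u v : ℂ × ℂ) :
    prodMetric g p u v = conformalFactor g p.1 * (conj u.1 * v.1).re +
      conformalFactor g p.2 * (conj u.2 * v.2).re := by
  unfold prodMetric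
  congr 1
  · exact inner_eq hg _ _ _
  · exact inner_eq hg _ _ _

/-- `prodForm` as a linear form in its first argument. -/
def prodFormLeft (g : Metric S) (hg : IsConformal g) (p : S × S) (v : TangentProd p) :
    TangentProd p →ₗ[ℝ] ℝ where
  toFun w := prodForm g p w v
  map_add' w w' := by
    have h : ∀ a b c : ℂ × ℂ, prodForm g p (a + b : ℂ × ℂ) c =
        prodForm g p a c + prodForm g p b c := fun a b c => by
      rw [prodForm_eq hg, prodForm_eq hg, prodForm_eq hg]
      simp
      ring
    exact h w w' v
  map_smul' r w := by
    have h : ∀ (r : ℝ) (a c : ℂ × ℂ), prodForm g p (r • a : ℂ × ℂ) c =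
        r * prodForm g p a c := fun r a c => by
      rw [prodForm_eq hg, prodForm_eq hg]
      simp
      ring
    exact h r w v

/-- On a Lagrangian tangent plane the symplectic form vanishes, so the tangential part removed by
the projection pairs to zero with tangent vectors. The projections in the mean curvature can
therefore be ignored. -/
theorem prodForm_normalPart {g : Metric S} (hg : IsConformal g) {F : S → S × S} {x : S}
    (hF : ∀ u v, prodForm g (F x) (pushforward F x u) (pushforward F x v) = 0)
    (w : TangentProd (F x)) (v : TangentSpace 𝓘(ℝ, ℂ) x) :
    prodForm g (F x) (normalPart g F x w) (pushforward F x v) =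
      prodForm g (F x) w (pushforward F x v) := by
  change prodFormLeft g hg (F x) (pushforward F x v) (normalPart g F x w) =
    prodFormLeft g hg (F x) (pushforward F x v) w
  have h : ∀ u, prodFormLeft g hg (F x) (pushforward F x v) (pushforward F x u) = 0 :=
    fun u => hF u v
  unfold normalPart
  simp [map_sub, map_smul, h]

theorem prodForm_meanCurvature {g : Metric S} (hg : IsConformal g) {F : S → S × S} {x : S}
    (hF : ∀ u v, prodForm g (F x) (pushforward F x u) (pushforward F x v) = 0)
    (v : TangentSpace 𝓘(ℝ, ℂ) x) :
    prodForm g (F x) (meanCurvature g F x) (pushforward F x v) =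
      ∑ i, ∑ j, (inducedMetric g F x)⁻¹ i j * prodForm g (F x)
        (secondDeriv g (fun y => (F y).1) x (frame x i) (frame x j),
          secondDeriv g (fun y => (F y).2) x (frame x i) (frame x j)) (pushforward F x v) := by
  change prodFormLeft g hg (F x) (pushforward F x v) (meanCurvature g F x) = _
  unfold meanCurvature
  simp only [map_sum, map_smul, smul_eq_mul]
  refine Finset.sum_congr rfl fun i _ => Finset.sum_congr rfl fun j _ => ?_
  congr 1
  exact prodForm_normalPart hg hF _ v

/-- The derivative `∂u/∂z` of a function of one complex variable. -/
def dzOf (u : ℂ → ℂ) (z : ℂ) : ℂ := (fderiv ℝ u z 1 - Complex.I * fderiv ℝ u z Complex.I) / 2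

/-- The form `Im (∇ (∂f) / ∂f)` of the section `∂f` of `Hom(TS, f^* TS)`. -/
def phaseForm (g : Metric S) (f : S → S) (x : S) (v : ℂ) : ℝ :=
  (fderiv ℝ (dzOf (inCharts f x)) (chartAt ℂ x x) v / dzOf (inCharts f x) (chartAt ℂ x x) +
    connectionCoeff g (chartAt ℂ (f x)) (chartAt ℂ (f x) (f x)) *
      fderiv ℝ (inCharts f x) (chartAt ℂ x x) v -
    connectionCoeff g (chartAt ℂ x) (chartAt ℂ x x) * v).im

/-! ### The Jacobian identity of a symplectomorphism and its derivative -/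

section Symplectic

variable {g : Metric S} {f : S → S}

theorem IsSymplectomorphism.contMDiff (hf : IsSymplectomorphism g f) :
    ContMDiff 𝓘(ℝ, ℂ) 𝓘(ℝ, ℂ) ∞ f := by
  obtain ⟨⟨Φ, rfl⟩, -⟩ := hf
  exact Φ.contMDiff

theorem IsSymplectomorphism.mdifferentiableAt (hf : IsSymplectomorphism g f) (x : S) :
    MDifferentiableAt 𝓘(ℝ, ℂ) 𝓘(ℝ, ℂ) f x :=
  hf.contMDiff.mdifferentiableAt (by simp)

theorem IsSymplectomorphism.conformalFactor_mul (hf : IsSymplectomorphism g f)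
    (hg : IsConformal g) (x : S) (u v : ℂ) :
    conformalFactor g (f x) * (conj (fderiv ℝ (inCharts f x) (chartAt ℂ x x) u) *
      fderiv ℝ (inCharts f x) (chartAt ℂ x x) v).im =
      conformalFactor g x * (conj u * v).im := by
  rw [← mfderiv_eq_fderiv_inCharts (hf.mdifferentiableAt x)]
  exact (areaForm_eq hg _ _ _).symm.trans ((hf.2 x u v).trans (areaForm_eq hg _ _ _))

theorem IsSymplectomorphism.density_mul (hf : IsSymplectomorphism g f)
    (hg : IsConformal g) (x : S) :
    ∀ᶠ w in 𝓝 (chartAt ℂ x x), density g (chartAt ℂ (f x)) (inCharts f x w) *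
      (conj (fderiv ℝ (inCharts f x) w 1) * fderiv ℝ (inCharts f x) w Complex.I).im =
        density g (chartAt ℂ x) w := by
  set e := chartAt ℂ x with he'
  have he : e ∈ atlas ℂ S := chart_mem_atlas ℂ x
  have hΨ : ContMDiffOn 𝓘(ℝ, ℂ) 𝓘(ℝ, ℂ) ∞ (fun w => f (e.symm w)) e.target :=
    hf.contMDiff.comp_contMDiffOn (contMDiffOn_chart_symm_real he)
  have hV := isOpen_inter_preimage_chart e.open_target hΨ (chartAt ℂ (f x))
  have hmem : e x ∈ e.target ∩ (fun w => f (e.symm w)) ⁻¹' (chartAt ℂ (f x)).source := by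
    refine ⟨mem_chart_target ℂ x, ?_⟩
    rw [mem_preimage, e.left_inv (mem_chart_source ℂ x)]
    exact mem_chart_source ℂ _
  filter_upwards [hV.mem_nhds hmem] with w hw
  have h1 := pullbackArea_eq hg e.open_target hΨ (chart_mem_atlas ℂ (f x)) hw 1 Complex.I
  refine h1.symm.trans ?_
  unfold pullbackArea
  rw [mfderiv_symplectic_comp_chart_symm hf he hw.1, mfderiv_symplectic_comp_chart_symm hf he hw.1]
  refine (hf.2 _ _ _).trans ((areaForm_chart_symm hg he hw.1 1 Complex.I).trans ?_)
  simp

/-- The covariant derivative of the Jacobian of a symplectomorphism vanishes. -/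
theorem IsSymplectomorphism.fderiv_jacobian (hf : IsSymplectomorphism g f)
    (hg : IsConformal g) (x : S) (v : ℂ) :
    (conj (fderiv ℝ (fderiv ℝ (inCharts f x)) (chartAt ℂ x x) v 1) *
        fderiv ℝ (inCharts f x) (chartAt ℂ x x) Complex.I).im +
      (conj (fderiv ℝ (inCharts f x) (chartAt ℂ x x) 1) *
        fderiv ℝ (fderiv ℝ (inCharts f x)) (chartAt ℂ x x) v Complex.I).im +
      (conj (fderiv ℝ (inCharts f x) (chartAt ℂ x x) 1) *
        fderiv ℝ (inCharts f x) (chartAt ℂ x x) Complex.I).im *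
        (2 * (connectionCoeff g (chartAt ℂ (f x)) (chartAt ℂ (f x) (f x)) *
          fderiv ℝ (inCharts f x) (chartAt ℂ x x) v).re -
        2 * (connectionCoeff g (chartAt ℂ x) (chartAt ℂ x x) * v).re) = 0 := by
  set z := chartAt ℂ x x with hz
  set u := inCharts f x with hu'
  have huz : u z = chartAt ℂ (f x) (f x) := inCharts_center f x
  have hu : ContDiffAt ℝ ∞ u z := contDiffAt_inCharts (hf.contMDiff.contMDiffAt)
  have hzt : z ∈ (chartAt ℂ x).target := mem_chart_target ℂ x
  have huzt : u z ∈ (chartAt ℂ (f x)).target := by rw [huz]; exact mem_chart_target ℂ _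
  have hud : HasFDerivAt u (fderiv ℝ u z) z := (hu.differentiableAt (by simp)).hasFDerivAt
  have hudd : HasFDerivAt (fderiv ℝ u) (fderiv ℝ (fderiv ℝ u) z) z :=
    ((hu.fderiv_right (m := ∞) (by simp)).differentiableAt (by simp)).hasFDerivAt
  have hY : ∀ Y, HasFDerivAt (fun w => fderiv ℝ u w Y) ((fderiv ℝ (fderiv ℝ u) z).flip Y) z := by
    intro Y
    convert! hudd.clm_apply (hasFDerivAt_const Y z) using 1
    ext X
    simp
  have hlog : ∀ (e : OpenPartialHomeomorph S ℂ), e ∈ atlas ℂ S → ∀ w ∈ e.target,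
      HasFDerivAt (density g e) (fderiv ℝ (density g e) w) w ∧ ∀ v, fderiv ℝ (density g e) w v =
        density g e w * (2 * (connectionCoeff g e w * v).re) := by
    intro e he w hw
    have h1 : HasFDerivAt (density g e) (fderiv ℝ (density g e) w) w :=
      (((contDiffOn_density g he).contDiffAt (e.open_target.mem_nhds hw)).differentiableAt
        (by simp)).hasFDerivAt
    refine ⟨h1, fun v => ?_⟩
    have hpos := density_pos hg he hw
    have h2 := h1.log hpos.ne'
    have h3 := fderiv_eq_two_re_wirtinger (fun w => Real.log (density g e w)) w v
    rw [h2.fderiv] at h3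
    simp only [smul_apply, smul_eq_mul] at h3
    unfold connectionCoeff
    rw [← h3]
    field_simp
  obtain ⟨hρ', hρ'2⟩ := hlog _ (chart_mem_atlas ℂ (f x)) (u z) huzt
  obtain ⟨hρ, hρ2⟩ := hlog _ (chart_mem_atlas ℂ x) z hzt
  have hprod := (hρ'.comp z hud).mul
    (((Complex.reCLM.hasFDerivAt.comp z (hY 1)).mul
        (Complex.imCLM.hasFDerivAt.comp z (hY Complex.I))).sub
      ((Complex.imCLM.hasFDerivAt.comp z (hY 1)).mul
        (Complex.reCLM.hasFDerivAt.comp z (hY Complex.I))))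
  have hjac := hf.density_mul hg x
  -- This is ρ = (ρ' ∘ u) · Jac u near z. Differentiating it, the rule dρ(v) = 2ρ Re(Γv) turns
  -- derivatives of the densities into connection terms, and the positive factor ρ' ∘ u is divided
  -- out at the end.
  have heq : density g (chartAt ℂ x) =ᶠ[𝓝 z] fun w => density g (chartAt ℂ (f x)) (u w) *
      ((fderiv ℝ u w 1).re * (fderiv ℝ u w Complex.I).im -
        (fderiv ℝ u w 1).im * (fderiv ℝ u w Complex.I).re) := by
    filter_upwards [hjac] with w hw
    rw [← hw]
    congr 1
    simp
    ring
  have h1 := DFunLike.congr_fun (hρ.unique (hprod.congr_of_eventuallyEq heq)) v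
  have h2 := heq.eq_of_nhds
  simp only [add_apply, sub_apply, smul_apply, smul_eq_mul, ContinuousLinearMap.comp_apply,
    Function.comp, hρ2, hρ'2, ContinuousLinearMap.flip_apply, Complex.reCLM_apply,
    Complex.imCLM_apply, Pi.sub_apply, Pi.mul_apply] at h1
  have hpos := density_pos hg (chart_mem_atlas ℂ (f x)) huzt
  rw [h2] at h1
  rw [← huz]
  have him : ∀ p q : ℂ, (conj p * q).im = p.re * q.im - p.im * q.re := fun p q => by
    simp; ring
  simp only [him]
  have h3 : ∀ X : ℝ, density g (chartAt ℂ (f x)) (u z) * X = 0 → X = 0 := fun X hX =>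
    (mul_eq_zero.1 hX).resolve_left hpos.ne'
  apply h3
  linear_combination -h1

end Symplectic

theorem real_clm_eq_complex (D : ℂ →L[ℝ] ℂ) (v : ℂ) :
    D v = (D 1 - Complex.I * D Complex.I) / 2 * v +
      (D 1 + Complex.I * D Complex.I) / 2 * conj v := by
  rw [real_clm_apply_eq D v]
  have h1 := Complex.re_add_im v
  have h2 : conj v = v.re - v.im * Complex.I := by
    apply Complex.ext <;> simp
  rw [h2]
  simp only [Complex.real_smul]
  linear_combination (v.im : ℂ) * D Complex.I * Complex.I_sq +
    (D 1 - Complex.I * D Complex.I) / 2 * h1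

/-! ### The mean curvature form of a symplectic graph is the phase form -/

section Graph

variable {g : Metric S} {f ψ : S → S} {x : S}

theorem pushforward_graph_comp (hf : IsSymplectomorphism g f)
    (hψ : MDifferentiableAt 𝓘(ℝ, ℂ) 𝓘(ℝ, ℂ) ψ x) (v : ℂ) :
    pushforward (fun y => (ψ y, f (ψ y))) x v =
      ((show ℂ from mfderiv 𝓘(ℝ, ℂ) 𝓘(ℝ, ℂ) ψ x v),
        fderiv ℝ (inCharts f (ψ x)) (chartAt ℂ (ψ x) (ψ x))
          (mfderiv 𝓘(ℝ, ℂ) 𝓘(ℝ, ℂ) ψ x v)) := by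
  have h := HasMFDerivAt.comp x (hf.mdifferentiableAt (ψ x)).hasMFDerivAt hψ.hasMFDerivAt
  have h2 : mfderiv 𝓘(ℝ, ℂ) 𝓘(ℝ, ℂ) (fun y => f (ψ y)) x = _ := h.mfderiv
  rw [← mfderiv_eq_fderiv_inCharts (hf.mdifferentiableAt (ψ x))]
  unfold pushforward
  simp only
  rw [h2]
  rfl

theorem prodForm_pushforward_graph_comp (hf : IsSymplectomorphism g f) (hg : IsConformal g)
    (hψ : MDifferentiableAt 𝓘(ℝ, ℂ) 𝓘(ℝ, ℂ) ψ x) (u v : ℂ) :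
    prodForm g (ψ x, f (ψ x)) (pushforward (fun y => (ψ y, f (ψ y))) x u)
      (pushforward (fun y => (ψ y, f (ψ y))) x v) = 0 := by
  rw [pushforward_graph_comp hf hψ, pushforward_graph_comp hf hψ]
  refine (prodForm_eq hg _ _ _).trans ?_
  exact sub_eq_zero.2 (hf.conformalFactor_mul hg (ψ x) _ _).symm

/-- The mean curvature form of the graph of a symplectomorphism `f`, in any parametrization of the
graph. -/
theorem prodForm_meanCurvature_graph_comp (hf : IsSymplectomorphism g f) (hg : IsConformal g)
    (hψ : ContMDiffAt 𝓘(ℝ, ℂ) 𝓘(ℝ, ℂ) ∞ ψ x)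
    (hinj : Function.Injective (mfderiv 𝓘(ℝ, ℂ) 𝓘(ℝ, ℂ) ψ x)) (v : ℂ) :
    prodForm g (ψ x, f (ψ x)) (meanCurvature g (fun y => (ψ y, f (ψ y))) x)
      (pushforward (fun y => (ψ y, f (ψ y))) x v) =
      phaseForm g f (ψ x) (mfderiv 𝓘(ℝ, ℂ) 𝓘(ℝ, ℂ) ψ x v) := by
  have hψd : MDifferentiableAt 𝓘(ℝ, ℂ) 𝓘(ℝ, ℂ) ψ x := hψ.mdifferentiableAt (by simp)
  have hfψd : MDifferentiableAt 𝓘(ℝ, ℂ) 𝓘(ℝ, ℂ) (fun y => f (ψ y)) x :=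
    (hf.mdifferentiableAt (ψ x)).comp x hψd
  rw [show prodForm g (ψ x, f (ψ x)) (meanCurvature g (fun y => (ψ y, f (ψ y))) x)
      (pushforward (fun y => (ψ y, f (ψ y))) x v) = _ from
    prodForm_meanCurvature (F := fun y => (ψ y, f (ψ y))) hg
      (fun u v => prodForm_pushforward_graph_comp hf hg hψd u v) v]
  set p := ψ x with hp
  set u := inCharts f p with hu'
  set z := chartAt ℂ p p with hz
  set D := fderiv ℝ u z with hD'
  set H := fderiv ℝ (fderiv ℝ u) z with hH'
  set L : ℂ →L[ℝ] ℂ := mfderiv 𝓘(ℝ, ℂ) 𝓘(ℝ, ℂ) ψ x with hL'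
  have hLψ : L = fderiv ℝ (inCharts ψ x) (chartAt ℂ x x) := mfderiv_eq_fderiv_inCharts hψd
  set w : ℂ := L v with hw
  set Γ := connectionCoeff g (chartAt ℂ p) z with hΓ
  set Γ' := connectionCoeff g (chartAt ℂ (f p)) (chartAt ℂ (f p) (f p)) with hΓ'
  set ρ := conformalFactor g p with hρ
  set ρ' := conformalFactor g (f p) with hρ'
  have hu : ContDiffAt ℝ ∞ u z := contDiffAt_inCharts (hf.contMDiff.contMDiffAt)
  have hsym : ∀ a b, H a b = H b a := fun a b =>
    (hu.isSymmSndFDerivAt (by rw [minSmoothness_of_isRCLikeNormedField];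
                              exact ENat.LEInfty.out)).eq a b
  set a := (D 1 - Complex.I * D Complex.I) / 2 with ha
  set b := (D 1 + Complex.I * D Complex.I) / 2 with hb
  have hD : ∀ u, D u = a * u + b * conj u := real_clm_eq_complex D
  -- The coefficients of the Hessian of f in dz², dz dz̄ and dz̄².
  set A₀ := (H 1 1 - H Complex.I Complex.I - 2 * Complex.I * H 1 Complex.I) / 4 with hA₀
  set B₀ := (H 1 1 + H Complex.I Complex.I) / 4 with hB₀
  set C₀ := (H 1 1 - H Complex.I Complex.I + 2 * Complex.I * H 1 Complex.I) / 4 with hC₀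
  have hH : ∀ u v, H u v = A₀ * u * v + B₀ * (u * conj v + conj u * v) + C₀ * conj u * conj v := by
    intro u v
    have h1 : H u v = (H u 1 - Complex.I * H u Complex.I) / 2 * v +
      (H u 1 + Complex.I * H u Complex.I) / 2 * conj v := real_clm_eq_complex (H u) v
    have h2 : H u 1 = (H 1 1 - Complex.I * H Complex.I 1) / 2 * u +
      (H 1 1 + Complex.I * H Complex.I 1) / 2 * conj u := real_clm_eq_complex (H.flip 1) u
    have h3 : H u Complex.I = (H 1 Complex.I - Complex.I * H Complex.I Complex.I) / 2 * u +
      (H 1 Complex.I + Complex.I * H Complex.I Complex.I) / 2 * conj u :=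
      real_clm_eq_complex (H.flip Complex.I) u
    rw [h1, h2, h3, hsym Complex.I 1, hA₀, hB₀, hC₀]
    linear_combination ((H Complex.I Complex.I) / 4 * u * v -
      (H Complex.I Complex.I) / 4 * (u * conj v + conj u * v) +
      (H Complex.I Complex.I) / 4 * conj u * conj v) * Complex.I_sq
  have hρpos : 0 < ρ := conformalFactor_pos g p
  have hρ'pos : 0 < ρ' := conformalFactor_pos g (f p)
  have hND : Complex.normSq a - Complex.normSq b = (conj (D 1) * D Complex.I).im := by
    rw [hD 1, hD Complex.I]
    simp [Complex.normSq_apply]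
    ring
  have hN : ρ' * (Complex.normSq a - Complex.normSq b) = ρ := by
    have h := hf.conformalFactor_mul hg p 1 Complex.I
    rw [hND]
    simpa using h
  -- The corresponding coefficients of the covariant Hessian ∇df: Γ' is the connection of the
  -- target, Γ that of the source.
  set A := A₀ + Γ' * a ^ 2 - a * Γ with hA
  set B := B₀ + Γ' * a * b with hB
  set C := C₀ + Γ' * b ^ 2 - b * conj Γ with hC
  have hre : ∀ v, ((conj a * A + a * conj B - conj b * B - b * conj C) * v).re = 0 := by
    intro v
    have h := hf.fderiv_jacobian hg p v
    have h' : (conj (H v 1) * D Complex.I).im + (conj (D 1) * H v Complex.I).im +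
      (conj (D 1) * D Complex.I).im * (2 * (Γ' * D v).re - 2 * (Γ * v).re) = 0 := h
    rw [← hND, hH v 1, hH v Complex.I, hD Complex.I, hD 1, hD v] at h'
    have h2 : 2 * ((conj a * A + a * conj B - conj b * B - b * conj C) * v).re = 0 := by
      rw [← h', hA, hB, hC]
      simp [Complex.normSq_apply, pow_two]
      ring
    linarith
  have hS : conj a * A + a * conj B - conj b * B - b * conj C = 0 := by
    have h1 := hre 1
    have h2 := hre Complex.I
    rw [mul_one] at h1
    rw [Complex.mul_I_re, neg_eq_zero] at h2
    exact Complex.ext h1 h2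
  have ha0 : a ≠ 0 := by
    intro h0
    rw [h0, map_zero] at hN
    nlinarith [Complex.normSq_nonneg b]
  let E : ℂ → ℂ → ℂ := fun u v => A * u * v + B * (u * conj v + conj u * v) + C * conj u * conj v
  have htr := trace_symplectic_graph (w := w) hρpos hρ'pos hN hS D hD E fun u v => rfl
  let Q : ℂ →ₗ[ℝ] ℂ →ₗ[ℝ] ℝ := LinearMap.mk₂ ℝ
    (fun u v => ρ * (conj u * v).re + ρ' * (conj (D u) * D v).re)
    (fun a b c => by simp only [map_add, add_mul, Complex.add_re]; ring)
    (fun r b c => by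
      rw [map_smul D]; simp only [Complex.real_smul, map_mul, Complex.conj_ofReal,
      mul_assoc, Complex.re_ofReal_mul, smul_eq_mul]; ring)
    (fun a b c => by simp only [map_add, mul_add, Complex.add_re]; ring)
    (fun r b c => by
      rw [map_smul D]; simp only [Complex.real_smul, mul_left_comm _ (r : ℂ), Complex.re_ofReal_mul,
        smul_eq_mul]; ring)
  let bf : ℂ →ₗ[ℝ] ℂ →ₗ[ℝ] ℝ := LinearMap.mk₂ ℝ
    (fun u v => -(ρ' * (conj (E u v) * D w).im))
    (fun a b c => by
      have : E (a + b) c = E a c + E b c := by simp only [E, map_add]; ring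
      rw [this]; simp only [map_add, add_mul, Complex.add_im]; ring)
    (fun r b c => by
      have : E (r • b) c = r * E b c := by
        simp only [E, Complex.real_smul, map_mul, Complex.conj_ofReal]; ring
      rw [this]
      simp only [map_mul, Complex.conj_ofReal, mul_assoc, Complex.im_ofReal_mul, smul_eq_mul]
      ring)
    (fun a b c => by
      have : E a (b + c) = E a b + E a c := by simp only [E, map_add]; ring
      rw [this]; simp only [map_add, add_mul, Complex.add_im]; ring)
    (fun r b c => by
      have : E b (r • c) = r * E b c := by
        simp only [E, Complex.real_smul, map_mul, Complex.conj_ofReal]; ring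
      rw [this]
      simp only [map_mul, Complex.conj_ofReal, mul_assoc, Complex.im_ofReal_mul, smul_eq_mul]
      ring)
  have hcomp := trace_comp_linear Q bf L hinj
  have hmetric : inducedMetric g (fun y => (ψ y, f (ψ y))) x =
      Matrix.of fun i j => Q (L (unitFrame i)) (L (unitFrame j)) := by
    ext i j
    unfold inducedMetric
    rw [show pushforward (fun y => (ψ y, f (ψ y))) x (frame x i) = _ from
      pushforward_graph_comp hf hψd _, show pushforward (fun y => (ψ y, f (ψ y))) x (frame x j) = _
      from pushforward_graph_comp hf hψd _]
    exact prodMetric_eq hg _ _ _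
  have hform : ∀ i j, prodForm g (ψ x, f (ψ x))
      (secondDeriv g ψ x (frame x i) (frame x j),
        secondDeriv g (fun y => f (ψ y)) x (frame x i) (frame x j))
      (pushforward (fun y => (ψ y, f (ψ y))) x v) =
      bf (L (unitFrame i)) (L (unitFrame j)) := by
    intro i j
    have hs1 : secondDeriv g ψ x (frame x i) (frame x j) = _ :=
      secondDeriv_eq g hψd (unitFrame i) (unitFrame j)
    have hs2 : secondDeriv g (fun y => f (ψ y)) x (frame x i) (frame x j) = _ :=
      secondDeriv_eq g hfψd (unitFrame i) (unitFrame j)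
    have hψc := contDiffAt_inCharts hψ
    have hcen : inCharts ψ x (chartAt ℂ x x) = z := inCharts_center ψ x
    have heq := inCharts_comp (f := f) hψ.continuousAt
    have hu2 : ContDiffAt ℝ ∞ u (inCharts ψ x (chartAt ℂ x x)) := by rwa [hcen]
    have hd1 : fderiv ℝ (inCharts (fun y => f (ψ y)) x) (chartAt ℂ x x) = D.comp L := by
      rw [heq.fderiv_eq, fderiv_comp _ (hu2.differentiableAt (by simp))
        (hψc.differentiableAt (by simp)), hcen, ← hLψ]
    have hd2 : fderiv ℝ (fderiv ℝ (inCharts (fun y => f (ψ y)) x)) (chartAt ℂ x x) =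
        fderiv ℝ (fderiv ℝ (u ∘ inCharts ψ x)) (chartAt ℂ x x) :=
      heq.fderiv.fderiv_eq
    rw [hs1, hs2, hd1, hd2, pushforward_graph_comp hf hψd, fderiv_fderiv_comp hψc hu2, hcen, ← hLψ]
    refine (prodForm_eq hg _ _ _).trans ?_
    set s := fderiv ℝ (fderiv ℝ (inCharts ψ x)) (chartAt ℂ x x) (unitFrame i) (unitFrame j)
    set l := L (unitFrame i)
    set l' := L (unitFrame j)
    change ρ * (conj (s + Γ * l * l') * w).im -
      ρ' * (conj (H l l' + D s + Γ' * D l * D l') * D w).im = -(ρ' * (conj (E l l') * D w).im)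
    -- By the chain rule, the covariant second derivative of f ∘ ψ is ∇df on the vectors dψ plus df
    -- of the covariant second derivative of ψ. Since df is symplectic, the last term cancels the
    -- first component of the pairing, so only ∇df remains in any parametrization.
    have hsp : ρ' * (conj (D (s + Γ * l * l')) * D w).im = ρ * (conj (s + Γ * l * l') * w).im :=
      hf.conformalFactor_mul hg p _ _
    rw [← hsp]
    have hE : H l l' + D s + Γ' * D l * D l' = E l l' + D (s + Γ * l * l') := by
      rw [map_add, hH, hD (Γ * l * l'), hD l, hD l']
      simp only [E, hA, hB, hC, map_mul]
      ring
    rw [hE]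
    simp only [map_add, add_mul, Complex.add_im]
    ring
  have hsum : ∑ i, ∑ j, (inducedMetric g (fun y => (ψ y, f (ψ y))) x)⁻¹ i j *
      prodForm g (ψ x, f (ψ x)) (secondDeriv g ψ x (frame x i) (frame x j),
        secondDeriv g (fun y => f (ψ y)) x (frame x i) (frame x j))
      (pushforward (fun y => (ψ y, f (ψ y))) x v) = ((A * w + B * conj w) / a).im := by
    rw [hmetric]
    simp only [hform]
    exact hcomp.trans htr
  refine hsum.trans ?_
  unfold phaseForm
  have hdz : dzOf u z = a := rfl
  have hddz : fderiv ℝ (dzOf u) z w = A₀ * w + B₀ * conj w := by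
    have hudd : HasFDerivAt (fderiv ℝ u) H z :=
      ((hu.fderiv_right (m := ∞) (by simp)).differentiableAt (by simp)).hasFDerivAt
    have hY : ∀ Y, HasFDerivAt (fun w => fderiv ℝ u w Y) (H.flip Y) z := by
      intro Y
      convert! hudd.clm_apply (hasFDerivAt_const Y z) using 1
      ext X
      simp
    have h1 : HasFDerivAt (dzOf u) _ z :=
      ((hY 1).sub ((hY Complex.I).const_mul Complex.I)).mul_const (2⁻¹ : ℂ)
    rw [h1.fderiv]
    simp only [smul_apply, sub_apply, ContinuousLinearMap.flip_apply, smul_eq_mul]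
    rw [hH w 1, hH w Complex.I]
    simp only [map_one, Complex.conj_I]
    linear_combination (-(A₀ * w + B₀ * conj w - B₀ * w - C₀ * conj w) / 2) * Complex.I_sq
  change ((A * w + B * conj w) / a).im =
    (fderiv ℝ (dzOf u) z w / dzOf u z + Γ' * D w - Γ * w).im
  rw [hddz, hdz, hD w]
  congr 1
  rw [hA, hB]
  field_simp
  ring

end Graph

section Center

variable {E : Type*} [NormedAddCommGroup E] [NormedSpace ℝ E] {Ψ : E → S} {q : E} {y : S}

theorem mfderiv_eq_fderiv_chartAt (hy : Ψ q = y) (hd : MDifferentiableAt 𝓘(ℝ, E) 𝓘(ℝ, ℂ) Ψ q) :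
    (show E →L[ℝ] ℂ from mfderiv 𝓘(ℝ, E) 𝓘(ℝ, ℂ) Ψ q) =
      fderiv ℝ (fun q => chartAt ℂ y (Ψ q)) q := by
  subst hy
  have h1 := hd.mfderiv
  simp only [modelWithCornersSelf_coe, range_id, fderivWithin_univ] at h1
  exact h1

theorem pullbackArea_eq_center {g : Metric S} (hg : IsConformal g) (hy : Ψ q = y)
    (hd : MDifferentiableAt 𝓘(ℝ, E) 𝓘(ℝ, ℂ) Ψ q) (X Y : E) :
    pullbackArea g Ψ q X Y = conformalFactor g y *
      (conj (fderiv ℝ (fun q => chartAt ℂ y (Ψ q)) q X) *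
        fderiv ℝ (fun q => chartAt ℂ y (Ψ q)) q Y).im := by
  rw [← mfderiv_eq_fderiv_chartAt hy hd, ← hy]
  exact areaForm_eq hg _ _ _

end Center

theorem timeInterval_mem_nhds {T : EReal} {t : ℝ} (ht : t ∈ timeInterval T) (h0 : 0 < t) :
    timeInterval T ∈ 𝓝 t := by
  have h1 : IsOpen {s : ℝ | (s : EReal) < T} := isOpen_Iio.preimage continuous_coe_real_ereal
  filter_upwards [lt_mem_nhds h0, h1.mem_nhds ht.2] with s hs hs'
  exact ⟨hs.le, hs'⟩

/-! ### The flow equation as an equation for the velocity of f_t -/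

section Flow

variable {g : Metric S} {T : EReal} {f : S → S} {f_ : ℝ → S → S}

theorem contMDiffAt_flow (hf : ContMDiffOn (𝓘(ℝ, ℝ).prod 𝓘(ℝ, ℂ)) 𝓘(ℝ, ℂ) ∞
    (fun q : ℝ × S => f_ q.1 q.2) (timeInterval T ×ˢ univ)) {e : OpenPartialHomeomorph S ℂ}
    (he : e ∈ atlas ℂ S) {t : ℝ} (ht : t ∈ timeInterval T) (h0 : 0 < t) {z : ℂ}
    (hz : z ∈ e.target) :
    ContMDiffAt 𝓘(ℝ, ℝ × ℂ) 𝓘(ℝ, ℂ) ∞ (fun q : ℝ × ℂ => f_ q.1 (e.symm q.2)) (t, z) := by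
  have h1 : ContMDiffAt (𝓘(ℝ, ℝ).prod 𝓘(ℝ, ℂ)) 𝓘(ℝ, ℂ) ∞
      (fun q : ℝ × S => f_ q.1 q.2) (t, e.symm z) :=
    hf.contMDiffAt (prod_mem_nhds (timeInterval_mem_nhds ht h0) Filter.univ_mem)
  have h3 : ContMDiffAt 𝓘(ℝ, ℝ × ℂ) 𝓘(ℝ, ℂ) ∞ (fun q : ℝ × ℂ => e.symm q.2) (t, z) :=
    ((contMDiffOn_chart_symm_real he).contMDiffAt (e.open_target.mem_nhds hz)).comp (t, z)
      contDiff_snd.contMDiff.contMDiffAt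
  exact h1.comp (t, z) (contDiff_fst.contMDiff.contMDiffAt.prodMk h3)

/-- Along the mean curvature flow, the velocity of `f_t` is dual to the phase form. -/
theorem IsMeanCurvatureFlow.pullbackArea_eq_neg_phaseForm
    (hflow : IsMeanCurvatureFlow g f T f_) (hg : IsConformal g) {t : ℝ}
    (ht : t ∈ timeInterval T) (h0 : 0 < t) (x : S) (v : ℂ) :
    pullbackArea g (fun q : ℝ × ℂ => f_ q.1 ((chartAt ℂ x).symm q.2)) (t, chartAt ℂ x x)
      (1, 0) (0, v) = -phaseForm g (f_ t) x v := by
  obtain ⟨F, hF, -, hrange⟩ := hflow.flow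
  have hfs := hflow.symplectic t ht
  have hnhds := timeInterval_mem_nhds ht h0
  have hsnd : ∀ s ∈ timeInterval T, ∀ y, (F s y).2 = f_ s (F s y).1 := by
    intro s hs y
    have h1 : F s y ∈ range (graphMap (f_ s)) := by
      rw [← hrange s hs]; exact mem_range_self y
    obtain ⟨y', hy'⟩ := h1
    rw [← hy']
    rfl
  -- The image of F_t is the whole graph, so F_t(x') = (x, f_t(x)) for some x'. Near x' the
  -- immersion is the graph parametrized through ψ, the first component of F_t.
  obtain ⟨x', hx'⟩ : graphMap (f_ t) x ∈ range (F t) := by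
    rw [hrange t ht]; exact mem_range_self x
  have hψx : (F t x').1 = x := by rw [hx']; rfl
  subst hψx
  set ψ : S → S := fun y => (F t y).1 with hψ'
  set x := (F t x').1 with hx
  have hG : F t = fun y => (ψ y, f_ t (ψ y)) := funext fun y => Prod.ext rfl (hsnd t ht y)
  have hFat : ContMDiffAt (𝓘(ℝ, ℝ).prod 𝓘(ℝ, ℂ)) (𝓘(ℝ, ℂ).prod 𝓘(ℝ, ℂ)) ∞
      (fun q : ℝ × S => F q.1 q.2) (t, x') :=
    hF.smooth.contMDiffAt (prod_mem_nhds hnhds Filter.univ_mem)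
  have hF1 : ContMDiffAt (𝓘(ℝ, ℝ).prod 𝓘(ℝ, ℂ)) 𝓘(ℝ, ℂ) ∞
      (fun q : ℝ × S => (F q.1 q.2).1) (t, x') := hFat.fst
  have hF2 : ContMDiffAt (𝓘(ℝ, ℝ).prod 𝓘(ℝ, ℂ)) 𝓘(ℝ, ℂ) ∞
      (fun q : ℝ × S => (F q.1 q.2).2) (t, x') := hFat.snd
  have hψs : ContMDiffAt 𝓘(ℝ, ℂ) 𝓘(ℝ, ℂ) ∞ ψ x' :=
    hF1.comp x' (contMDiffAt_const.prodMk contMDiffAt_id)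
  have hψd : MDifferentiableAt 𝓘(ℝ, ℂ) 𝓘(ℝ, ℂ) ψ x' := hψs.mdifferentiableAt (by simp)
  have hcurve : ContMDiffAt 𝓘(ℝ, ℝ) (𝓘(ℝ, ℝ).prod 𝓘(ℝ, ℂ)) ∞ (fun s : ℝ => (s, x')) t :=
    contMDiffAt_id.prodMk contMDiffAt_const
  have hc1s : ContMDiffAt 𝓘(ℝ, ℝ) 𝓘(ℝ, ℂ) ∞ (fun s => (F s x').1) t :=
    ContMDiffAt.comp t (g := fun q : ℝ × S => (F q.1 q.2).1) hF1 hcurve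
  have hc2s : ContMDiffAt 𝓘(ℝ, ℝ) 𝓘(ℝ, ℂ) ∞ (fun s => (F s x').2) t :=
    ContMDiffAt.comp t (g := fun q : ℝ × S => (F q.1 q.2).2) hF2 hcurve
  have hc1 := hc1s.mdifferentiableAt (by simp)
  have hc2 := hc2s.mdifferentiableAt (by simp)
  set L : ℂ →L[ℝ] ℂ := mfderiv 𝓘(ℝ, ℂ) 𝓘(ℝ, ℂ) ψ x' with hL
  have hinj : Function.Injective L := by
    intro a b hab
    have h1 := hF.immersion t ht x'
    rw [hG] at h1
    apply h1
    rw [show pushforward (fun y => (ψ y, f_ t (ψ y))) x' a = _ from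
      pushforward_graph_comp hfs hψd a, show pushforward (fun y => (ψ y, f_ t (ψ y))) x' b = _ from
      pushforward_graph_comp hfs hψd b]
    exact Prod.ext hab (congrArg (fderiv ℝ (inCharts (f_ t) (ψ x')) (chartAt ℂ (ψ x') (ψ x'))) hab)
  obtain ⟨v', hv'⟩ : ∃ v', L v' = v :=
    (LinearMap.injective_iff_surjective (f := (L : ℂ →ₗ[ℝ] ℂ))).1 hinj v
  set V₁ : ℂ := mfderivWithin 𝓘(ℝ, ℝ) 𝓘(ℝ, ℂ) (fun s => (F s x').1) (timeInterval T) t (1 : ℝ)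
    with hV₁
  set V₂ : ℂ := mfderivWithin 𝓘(ℝ, ℝ) 𝓘(ℝ, ℂ) (fun s => (F s x').2) (timeInterval T) t (1 : ℝ)
    with hV₂
  -- The graph is Lagrangian, so pairing with a tangent vector sees only the normal part of the
  -- velocity of F, which is the mean curvature vector.
  have hvel : prodForm g (x, f_ t x) ((V₁, V₂) : ℂ × ℂ)
      (pushforward (fun y => (ψ y, f_ t (ψ y))) x' v') = phaseForm g (f_ t) x v := by
    have key : ∀ G : S → S × S, F t = G →
        (∀ a b, prodForm g (G x') (pushforward G x' a) (pushforward G x' b) = 0) →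
        prodForm g (G x') ((V₁, V₂) : ℂ × ℂ) (pushforward G x' v') =
          prodForm g (G x') (meanCurvature g G x') (pushforward G x' v') := by
      rintro G rfl hLag
      rw [← hF.velocity t ht x']
      exact (prodForm_normalPart hg hLag _ _).symm
    have h1 := key _ hG fun a b => prodForm_pushforward_graph_comp hfs hg hψd a b
    rw [← hv']
    exact h1.trans (prodForm_meanCurvature_graph_comp hfs hg hψs hinj v')
  set e := chartAt ℂ x with he'
  have he : e ∈ atlas ℂ S := chart_mem_atlas ℂ x
  have hex : e.symm (e x) = x := e.left_inv (mem_chart_source ℂ x)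
  set Ψ : ℝ × ℂ → S := fun q => f_ q.1 (e.symm q.2) with hΨ
  have hΨs : ContMDiffAt 𝓘(ℝ, ℝ × ℂ) 𝓘(ℝ, ℂ) ∞ Ψ (t, e x) :=
    contMDiffAt_flow hflow.smooth he ht h0 (mem_chart_target ℂ x)
  have hΨd : MDifferentiableAt 𝓘(ℝ, ℝ × ℂ) 𝓘(ℝ, ℂ) Ψ (t, e x) := hΨs.mdifferentiableAt (by simp)
  have hΨy : Ψ (t, e x) = f_ t x := by simp only [hΨ, hex]
  rw [pullbackArea_eq_center hg hΨy hΨd]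
  set u : ℝ × ℂ → ℂ := fun q => chartAt ℂ (f_ t x) (Ψ q) with hu
  have hud : HasFDerivAt u (fderiv ℝ u (t, e x)) (t, e x) := by
    have h1 : MDifferentiableAt 𝓘(ℝ, ℂ) 𝓘(ℝ, ℂ) (chartAt ℂ (f_ t x)) (Ψ (t, e x)) :=
      mdifferentiableAt_chart_real (chart_mem_atlas ℂ _) (by rw [hΨy]; exact mem_chart_source ℂ _)
    have h2 := h1.comp (t, e x) hΨd
    exact (mdifferentiableAt_iff_differentiableAt.1 h2).hasFDerivAt
  set D := fderiv ℝ (inCharts (f_ t) x) (e x) with hD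
  have hDu : ∀ w, fderiv ℝ u (t, e x) (0, w) = D w := by
    intro w
    have h1 : HasFDerivAt (inCharts (f_ t) x) _ (e x) :=
      hud.comp (e x) (hasFDerivAt_prodMk_right t (e x))
    rw [hD, h1.fderiv]
    simp
  have hV₁' : V₁ = fderiv ℝ (fun s => e ((F s x').1)) t 1 := by
    rw [← mfderiv_eq_fderiv_chartAt rfl hc1]
    rw [hV₁, mfderivWithin_of_mem_nhds hnhds]
    rfl
  have hc1' : HasFDerivAt (fun s => e ((F s x').1)) (fderiv ℝ (fun s => e ((F s x').1)) t) t := by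
    have h1 : MDifferentiableAt 𝓘(ℝ, ℂ) 𝓘(ℝ, ℂ) e ((F t x').1) :=
      mdifferentiableAt_chart_real he (mem_chart_source ℂ _)
    have h2 := h1.comp t hc1
    exact (mdifferentiableAt_iff_differentiableAt.1 h2).hasFDerivAt
  -- The curve s ↦ F_s(x') stays on the graphs, so its second component is f_s applied to the first.
  have hV₂' : V₂ = fderiv ℝ u (t, e x) (1, V₁) := by
    have h1 : V₂ = fderiv ℝ (fun s => chartAt ℂ (f_ t x) ((F s x').2)) t 1 := by
      rw [← mfderiv_eq_fderiv_chartAt (Ψ := fun s => (F s x').2) (hsnd t ht x') hc2]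
      rw [hV₂, mfderivWithin_of_mem_nhds hnhds]
      rfl
    have h2 : (fun s => chartAt ℂ (f_ t x) ((F s x').2)) =ᶠ[𝓝 t]
        u ∘ fun s => (s, e ((F s x').1)) := by
      have h3 : ∀ᶠ s in 𝓝 t, (F s x').1 ∈ e.source :=
        hc1.continuousAt.eventually (e.open_source.mem_nhds (mem_chart_source ℂ x))
      filter_upwards [hnhds, h3] with s hs hs'
      simp only [hu, hΨ, Function.comp, e.left_inv hs', hsnd s hs x']
    have h4 : HasFDerivAt (fun s : ℝ => (s, e ((F s x').1))) _ t := (hasFDerivAt_id t).prodMk hc1'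
    rw [h1, h2.fderiv_eq, (hud.comp t h4).fderiv, hV₁']
    simp
  have hadd : fderiv ℝ u (t, e x) (1, V₁) = fderiv ℝ u (t, e x) (1, 0) + D V₁ := by
    rw [← hDu, ← map_add]
    simp
  rw [pushforward_graph_comp hfs hψd] at hvel
  have hvel' : conformalFactor g x * (conj V₁ * L v').im -
      conformalFactor g (f_ t x) * (conj V₂ * D (L v')).im = phaseForm g (f_ t) x v :=
    (prodForm_eq hg _ _ _).symm.trans hvel
  rw [hv', hV₂', hadd] at hvel'
  -- The term df_t(V₁) comes from the motion of the parametrization; since f_t is symplectic it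
  -- cancels the contribution of the first factor, leaving only the velocity of f_t at a fixed
  -- point.
  have hsp : conformalFactor g (f_ t x) * (conj (D V₁) * D v).im =
      conformalFactor g x * (conj V₁ * v).im := hfs.conformalFactor_mul hg x V₁ v
  rw [hDu, ← hvel', ← hsp]
  simp only [map_add, add_mul, Complex.add_im]
  ring

/-- The factor 2r is dt/dr for t = r². -/
theorem IsMeanCurvatureFlow.pullbackArea_flowInChart
    (hflow : IsMeanCurvatureFlow g f T f_) (hg : IsConformal g) {r : ℝ}
    (hr : r ∈ sqrtDomain T) (h0 : 0 < r) (x : S) (v : ℂ) :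
    pullbackArea g (flowInChart f_ (chartAt ℂ x)) (r, chartAt ℂ x x) (1, 0) (0, v) =
      -(2 * r) * phaseForm g (f_ (r ^ 2)) x v := by
  have hΨs := contMDiffAt_flow hflow.smooth (chart_mem_atlas ℂ x) (sq_mem_timeInterval hr)
    (by positivity) (mem_chart_target ℂ x)
  have hℓ : HasFDerivAt (fun q : ℝ × ℂ => (q.1 ^ 2, q.2)) _ (r, chartAt ℂ x x) :=
    ((hasFDerivAt_fst (𝕜 := ℝ) (p := (r, chartAt ℂ x x))).pow 2).prodMk hasFDerivAt_snd
  have h := pullbackArea_comp (g := g) (Ψ := fun q : ℝ × ℂ => f_ q.1 ((chartAt ℂ x).symm q.2))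
    (ℓ := fun q : ℝ × ℂ => (q.1 ^ 2, q.2)) (p := (r, chartAt ℂ x x))
    (hΨs.mdifferentiableAt (by simp)) hℓ (1, 0) (0, v)
  refine Eq.trans h ?_
  rw [pullbackArea_swap hg]
  have h2 := pullbackArea_right_comb hg
    (fun q : ℝ × ℂ => f_ q.1 ((chartAt ℂ x).symm q.2)) (r ^ 2, chartAt ℂ x x) (0, v) (1, 0) 0
    (2 * r) 0
  have h3 := hflow.pullbackArea_eq_neg_phaseForm hg (sq_mem_timeInterval hr) (by positivity) x v
  rw [pullbackArea_swap hg] at h3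
  simp at h2 ⊢
  rw [h2]
  linear_combination (-(2 * r)) * h3

end Flow

/-! ### The phase along the flow -/

section Slice

variable {g : Metric S} {T : EReal} {f : S → S} {f_ : ℝ → S → S}

/-- The angle form treats ∂Ψ as a section of Hom(ℂ, Ψ^*TS) with the flat connection on ℂ;
subtracting the source connection form corrects this. The correction is independent of time and
disappears from time derivatives. -/
theorem angleForm_flowInChart_slice
    (hf : ContMDiffOn (𝓘(ℝ, ℝ).prod 𝓘(ℝ, ℂ)) 𝓘(ℝ, ℂ) ∞
      (fun q : ℝ × S => f_ q.1 q.2) (timeInterval T ×ˢ univ)) {r : ℝ} (hr : r ∈ sqrtDomain T)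
    (x : S) (v : ℂ) :
    angleForm g (flowInChart f_ (chartAt ℂ x)) (r, chartAt ℂ x x) (0, v) -
      (connectionCoeff g (chartAt ℂ x) (chartAt ℂ x x) * v).im = phaseForm g (f_ (r ^ 2)) x v := by
  set e := chartAt ℂ x with he'
  have he : e ∈ atlas ℂ S := chart_mem_atlas ℂ x
  have hcen : flowInChart f_ e (r, e x) = f_ (r ^ 2) x := by
    simp only [flowInChart, e.left_inv (mem_chart_source ℂ x)]
  have hW : IsOpen (sqrtDomain T ×ˢ e.target) := (isOpen_sqrtDomain T).prod e.open_target
  have hΨ := contMDiffOn_flowInChart hf he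
  unfold angleForm angleIn phaseForm
  rw [hcen]
  set e' := chartAt ℂ (f_ (r ^ 2) x) with he''
  have hV := isOpen_inter_preimage_chart hW hΨ e'
  have hu := contDiffOn_chart_comp hΨ (chart_mem_atlas ℂ (f_ (r ^ 2) x))
  have hp : (r, e x) ∈ sqrtDomain T ×ˢ e.target ∩ flowInChart f_ e ⁻¹' e'.source :=
    ⟨⟨hr, mem_chart_target ℂ x⟩, by rw [mem_preimage, hcen]; exact mem_chart_source ℂ _⟩
  set u : ℝ × ℂ → ℂ := fun q => e' (flowInChart f_ e q) with hu'
  have hD : ∀ w, (r, w) ∈ sqrtDomain T ×ˢ e.target ∩ flowInChart f_ e ⁻¹' e'.source → ∀ Y,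
      fderiv ℝ u (r, w) (0, Y) = fderiv ℝ (inCharts (f_ (r ^ 2)) x) w Y := by
    intro w hw Y
    have h1 : HasFDerivAt u (fderiv ℝ u (r, w)) (r, w) :=
      ((hu.contDiffAt (hV.mem_nhds hw)).differentiableAt (by simp)).hasFDerivAt
    have h2 : HasFDerivAt (inCharts (f_ (r ^ 2)) x) _ w :=
      h1.comp w (hasFDerivAt_prodMk_right r w)
    rw [h2.fderiv]
    simp
  have hdz : ∀ w, (r, w) ∈ sqrtDomain T ×ˢ e.target ∩ flowInChart f_ e ⁻¹' e'.source →
      dzPart u (r, w) = dzOf (inCharts (f_ (r ^ 2)) x) w := by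
    intro w hw
    simp only [dzPart, dzOf, hD w hw]
  have hDdz : fderiv ℝ (dzPart u) (r, e x) (0, v) =
      fderiv ℝ (dzOf (inCharts (f_ (r ^ 2)) x)) (e x) v := by
    have h1 : HasFDerivAt (dzPart u) (fderiv ℝ (dzPart u) (r, e x)) (r, e x) :=
      (((contDiffOn_dzPart hV hu).contDiffAt (hV.mem_nhds hp)).differentiableAt
        (by simp)).hasFDerivAt
    have h2 := h1.comp (e x) (hasFDerivAt_prodMk_right r (e x))
    have h3 : dzOf (inCharts (f_ (r ^ 2)) x) =ᶠ[𝓝 (e x)] dzPart u ∘ fun w => (r, w) := by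
      have : ∀ᶠ w in 𝓝 (e x),
          (r, w) ∈ sqrtDomain T ×ˢ e.target ∩ flowInChart f_ e ⁻¹' e'.source :=
        (Continuous.tendsto (f := fun w : ℂ => (r, w)) (by fun_prop) (e x)).eventually
          (hV.mem_nhds hp)
      filter_upwards [this] with w hw
      exact (hdz w hw).symm
    rw [(h2.congr_of_eventuallyEq h3).fderiv]
    simp
  rw [hDdz, hdz _ hp, hD _ hp, ← Complex.sub_im]

/-- The identification of the mean curvature form, taken for the standard parametrization of the
graph, ψ = id. -/
theorem HasZeroMaslovClass.exists_mfderiv_eq_phaseForm (hM : HasZeroMaslovClass g f)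
    (hg : IsConformal g) (hf : IsSymplectomorphism g f) :
    ∃ K : S → ℝ, ContMDiff 𝓘(ℝ, ℂ) 𝓘(ℝ, ℝ) ∞ K ∧
      ∀ x v, (mfderiv 𝓘(ℝ, ℂ) 𝓘(ℝ, ℝ) K x v : ℝ) = 2 / Real.pi * phaseForm g f x v := by
  obtain ⟨K, hK, hK'⟩ := hM
  refine ⟨K, hK, fun x v => (hK' x v).trans ?_⟩
  have hid : mfderiv 𝓘(ℝ, ℂ) 𝓘(ℝ, ℂ) (fun y : S => y) x = ContinuousLinearMap.id ℝ _ :=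
    mfderiv_id
  have h := prodForm_meanCurvature_graph_comp (ψ := fun y => y) (x := x) hf hg contMDiffAt_id
    (by rw [hid]; exact fun a b h => h) v
  rw [hid] at h
  exact congrArg (2 / Real.pi * ·) h

end Slice

/-- The solution of `y' = 1 + c y` with `y(0) = 0`. -/
theorem exists_weight (c : ℝ) : ∃ y : ℝ → ℝ, ContDiff ℝ ∞ y ∧ y 0 = 0 ∧
    ∀ s, HasDerivAt y (1 + c * y s) s := by
  by_cases hc : c = 0
  · subst hc
    refine ⟨fun s => s, contDiff_id, rfl, fun s => ?_⟩
    rw [zero_mul, add_zero]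
    exact hasDerivAt_id' s
  · refine ⟨fun s => (Real.exp (c * s) - 1) / c,
      ((Real.contDiff_exp.comp (contDiff_const.mul contDiff_id)).sub contDiff_const).div_const c,
      by simp, fun s => ?_⟩
    have h := (((((hasDerivAt_id s).const_mul c).exp).sub_const 1).div_const c)
    convert! h using 1
    simp only [id]
    field_simp
    ring

/-! ### Functions and forms on the surface in charts -/

section InCharts

theorem contMDiff_of_contDiffOn_chart_symm {P : S → ℝ}
    (h : ∀ e ∈ atlas ℂ S, ContDiffOn ℝ ∞ (fun z => P (e.symm z)) e.target) :
    ContMDiff 𝓘(ℝ, ℂ) 𝓘(ℝ, ℝ) ∞ P := by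
  intro x
  have he : chartAt ℂ x ∈ atlas ℂ S := chart_mem_atlas ℂ x
  have h1 := (h _ he).contMDiffOn.comp (contMDiffOn_chart_real he)
    fun y hy => (chartAt ℂ x).map_source hy
  have h2 := h1.contMDiffAt ((chartAt ℂ x).open_source.mem_nhds (mem_chart_source ℂ x))
  refine h2.congr_of_eventuallyEq ?_
  filter_upwards [(chartAt ℂ x).open_source.mem_nhds (mem_chart_source ℂ x)] with y hy
  simp only [Function.comp, (chartAt ℂ x).left_inv hy]

theorem mfderiv_eq_fderiv_chart_symm {P : S → ℝ} {x : S}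
    (hP : MDifferentiableAt 𝓘(ℝ, ℂ) 𝓘(ℝ, ℝ) P x) :
    (show ℂ →L[ℝ] ℝ from mfderiv 𝓘(ℝ, ℂ) 𝓘(ℝ, ℝ) P x) =
      fderiv ℝ (fun z => P ((chartAt ℂ x).symm z)) (chartAt ℂ x x) := by
  have h1 := hP.mfderiv
  simp only [modelWithCornersSelf_coe, range_id, fderivWithin_univ] at h1
  exact h1

/-- Tangent vectors at x are represented in the preferred chart, so the differential of the inverse
of that chart is the identity at the coordinate of x. -/
theorem oneForm_chart_symm_center (α : OneForm S) (x : S) (v : ℂ) :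
    α ((chartAt ℂ x).symm (chartAt ℂ x x))
      (mfderiv 𝓘(ℝ, ℂ) 𝓘(ℝ, ℂ) (chartAt ℂ x).symm (chartAt ℂ x x) v) = α x v := by
  have hex : (chartAt ℂ x).symm (chartAt ℂ x x) = x :=
    (chartAt ℂ x).left_inv (mem_chart_source ℂ x)
  have h1 := mfderiv_eq_fderiv_chartAt hex
    (mdifferentiableAt_chart_symm_real (chart_mem_atlas ℂ x) (mem_chart_target ℂ x))
  have h2 : (fun q => chartAt ℂ x ((chartAt ℂ x).symm q)) =ᶠ[𝓝 (chartAt ℂ x x)] id := by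
    filter_upwards [(chartAt ℂ x).open_target.mem_nhds (mem_chart_target ℂ x)] with w hw
    exact (chartAt ℂ x).right_inv hw
  rw [h2.fderiv_eq, fderiv_id] at h1
  have h3 : (show ℂ from mfderiv 𝓘(ℝ, ℂ) 𝓘(ℝ, ℂ) (chartAt ℂ x).symm (chartAt ℂ x x) v) = v :=
    DFunLike.congr_fun h1 v
  have key : ∀ (y : S) (w : ℂ), y = x → w = v → α y w = α x v := by
    rintro y w rfl rfl; rfl
  exact key _ _ hex h3

end InCharts

/-! ### The variation of the flux -/

section Variation

variable {g : Metric S} {T : EReal} {φ f_ : ℝ → S → S} {Φ : ℝ → ℝ → S → S} {f : S → S}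
  {e : OpenPartialHomeomorph S ℂ}

/-- The area swept out by the path `s ↦ f_{s,t}(x)` when `r = √t` varies, per unit of `r`. -/
def sweptAreaAt (g : Metric S) (Φ : ℝ → ℝ → S → S) (r : ℝ) (x : S) : ℝ :=
  ∫ σ in (0 : ℝ)..Real.pi,
    pullbackArea g (fun p : ℝ × ℝ => Φ (unitWave p.1) (p.2 ^ 2) x) (σ, r) (1, 0) (0, 1)

theorem IsIsotopyAlongFlow.sweptAreaAt_chart_symm (hΦ : IsIsotopyAlongFlow g T φ f_ Φ)
    (he : e ∈ atlas ℂ S) {r : ℝ} (hr : r ∈ sqrtDomain T) {z : ℂ} (hz : z ∈ e.target) :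
    sweptAreaAt g Φ r (e.symm z) = sweptArea g Φ e (r, z) := by
  refine intervalIntegral.integral_congr fun σ _ => ?_
  have hO : IsOpen ((univ : Set ℝ) ×ˢ sqrtDomain T ×ˢ e.target) :=
    isOpen_univ.prod ((isOpen_sqrtDomain T).prod e.open_target)
  let L : ℝ × ℝ →L[ℝ] ℝ × ℝ × ℂ := (ContinuousLinearMap.fst ℝ ℝ ℝ).prod
    ((ContinuousLinearMap.snd ℝ ℝ ℝ).prod (0 : ℝ × ℝ →L[ℝ] ℂ))
  have hL : HasFDerivAt (fun p : ℝ × ℝ => (p.1, p.2, z)) L (σ, r) :=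
    hasFDerivAt_fst.prodMk (hasFDerivAt_snd.prodMk (hasFDerivAt_const z _))
  exact pullbackArea_comp (g := g) (Ψ := familyInChart Φ e)
    (mdifferentiableAt_of_contMDiffOn hO (hΦ.contMDiffOn_familyInChart he)
      ⟨mem_univ _, hr, hz⟩) hL (1, 0) (0, 1)

/-- In a chart, the integrand of the primitive of the variation of the flux form. -/
def fluxPotential (g : Metric S) (Φ : ℝ → ℝ → S → S) (f_ : ℝ → S → S) (w : ℝ → ℝ)
    (e : OpenPartialHomeomorph S ℂ) (q : ℝ × ℂ) : ℝ :=
  sweptArea g Φ e q - w q.1 * angleForm g (flowInChart f_ e) q (1, 0)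

theorem IsIsotopyAlongFlow.contDiffOn_fluxPotential (hΦ : IsIsotopyAlongFlow g T φ f_ Φ)
    (hflow : IsMeanCurvatureFlow g f T f_) (hg : IsConformal g) {w : ℝ → ℝ} (hw : ContDiff ℝ ∞ w)
    (he : e ∈ atlas ℂ S) :
    ContDiffOn ℝ ∞ (fluxPotential g Φ f_ w e) (sqrtDomain T ×ˢ e.target) :=
  (hΦ.contDiffOn_sweptArea hg he).sub ((hw.comp contDiff_fst).contDiffOn.mul
    (contDiffOn_angleForm hg ((isOpen_sqrtDomain T).prod e.open_target)
      (contMDiffOn_flowInChart hflow.smooth he)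
      (fun _ hq => pullbackArea_flowInChart_pos hg hflow.symplectic hflow.smooth he hq) _))

/-- Modulo differentials of functions, the flux has r-derivative −2rθ and θ has r-derivative 2rcθ.
The equation w' = −2r(1 + cw) is the one for which all multiples of θ cancel in the derivative of
flux − wθ; what is left is the differential of `fluxPotential`. -/
theorem IsIsotopyAlongFlow.hasDerivAt_flux_sub (hΦ : IsIsotopyAlongFlow g T φ f_ Φ)
    (hflow : IsMeanCurvatureFlow g f T f_) (hg : IsConformal g) {c : ℝ}
    (hc : HasConstantCurvature g c) {w : ℝ → ℝ} {r : ℝ}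
    (hw : HasDerivAt w (-(2 * r) * (1 + c * w r)) r)
    (hr : r ∈ sqrtDomain T) (h0 : 0 < r) (x : S) (v : ℂ) :
    HasDerivAt (fun r => (∫ σ in (0 : ℝ)..Real.pi,
        pullbackArea g (familyInChart Φ (chartAt ℂ x)) (σ, r, chartAt ℂ x x) (1, 0, 0) (0, 0, v)) -
        w r * (angleForm g (flowInChart f_ (chartAt ℂ x)) (r, chartAt ℂ x x) (0, v) -
          (connectionCoeff g (chartAt ℂ x) (chartAt ℂ x x) * v).im))
      (fderiv ℝ (fluxPotential g Φ f_ w (chartAt ℂ x)) (r, chartAt ℂ x x) (0, v)) r := by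
  set e := chartAt ℂ x with he'
  have he : e ∈ atlas ℂ S := chart_mem_atlas ℂ x
  have hz : e x ∈ e.target := mem_chart_target ℂ x
  have hW : IsOpen (sqrtDomain T ×ˢ e.target) := (isOpen_sqrtDomain T).prod e.open_target
  have hq : (r, e x) ∈ sqrtDomain T ×ˢ e.target := ⟨hr, hz⟩
  have hΨ := contMDiffOn_flowInChart hflow.smooth he
  have hpos : ∀ q ∈ sqrtDomain T ×ˢ e.target,
      0 < pullbackArea g (flowInChart f_ e) q (0, 1) (0, Complex.I) :=
    fun _ hq => pullbackArea_flowInChart_pos hg hflow.symplectic hflow.smooth he hq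
  have hangle : ∀ X, HasFDerivAt (fun q => angleForm g (flowInChart f_ e) q X)
      (fderiv ℝ (fun q => angleForm g (flowInChart f_ e) q X) (r, e x)) (r, e x) := fun X =>
    (((contDiffOn_angleForm hg hW hΨ hpos X).contDiffAt (hW.mem_nhds hq)).differentiableAt
      (by simp)).hasFDerivAt
  have hswept : HasFDerivAt (sweptArea g Φ e) (fderiv ℝ (sweptArea g Φ e) (r, e x)) (r, e x) :=
    (((hΦ.contDiffOn_sweptArea hg he).contDiffAt (hW.mem_nhds hq)).differentiableAt
      (by simp)).hasFDerivAt
  have hG : fderiv ℝ (fluxPotential g Φ f_ w e) (r, e x) (0, v) =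
      fderiv ℝ (sweptArea g Φ e) (r, e x) (0, v) -
        w r * fderiv ℝ (fun q => angleForm g (flowInChart f_ e) q (1, 0)) (r, e x) (0, v) := by
    have h1 : HasFDerivAt (fun q : ℝ × ℂ => w q.1) _ (r, e x) :=
      HasFDerivAt.comp (g := w) (r, e x) hw.hasFDerivAt hasFDerivAt_fst
    have h2 : HasFDerivAt (fluxPotential g Φ f_ w e) _ (r, e x) :=
      hswept.sub (h1.mul (hangle (1, 0)))
    rw [h2.fderiv]
    simp
  have hθ := ((hangle (0, v)).comp r (hasFDerivAt_prodMk_const_left r (e x))).hasDerivAt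
  have hflux := hΦ.hasDerivAt_flux hg he hr hz v
  have hstr := fderiv_angleForm_sub hg hc hW hΨ hpos hq (1, 0) (0, v)
  have hmcf := hflow.pullbackArea_flowInChart hg hr h0 x v
  have hsl := angleForm_flowInChart_slice (g := g) hflow.smooth hr x v
  have hall := hflux.sub (hw.mul (hθ.sub_const
    ((connectionCoeff g e (e x) * v).im)))
  convert! hall using 1
  rw [hG]
  simp only [ContinuousLinearMap.comp_apply, Function.comp, ContinuousLinearMap.inl_apply]
  rw [hsl]
  rw [hmcf] at hstr ⊢
  linear_combination (w r) * hstr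

/-- Integrate the derivative of flux − wθ from 0 to τ. Since w(τ) = 0, the phase form at the final
time does not occur; only the initial one remains. -/
theorem IsIsotopyAlongFlow.flux_sub_flux_zero (hΦ : IsIsotopyAlongFlow g T φ f_ Φ)
    (hflow : IsMeanCurvatureFlow g f T f_) (hg : IsConformal g) {c : ℝ}
    (hc : HasConstantCurvature g c) {w : ℝ → ℝ} (hws : ContDiff ℝ ∞ w)
    (hw : ∀ r, HasDerivAt w (-(2 * r) * (1 + c * w r)) r) {τ : ℝ} (hwτ : w τ = 0)
    (hφ : IsSymplecticIsotopy g φ f)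
    (hτ : τ ∈ sqrtDomain T) (h0 : 0 ≤ τ) (x : S) (v : ℂ) :
    fluxForm g (fun s => Φ s (τ ^ 2)) x v - fluxForm g φ x v = -(w 0 * phaseForm g f x v) +
      ∫ r in (0 : ℝ)..τ,
        fderiv ℝ (fluxPotential g Φ f_ w (chartAt ℂ x)) (r, chartAt ℂ x x) (0, v) := by
  set e := chartAt ℂ x with he'
  have he : e ∈ atlas ℂ S := chart_mem_atlas ℂ x
  have hz : e x ∈ e.target := mem_chart_target ℂ x
  have hW : IsOpen (sqrtDomain T ×ˢ e.target) := (isOpen_sqrtDomain T).prod e.open_target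
  have hsub : uIcc 0 τ ⊆ sqrtDomain T := uIcc_subset_sqrtDomain hτ
  have h0' : (0 : ℝ) ∈ sqrtDomain T := hsub left_mem_uIcc
  have hΨ := contMDiffOn_flowInChart hflow.smooth he
  have hpos : ∀ q ∈ sqrtDomain T ×ˢ e.target,
      0 < pullbackArea g (flowInChart f_ e) q (0, 1) (0, Complex.I) :=
    fun _ hq => pullbackArea_flowInChart_pos hg hflow.symplectic hflow.smooth he hq
  have hline : ContinuousOn (fun r : ℝ => (r, e x)) (uIcc 0 τ) := by fun_prop
  have hmaps : MapsTo (fun r : ℝ => (r, e x)) (uIcc 0 τ) (sqrtDomain T ×ˢ e.target) :=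
    fun r hr => ⟨hsub hr, hz⟩
  have hD : ContinuousOn (fun r => fderiv ℝ (fluxPotential g Φ f_ w e) (r, e x) (0, v))
      (uIcc 0 τ) :=
    ((((hΦ.contDiffOn_fluxPotential hflow hg hws he).continuousOn_fderiv_of_isOpen hW
      (by simp)).clm_apply continuousOn_const).comp hline hmaps)
  have hcont : ContinuousOn (fun r => (∫ σ in (0 : ℝ)..Real.pi,
        pullbackArea g (familyInChart Φ e) (σ, r, e x) (1, 0, 0) (0, 0, v)) -
        w r * (angleForm g (flowInChart f_ e) (r, e x) (0, v) -
          (connectionCoeff g e (e x) * v).im)) (uIcc 0 τ) := by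
    have h1 : ContinuousOn (fun r => ∫ σ in (0 : ℝ)..Real.pi,
        pullbackArea g (familyInChart Φ e) (σ, r, e x) (1, 0, 0) (0, 0, v)) (uIcc 0 τ) :=
      fun r hr => (hΦ.hasDerivAt_flux hg he (hsub hr) hz v).continuousAt.continuousWithinAt
    have h2 : ContinuousOn (fun r => angleForm g (flowInChart f_ e) (r, e x) (0, v)) (uIcc 0 τ) :=
      (contDiffOn_angleForm hg hW hΨ hpos (0, v)).continuousOn.comp hline hmaps
    exact h1.sub (hws.continuous.continuousOn.mul (h2.sub continuousOn_const))
  -- The flow equation was derived only for r > 0; continuity up to r = 0 suffices for the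
  -- fundamental theorem of calculus.
  have hftc := intervalIntegral.integral_eq_sub_of_hasDerivAt_of_le h0
    (by rwa [uIcc_of_le h0] at hcont)
    (fun r hr => hΦ.hasDerivAt_flux_sub hflow hg hc (hw r)
      (hsub (by rw [uIcc_of_le h0]; exact Ioo_subset_Icc_self hr)) hr.1 x v) hD.intervalIntegrable
  rw [angleForm_flowInChart_slice hflow.smooth h0' x v, hwτ] at hftc
  have hzero : (0 : ℝ) ^ 2 = 0 := by norm_num
  have hφ0 : fluxForm g φ x v = fluxForm g (fun s => Φ s (0 ^ 2)) x v := by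
    -- The two isotopies agree only for s in [0, 1], so their two-sided s-derivatives may differ at
    -- the ends. The reparametrised maps use only parameters in [0, 1] and are equal.
    have hiso : isotopyInChart φ e = isotopyInChart (fun s => Φ s (0 ^ 2)) e := by
      funext q
      simp only [isotopyInChart, hzero]
      rw [hΦ.zero _ (unitWave_mem _)]
    rw [← oneForm_chart_symm_center (fluxForm g fun s => Φ s (0 ^ 2)) x v,
      ← oneForm_chart_symm_center (fluxForm g φ) x v, hφ.fluxForm_chart_symm hg he hz,
      (hΦ.isotopy _ (sq_mem_timeInterval h0')).fluxForm_chart_symm hg he hz, hiso]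
  rw [hzero, hflow.zero] at hftc
  rw [hφ0, ← oneForm_chart_symm_center (fluxForm g fun s => Φ s (τ ^ 2)) x v,
    ← oneForm_chart_symm_center (fluxForm g fun s => Φ s (0 ^ 2)) x v,
    hΦ.fluxForm_chart_symm hg he hτ hz, hΦ.fluxForm_chart_symm hg he h0' hz]
  linear_combination -hftc

end Variation

/-! ### Exactness of the change of the flux form -/

section Class

variable {g : Metric S} {T : EReal} {φ f_ : ℝ → S → S} {Φ : ℝ → ℝ → S → S} {f : S → S}

theorem IsIsotopyAlongFlow.isExactForm_flux_sub (hΦ : IsIsotopyAlongFlow g T φ f_ Φ)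
    (hflow : IsMeanCurvatureFlow g f T f_) (hg : IsConformal g) {c : ℝ}
    (hc : HasConstantCurvature g c) (hM : HasZeroMaslovClass g f)
    (hφ : IsSymplecticIsotopy g φ f) {τ : ℝ} (hτ : τ ∈ sqrtDomain T) (h0 : 0 ≤ τ) :
    IsExactForm fun x v => fluxForm g (fun s => Φ s (τ ^ 2)) x v - fluxForm g φ x v := by
  obtain ⟨y, hy, hy0, hy'⟩ := exists_weight c
  -- Here y is evaluated at the time remaining until t = τ², so y(0) = 0 gives w(τ) = 0 and y' = 1 +
  -- cy gives the equation required of w.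
  set w : ℝ → ℝ := fun r => y (τ ^ 2 - r ^ 2) with hw
  have hws : ContDiff ℝ ∞ w := hy.comp (contDiff_const.sub (contDiff_id.pow 2))
  have hw' : ∀ r, HasDerivAt w (-(2 * r) * (1 + c * w r)) r := by
    intro r
    have h1 : HasDerivAt (fun r : ℝ => τ ^ 2 - r ^ 2) _ r := (hasDerivAt_pow 2 r).const_sub (τ ^ 2)
    have h2 : HasDerivAt w _ r := (hy' (τ ^ 2 - r ^ 2)).comp r h1
    convert! h2 using 1
    simp only [hw]
    push_cast
    ring
  have hwτ : w τ = 0 := by simp [hw, hy0]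
  have hfs : IsSymplectomorphism g f := hφ.one ▸ hφ.symplectic 1 (by simp)
  obtain ⟨K, hK, hK'⟩ := hM.exists_mfderiv_eq_phaseForm hg hfs
  set P : S → ℝ := fun x => ∫ r in (0 : ℝ)..τ, (sweptAreaAt g Φ r x - w r * phaseRate g f_ r x)
    with hP'
  have hsub := uIcc_subset_sqrtDomain hτ
  have hPe : ∀ e ∈ atlas ℂ S, ∀ z ∈ e.target,
      P (e.symm z) = ∫ r in (0 : ℝ)..τ, fluxPotential g Φ f_ w e (r, z) := by
    intro e he z hz
    refine intervalIntegral.integral_congr fun r hr => ?_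
    simp only [fluxPotential]
    rw [hΦ.sweptAreaAt_chart_symm he (hsub hr) hz,
      phaseRate_chart_symm hg hflow.smooth he (hsub hr) hz]
  have hP : ContMDiff 𝓘(ℝ, ℂ) 𝓘(ℝ, ℝ) ∞ P := contMDiff_of_contDiffOn_chart_symm fun e he =>
    (contDiffOn_intervalIntegral_prod (isOpen_sqrtDomain T) hsub e.open_target
      (hΦ.contDiffOn_fluxPotential hflow hg hws he)).congr (hPe e he)
  -- The function K is a primitive of the Maslov form (2/π)θ_0, so π/2 restores θ_0. The function P
  -- is the time integral of the flux potential and is defined without reference to a chart.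
  refine ⟨fun x => -(w 0 * (Real.pi / 2)) * K x + P x, (contMDiff_const.mul hK).add hP,
    fun x v => ?_⟩
  refine Eq.trans ?_ (hΦ.flux_sub_flux_zero hflow hg hc hws hw' hwτ hφ hτ h0 x v).symm
  set e := chartAt ℂ x with he'
  have he : e ∈ atlas ℂ S := chart_mem_atlas ℂ x
  have hz : e x ∈ e.target := mem_chart_target ℂ x
  have hKd : MDifferentiableAt 𝓘(ℝ, ℂ) 𝓘(ℝ, ℝ) K x := hK.mdifferentiableAt (by simp)
  have hPd : MDifferentiableAt 𝓘(ℝ, ℂ) 𝓘(ℝ, ℝ) P x := hP.mdifferentiableAt (by simp)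
  have hPv : (mfderiv 𝓘(ℝ, ℂ) 𝓘(ℝ, ℝ) P x v : ℝ) =
      ∫ r in (0 : ℝ)..τ, fderiv ℝ (fluxPotential g Φ f_ w e) (r, e x) (0, v) := by
    have h1 : (mfderiv 𝓘(ℝ, ℂ) 𝓘(ℝ, ℝ) P x v : ℝ) = _ :=
      DFunLike.congr_fun (mfderiv_eq_fderiv_chart_symm hPd) v
    have hG := hΦ.contDiffOn_fluxPotential hflow hg hws he
    have h2 := hasFDerivAt_intervalIntegral_prod (isOpen_sqrtDomain T) hsub e.open_target hG hz
    have h3 : (fun z => P (e.symm z)) =ᶠ[𝓝 (e x)]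
        fun z => ∫ r in (0 : ℝ)..τ, fluxPotential g Φ f_ w e (r, z) := by
      filter_upwards [e.open_target.mem_nhds hz] with z hz using hPe e he z hz
    have hW : IsOpen (sqrtDomain T ×ˢ e.target) := (isOpen_sqrtDomain T).prod e.open_target
    have h4 : ContinuousOn (fun r => (fderiv ℝ (fluxPotential g Φ f_ w e) (r, e x)).comp
        (ContinuousLinearMap.inr ℝ ℝ ℂ)) (uIcc 0 τ) :=
      ((hG.continuousOn_fderiv_of_isOpen hW (by simp)).comp (by fun_prop)
        (fun r hr => ⟨hsub hr, hz⟩)).clm_comp continuousOn_const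
    rw [h1, h3.fderiv_eq, h2.fderiv]
    refine (ContinuousLinearMap.intervalIntegral_apply h4.intervalIntegrable (v : ℂ)).trans ?_
    rfl
  have hsum : ∀ a b : ℝ, (mfderiv 𝓘(ℝ, ℂ) 𝓘(ℝ, ℝ) K x v : ℝ) = a →
      (mfderiv 𝓘(ℝ, ℂ) 𝓘(ℝ, ℝ) P x v : ℝ) = b →
      (mfderiv 𝓘(ℝ, ℂ) 𝓘(ℝ, ℝ) (fun x => -(w 0 * (Real.pi / 2)) * K x + P x) x v : ℝ) =
        -(w 0 * (Real.pi / 2)) * a + b := by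
    rintro _ _ rfl rfl
    have h1 := (hKd.hasMFDerivAt.const_smul (-(w 0 * (Real.pi / 2)))).add hPd.hasMFDerivAt
    exact DFunLike.congr_fun h1.mfderiv v
  refine (hsum _ _ (hK' x v) hPv).trans ?_
  have := Real.pi_ne_zero
  field_simp

end Class

/-! ### Isotopies along the flow -/

section Existence

variable {g : Metric S} {T : EReal} {φ f_ : ℝ → S → S} {f h : S → S}

theorem IsSymplectomorphism.comp (hh : IsSymplectomorphism g h) (hf : IsSymplectomorphism g f) :
    IsSymplectomorphism g (h ∘ f) := by
  have hd : ∀ x, mfderiv 𝓘(ℝ, ℂ) 𝓘(ℝ, ℂ) (h ∘ f) x =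
      (mfderiv 𝓘(ℝ, ℂ) 𝓘(ℝ, ℂ) h (f x)).comp (mfderiv 𝓘(ℝ, ℂ) 𝓘(ℝ, ℂ) f x) := fun x =>
    mfderiv_comp x (hh.mdifferentiableAt (f x)) (hf.mdifferentiableAt x)
  refine ⟨?_, fun x u v => ?_⟩
  · obtain ⟨A, hA⟩ := hh.1
    obtain ⟨B, hB⟩ := hf.1
    exact ⟨B.trans A, by rw [← hA, ← hB]; rfl⟩
  · rw [hd]
    exact (hh.2 (f x) _ _).trans (hf.2 x u v)

theorem IsSymplectomorphism.symm {A : S ≃ₘ^∞⟮𝓘(ℝ, ℂ), 𝓘(ℝ, ℂ)⟯ S}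
    (hA : IsSymplectomorphism g A) : IsSymplectomorphism g A.symm := by
  refine ⟨⟨A.symm, rfl⟩, fun x u v => ?_⟩
  have hs : MDifferentiableAt 𝓘(ℝ, ℂ) 𝓘(ℝ, ℂ) A.symm x :=
    A.symm.contMDiff.mdifferentiableAt (by simp)
  have hd : ∀ u : ℂ, mfderiv 𝓘(ℝ, ℂ) 𝓘(ℝ, ℂ) (A ∘ A.symm) x u =
      mfderiv 𝓘(ℝ, ℂ) 𝓘(ℝ, ℂ) A (A.symm x) (mfderiv 𝓘(ℝ, ℂ) 𝓘(ℝ, ℂ) A.symm x u) := fun u =>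
    DFunLike.congr_fun (mfderiv_comp x (hA.mdifferentiableAt _) hs) u
  have hid : (A ∘ A.symm : S → S) = id := funext fun y => A.apply_symm_apply y
  refine (hA.2 (A.symm x) _ _).symm.trans ?_
  have key : ∀ k : S → S, k = id → areaForm g (k x) (mfderiv 𝓘(ℝ, ℂ) 𝓘(ℝ, ℂ) k x u)
      (mfderiv 𝓘(ℝ, ℂ) 𝓘(ℝ, ℂ) k x v) = areaForm g x u v := by
    rintro k rfl
    rw [mfderiv_id]
    rfl
  have h1 := key _ hid
  rw [hd u, hd v] at h1
  exact h1

/-- Take f_{st} ∘ f⁻¹ ∘ φ_s. It is the identity at s = 0, f_t at s = 1 and φ_s at t = 0, and st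
stays in [0, T) because 0 ≤ st ≤ t. -/
theorem exists_isIsotopyAlongFlow (hflow : IsMeanCurvatureFlow g f T f_)
    (hφ : IsSymplecticIsotopy g φ f) :
    ∃ Φ : ℝ → ℝ → S → S, IsIsotopyAlongFlow g T φ f_ Φ := by
  have hf : IsSymplectomorphism g f := hφ.one ▸ hφ.symplectic 1 (by simp)
  obtain ⟨A, rfl⟩ := hf.1
  have hmul : ∀ s ∈ Icc (0 : ℝ) 1, ∀ t ∈ timeInterval T, s * t ∈ timeInterval T :=
    fun s hs t ht => ⟨mul_nonneg hs.1 ht.1, lt_of_le_of_lt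
      (EReal.coe_le_coe_iff.2 (mul_le_of_le_one_left ht.1 hs.2)) ht.2⟩
  have hsm : ContMDiffOn (𝓘(ℝ, ℝ).prod (𝓘(ℝ, ℝ).prod 𝓘(ℝ, ℂ))) 𝓘(ℝ, ℂ) ∞
      (fun q : ℝ × ℝ × S => f_ (q.1 * q.2.1) (A.symm (φ q.1 q.2.2)))
      (Icc 0 1 ×ˢ timeInterval T ×ˢ univ) := by
    have h1 : ContMDiffOn (𝓘(ℝ, ℝ).prod (𝓘(ℝ, ℝ).prod 𝓘(ℝ, ℂ))) 𝓘(ℝ, ℂ) ∞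
        (fun q : ℝ × ℝ × S => φ q.1 q.2.2) (Icc 0 1 ×ˢ timeInterval T ×ˢ univ) :=
      hφ.smooth.comp (contMDiff_fst.prodMk (contMDiff_snd.comp contMDiff_snd)).contMDiffOn
        fun q hq => ⟨hq.1, mem_univ _⟩
    have h2 := A.symm.contMDiff.comp_contMDiffOn h1
    have h3 : ContMDiff (𝓘(ℝ, ℝ).prod (𝓘(ℝ, ℝ).prod 𝓘(ℝ, ℂ))) 𝓘(ℝ, ℝ) ∞
        (fun q : ℝ × ℝ × S => q.1 * q.2.1) :=
      contMDiff_fst.mul (contMDiff_fst.comp contMDiff_snd)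
    exact hflow.smooth.comp (h3.contMDiffOn.prodMk h2) fun q hq =>
      ⟨hmul _ hq.1 _ hq.2.1, mem_univ _⟩
  refine ⟨fun s t x => f_ (s * t) (A.symm (φ s x)), hsm, fun t ht => ⟨?_, fun s hs => ?_, ?_, ?_⟩,
    fun s _ => ?_⟩
  · exact hsm.comp (contMDiff_fst.prodMk (contMDiff_const.prodMk contMDiff_snd)).contMDiffOn
      fun q hq => ⟨hq.1, ht, mem_univ _⟩
  · exact (hflow.symplectic _ (hmul s hs t ht)).comp (hf.symm.comp (hφ.symplectic s hs))
  · funext x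
    simp [hφ.zero, hflow.zero]
  · funext x
    simp [hφ.one]
  · funext x
    simp [hflow.zero]

end Existence

end RiemannSurface

end

theorem proposition3p3 {S : Type*} [TopologicalSpace S] [T2Space S] [CompactSpace S]
    [ConnectedSpace S] [ChartedSpace ℂ S] [IsManifold 𝓘(ℂ) ω S]
    (g : RiemannSurface.Metric S) (hg : RiemannSurface.IsConformal g)
    (c : ℝ) (hc : RiemannSurface.HasConstantCurvature g c)
    (f : S → S) (hf : RiemannSurface.IsHamiltonian g f)
    (hM : RiemannSurface.HasZeroMaslovClass g f)
    (T : EReal) (hT : 0 < T) (f_ : ℝ → S → S)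
    (hflow : RiemannSurface.IsMeanCurvatureFlow g f T f_)
    (φ : ℝ → S → S) (hφ : RiemannSurface.IsSymplecticIsotopy g φ f) :
    (∃ Φ : ℝ → ℝ → S → S, RiemannSurface.IsIsotopyAlongFlow g T φ f_ Φ) ∧
      ∀ Φ : ℝ → ℝ → S → S, RiemannSurface.IsIsotopyAlongFlow g T φ f_ Φ →
        ∀ t ∈ RiemannSurface.timeInterval T,
          RiemannSurface.SameClass (RiemannSurface.fluxForm g (fun s => Φ s t))
            (RiemannSurface.fluxForm g φ) := by
  refine ⟨RiemannSurface.exists_isIsotopyAlongFlow hflow hφ, fun Φ hΦ t ht =>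
    ⟨(hΦ.isotopy t ht).isClosedForm_fluxForm hg, hφ.isClosedForm_fluxForm hg, ?_⟩⟩
  -- The time t corresponds to r = √t in the substituted parameter.
  have h := hΦ.isExactForm_flux_sub hflow hg hc hM hφ (τ := √t)
    (by simpa only [RiemannSurface.sqrtDomain, mem_ofPred_eq, Real.sq_sqrt ht.1] using ht.2)
    (Real.sqrt_nonneg t)
  rwa [Real.sq_sqrt ht.1] at h
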